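/- Let $n\ge 2$. Let $H_n=\mathbb R^{2n}\times\mathbb R$ be the Heisenberg group, with points $(z,t)$, $z=(x,y)$, group law $(x,y,t)\circ(x',y',t')=\bigl(x+x',\,y+y',\,t+t'+\sum_j(y_jx'_j-x_jy'_j)\bigr)$, contact form $\Theta=dt+\sum_j(x_j\,dy_j-y_j\,dx_j)$, contact planes $\xi=\ker\Theta$, left invariant frame $\mathring e_j=\partial_{x_j}+y_j\partial_t$, $\mathring e_{n+j}=\partial_{y_j}-x_j\partial_t$, $T=\partial_t$, complex structure $J\mathring e_j=\mathring e_{n+j}$, $J\mathring e_{n+j}=-\mathring e_j$ on $\xi$, Levi metric $\sum_j(dx_j^2+dy_j^2)$ on $\xi$, and the connection $\nabla$ with $\nabla\mathring e_a=\nabla T=0$. Let $\Sigma$ be an immersed $C^2$ hypersurface of $H_n$. A point of $\Sigma$ is singular if $\xi=T\Sigma$ there and regular otherwise; assume that $\Sigma$ is $C^\infty$ on its regular part. At regular points put $\xi'=(\xi\cap T\Sigma)\cap J(\xi\cap T\Sigma)$, let $e_n$ be a local $C^1$ unit vector field in $(\xi\cap T\Sigma)\cap(\xi')^{\perp}$ (unique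 up to sign), $e_{2n}=Je_n$, let $\alpha$ be the function with $\alpha e_{2n}+T\in T\Sigma$, let $l=\langle-\nabla_{e_n}e_{2n},e_n\rangle$, and let $\mathfrak S(v)=-\nabla_ve_{2n}+\alpha J'v$ for $v\in\xi\cap T\Sigma$, where $J'=J$ on $\xi'$ and $J'e_n=0$. A regular point is umbilic if $\mathfrak S(\xi')\subset\xi'$ and all eigenvalues of $\mathfrak S$ on $\xi'$ are equal; their common value is denoted by $k$. ($\mathfrak S$ is symmetric; replacing $e_n$ by $-e_n$ changes the signs of $k$, $l$ and $\alpha$ simultaneously.) $\Sigma$ is umbilic if all its regular points are umbilic. For $\lambda>0$ the Pansu sphere $S_\lambda$ is the union of the graphs of $f$ and $-f$, where $$f(z)=\frac1{2\lambda^2}\Bigl(\lambda|z|\sqrt{1-\lambda^2|z|^2}+\arccos(\lambda|z|)\Bigr),\qquad |z|\le\frac1\lambda .$$ **Theorem.** Suppose that $\Sigma$ is closed (compact without boundary), connected and umbilic, and that $l=2k$ on its regular part. Then there is a $\lambda>0$ such that, after a Heisenberg (left) translation, $\Sigma$ coincides with the Pansu sphere $S_\lambda$ (in particular $\Sigma$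 is embedded), and $\lambda=k$ on the whole regular part of $\Sigma$ for a suitable global $C^1$ choice of $e_n$ there. -/

import Mathlib

open scoped Manifold ContDiff

noncomputable section

namespace Heis

/-- The space `ℝ^{2n}` of horizontal components. The coordinate `Sum.inl j` is `x_j` and
`Sum.inr j` is `y_j`. It carries the Euclidean inner product. -/
abbrev E (n : ℕ) : Type := EuclideanSpace ℝ (Fin n ⊕ Fin n)

/-- The Heisenberg group `H_n` as the manifold `ℝ^{2n+1}`, with points `(z, t)`, `z = (x, y)`.
A tangent vector at a point is written in the coordinates `∂/∂x_j, ∂/∂y_j, ∂/∂t`, so it is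
again an element of `ℝ^{2n} × ℝ`. -/
abbrev H (n : ℕ) : Type := E n × ℝ

/-- The group law
`(x, y, t) ∘ (x', y', t') = (x + x', y + y', t + t' + ∑ j, (y_j x'_j - x_j y'_j))`. -/
def mul {n : ℕ} (p q : H n) : H n :=
  (p.1 + q.1,
    p.2 + q.2 + ∑ j : Fin n, (p.1 (Sum.inr j) * q.1 (Sum.inl j) - p.1 (Sum.inl j) * q.1 (Sum.inr j)))

/-- The contact form `Θ = dt + ∑ j, (x_j dy_j - y_j dx_j)` at the point `q`. -/
def contactForm {n : ℕ} (q : H n) : H n →ₗ[ℝ] ℝ where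
  toFun v := v.2 + ∑ j : Fin n, (q.1 (Sum.inl j) * v.1 (Sum.inr j) - q.1 (Sum.inr j) * v.1 (Sum.inl j))
  map_add' v w := by
    have h : ∀ j : Fin n, q.1 (Sum.inl j) * (v + w).1 (Sum.inr j)
        - q.1 (Sum.inr j) * (v + w).1 (Sum.inl j)
        = (q.1 (Sum.inl j) * v.1 (Sum.inr j) - q.1 (Sum.inr j) * v.1 (Sum.inl j))
          + (q.1 (Sum.inl j) * w.1 (Sum.inr j) - q.1 (Sum.inr j) * w.1 (Sum.inl j)) := by
      intro j
      simp only [Prod.fst_add, PiLp.add_apply]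
      ring
    simp only [h, Finset.sum_add_distrib, Prod.snd_add]
    ring
  map_smul' c v := by
    have h : ∀ j : Fin n, q.1 (Sum.inl j) * (c • v).1 (Sum.inr j)
        - q.1 (Sum.inr j) * (c • v).1 (Sum.inl j)
        = c * (q.1 (Sum.inl j) * v.1 (Sum.inr j) - q.1 (Sum.inr j) * v.1 (Sum.inl j)) := by
      intro j
      simp only [Prod.smul_fst, PiLp.smul_apply, smul_eq_mul]
      ring
    simp only [h, ← Finset.mul_sum, Prod.smul_snd, smul_eq_mul, RingHom.id_apply]
    ring

/-- The contact plane `ξ_q = ker Θ_q`. -/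
def contactPlane {n : ℕ} (q : H n) : Submodule ℝ (H n) := LinearMap.ker (contactForm q)

/-- The left invariant horizontal fields are `e̊_j = ∂/∂x_j + y_j ∂/∂t` and
`e̊_{n+j} = ∂/∂y_j - x_j ∂/∂t`. This is the vector `∑ j, (a_j e̊_j + a_{n+j} e̊_{n+j})` at `q`.
The map `frameVec q` identifies `ℝ^{2n}` with `ξ_q`, and the Levi metric
`∑ j, (dx_j^2 + dy_j^2)` on `ξ_q` with the Euclidean inner product. From here on, vectors of `ξ_q`
are written through their components `a` in this frame. -/
def frameVec {n : ℕ} (q : H n) : E n →ₗ[ℝ] H n where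
  toFun a :=
    (a, ∑ j : Fin n, (a (Sum.inl j) * q.1 (Sum.inr j) - a (Sum.inr j) * q.1 (Sum.inl j)))
  map_add' a b := by
    refine Prod.ext rfl ?_
    simp only [Prod.snd_add, ← Finset.sum_add_distrib, PiLp.add_apply]
    exact Finset.sum_congr rfl fun j _ => by ring
  map_smul' c a := by
    refine Prod.ext rfl ?_
    simp only [Prod.smul_snd, smul_eq_mul, Finset.mul_sum, PiLp.smul_apply, RingHom.id_apply]
    exact Finset.sum_congr rfl fun j _ => by ring

/-- The vector field `T = ∂/∂t`. -/
def T (n : ℕ) : H n := (0, 1)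

/-- The CR structure `J e̊_j = e̊_{n+j}`, `J e̊_{n+j} = -e̊_j`, in components. -/
def J {n : ℕ} : E n →ₗ[ℝ] E n where
  toFun a := WithLp.toLp 2 (Sum.elim (fun j => -a (Sum.inr j)) (fun j => a (Sum.inl j)))
  map_add' a b := by
    ext (j | j) <;> simp [add_comm]
  map_smul' c a := by
    ext (j | j) <;> simp

section Hypersurface

variable {n : ℕ} {M : Type*} [TopologicalSpace M] [ChartedSpace (EuclideanSpace ℝ (Fin (2 * n))) M]

/-- A `C^2` immersion of a `2n`-dimensional manifold into `H_n`, that is, an immersed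
hypersurface `Σ`. -/
def IsImmersedHypersurface (ι : M → H n) : Prop :=
  ContMDiff (𝓡 (2 * n)) 𝓘(ℝ, H n) 2 ι ∧
    ∀ p : M, Function.Injective (mfderiv (𝓡 (2 * n)) 𝓘(ℝ, H n) ι p)

/-- The tangent space `T_pΣ`, as a subspace of the tangent space of `H_n` at `ι p`. -/
def tangent (ι : M → H n) (p : M) : Submodule ℝ (H n) :=
  LinearMap.range (mfderiv (𝓡 (2 * n)) 𝓘(ℝ, H n) ι p).toLinearMap

/-- The regular part of `Σ`: the points with `ξ ≠ TΣ`. The other points are the singular ones. -/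
def regularSet (ι : M → H n) : Set M := {p | tangent ι p ≠ contactPlane (ι p)}

/-- The regular part of the immersed hypersurface is `C^∞` smooth: near each regular point it is
given by a `C^∞` local defining function. -/
def IsSmoothOnRegularPart (ι : M → H n) : Prop :=
  ∀ p ∈ regularSet ι, ∃ (V : Set (H n)) (u : H n → ℝ), IsOpen V ∧ ι p ∈ V ∧
    ContDiffOn ℝ ∞ u V ∧ (∀ q ∈ V, fderiv ℝ u q ≠ 0) ∧ ∀ᶠ q in nhds p, u (ι q) = 0

/-- `ξ ∩ TΣ` at `p`, in components. -/
def horTangent (ι : M → H n) (p : M) : Submodule ℝ (E n) :=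
  (tangent ι p).comap (frameVec (ι p))

/-- `ξ' = (ξ ∩ TΣ) ∩ J(ξ ∩ TΣ)` at `p`. -/
def xiPrime (ι : M → H n) (p : M) : Submodule ℝ (E n) :=
  horTangent ι p ⊓ (horTangent ι p).map J

/-- `e` is a choice of the vector field `e_n` on the open set `U` of regular points: a unit field
in `(ξ ∩ TΣ) ∩ (ξ')^⊥`. Locally there are exactly two such choices, `e` and `-e`. -/
def IsCharField (ι : M → H n) (U : Set M) (e : M → E n) : Prop :=
  IsOpen U ∧ U ⊆ regularSet ι ∧ ContMDiffOn (𝓡 (2 * n)) 𝓘(ℝ, E n) 1 e U ∧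
    ∀ q ∈ U, e q ∈ horTangent ι q ∧ e q ∈ (xiPrime ι q)ᗮ ∧ ‖e q‖ = 1

/-- `∇_v F` for `v ∈ ξ ∩ TΣ` at `p` and a horizontal vector field `F` along `Σ`. Since
the pseudohermitian connection of `H_n` satisfies `∇ e̊_a = 0`, this is the derivative of the
components of `F` in the direction of the vector of `T_pM` that `dι` maps to `v`. -/
def nabla (ι : M → H n) (p : M) (v : E n) (F : M → E n) : E n :=
  mfderiv (𝓡 (2 * n)) 𝓘(ℝ, E n) F p
    (Function.invFun (mfderiv (𝓡 (2 * n)) 𝓘(ℝ, H n) ι p) (frameVec (ι p) v))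

/-- The horizontal normal `e_{2n} = J e_n` that belongs to the choice `e` of `e_n`. -/
def horNormal (e : M → E n) : M → E n := fun q => J (e q)

/-- The function `α`, determined at regular points by `α e_{2n} + T ∈ TΣ`. -/
def alpha (ι : M → H n) (e : M → E n) (p : M) : ℝ :=
  Classical.epsilon fun a : ℝ => a • frameVec (ι p) (horNormal e p) + T n ∈ tangent ι p

/-- The operator `J'` on `ξ ∩ TΣ = ξ' ⊕ ℝ e_n`, equal to `J` on `ξ'` and with `J' e_n = 0`. -/
def Jprime (e : M → E n) (p : M) (v : E n) : E n := J (v - inner ℝ (e p) v • e p)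

/-- The shape operator `v ↦ -∇_v e_{2n} + α J' v` on `ξ ∩ TΣ`. -/
def shape (ι : M → H n) (e : M → E n) (p : M) (v : E n) : E n :=
  -nabla ι p v (horNormal e) + alpha ι e p • Jprime e p v

/-- The function `l`, with `-∇_{e_n} e_{2n} = l e_n` modulo `ξ'`. -/
def ell (ι : M → H n) (e : M → E n) (p : M) : ℝ :=
  inner ℝ (-nabla ι p (e p) (horNormal e)) (e p)

/-- With respect to the choice `e` of `e_n`, the shape operator maps `ξ'` to itself at `p`, and all
its eigenvalues on `ξ'` (where it is symmetric) are equal to `k`, so that it is `k` times the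
identity there. -/
def IsUmbilicWith (ι : M → H n) (e : M → E n) (p : M) (k : ℝ) : Prop :=
  (∀ v ∈ xiPrime ι p, shape ι e p v ∈ xiPrime ι p) ∧
    ∀ v ∈ xiPrime ι p, shape ι e p v = k • v

/-- All regular points of `Σ` are umbilic. The condition at a point does not depend on the local
choice of `e_n`; passing from `e` to `-e` changes the sign of `k`. -/
def IsUmbilic (ι : M → H n) : Prop :=
  ∀ p ∈ regularSet ι, ∃ (U : Set M) (e : M → E n) (k : ℝ),
    p ∈ U ∧ IsCharField ι U e ∧ IsUmbilicWith ι e p k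

/-- The condition `l = 2k` on the regular part. It does not depend on the local choice of `e_n`,
since `l` and `k` change sign together. -/
def EllEqTwoK (ι : M → H n) : Prop :=
  ∀ p ∈ regularSet ι, ∀ (U : Set M) (e : M → E n) (k : ℝ),
    p ∈ U → IsCharField ι U e → IsUmbilicWith ι e p k → ell ι e p = 2 * k

end Hypersurface

/-- The function `f(z) = (1 / (2 λ^2)) (λ |z| √(1 - λ^2 |z|^2) + arccos (λ |z|))`. -/
def pansuFun {n : ℕ} (lam : ℝ) (z : E n) : ℝ :=
  1 / (2 * lam ^ 2) *
    (lam * ‖z‖ * Real.sqrt (1 - lam ^ 2 * ‖z‖ ^ 2) + Real.arccos (lam * ‖z‖))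

/-- The Pansu sphere `S_λ`: the union of the graphs of `f` and `-f` over `|z| ≤ 1 / λ`. -/
def pansuSphere (n : ℕ) (lam : ℝ) : Set (H n) :=
  {q | ‖q.1‖ ≤ 1 / lam ∧ (q.2 = pansuFun lam q.1 ∨ q.2 = -pansuFun lam q.1)}

end Heis

end

noncomputable section

namespace Heis

open Set Filter Topology

/-! ### Linear algebra of `J`, the contact form and tangent hyperplanes. -/

section Algebra

variable {n : ℕ}

/-! Near a regular point the tangent planes of Σ are {X : ⟨N, X⟩ = a Θ(X)}, where N = e_{2n} and a =
α. The manifold is only C², but a local defining function is C^∞; hence N and a are taken as smooth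
functions on an open subset of H_n (`exists_isLocalFrame`), and identities valid along Σ are
differentiated in tangent directions only. Umbilicity, l = 2k and the Frobenius identity express dN
on all horizontal tangent vectors through a and k. Commuting two such derivatives (`codazzi`) gives
dk = 0 and da = (a² + k²)⟨JN, ·⟩ on horizontal tangent vectors. As n ≥ 2, ξ' contains a pair v, Jv,
whose bracket is transverse to the contact planes, so a function stationary in the horizontal
tangent directions is stationary along Σ (`fderiv_eq_zero_of_horizontal`). Therefore k is locally
constant. If k = λ > 0 (the sign is a choice of N), the point c = z + (a JN + λN)/(a² + λ²) and the
height t + ⟨Jc, z⟩ minus an explicit function of a are locally constant too. These first integrals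
say that Σ is locally a piece of a translate of S_λ.

Such a piece exists: at a point farthest from the t-axis the plane is vertical, and k = 0 would
contradict the second derivative test (`exists_mem_pansuPart_of_compact`). The set of points with
given λ, c, t is open, and closed in the regular part. Since a² + λ² = |z - c|⁻², the slope is
bounded away from the axis over c, whereas it blows up at singular points; so singular limit points
lie over c. There Σ is a graph over the horizontal plane, so a small punctured neighborhood is
connected and avoids the axis, and the piece continues across (`mem_pansuPart_or`). Hence every
point of Σ is on the same Pansu sphere.

Finally, the recentered immersion is a local homeomorphism into the sphere
(`isLocalHomeomorph_recenter`), hence a covering by compactness, and the sphere has no nontrivial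
connected coverings (`bijective_of_isLocalHomeomorph`). This gives embeddedness and equality with
S_λ. -/

lemma inner_def (a b : E n) :
    inner ℝ a b = ∑ j : Fin n, (a (Sum.inl j) * b (Sum.inl j) + a (Sum.inr j) * b (Sum.inr j)) := by
  rw [PiLp.inner_apply, Fintype.sum_sum_type, ← Finset.sum_add_distrib]
  refine Finset.sum_congr rfl fun j _ => ?_
  simp [mul_comm]

lemma J_inl (a : E n) (j : Fin n) : J a (Sum.inl j) = -a (Sum.inr j) := rfl

lemma J_inr (a : E n) (j : Fin n) : J a (Sum.inr j) = a (Sum.inl j) := rfl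

lemma J_J (a : E n) : J (J a) = -a := by
  ext (j | j) <;> simp [J_inl, J_inr]

lemma inner_J_left (a b : E n) : inner ℝ (J a) b = -inner ℝ a (J b) := by
  rw [inner_def, inner_def, ← Finset.sum_neg_distrib]
  refine Finset.sum_congr rfl fun j _ => ?_
  simp only [J_inl, J_inr]; ring

lemma inner_J_J (a b : E n) : inner ℝ (J a) (J b) = inner ℝ a b := by
  rw [inner_J_left, J_J, inner_neg_right, neg_neg]

lemma inner_J_self (a : E n) : inner ℝ (J a) a = 0 := by
  have h := inner_J_left a a
  rw [real_inner_comm a (J a)] at *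
  linarith [real_inner_comm (J a) a]

lemma inner_self_J (a : E n) : inner ℝ a (J a) = 0 := by
  rw [real_inner_comm, inner_J_self]

lemma norm_J (a : E n) : ‖J a‖ = ‖a‖ := by
  rw [@norm_eq_sqrt_real_inner _ _ _ (J a), inner_J_J, ← @norm_eq_sqrt_real_inner]

/-- `J` as a continuous linear map. -/
def JL : E n →L[ℝ] E n := LinearMap.toContinuousLinearMap J

@[simp] lemma JL_apply (a : E n) : JL a = J a := rfl

lemma frameVec_eq (q : H n) (a : E n) : frameVec q a = (a, inner ℝ (J a) q.1) := by
  refine Prod.ext rfl ?_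
  change _ = (inner ℝ (J a) q.1 : ℝ)
  rw [inner_def (J a) q.1]
  change ∑ j : Fin n, (_ - _) = _
  refine Finset.sum_congr rfl fun j _ => ?_
  simp only [J_inl, J_inr]; ring

lemma contactForm_eq (q v : H n) : contactForm q v = v.2 + inner ℝ (J q.1) v.1 := by
  change v.2 + _ = _
  rw [inner_def]
  congr 1
  refine Finset.sum_congr rfl fun j _ => ?_
  simp only [J_inl, J_inr]; ring

lemma mul_eq (p q : H n) : mul p q = (p.1 + q.1, p.2 + q.2 - inner ℝ (J p.1) q.1) := by
  refine Prod.ext rfl ?_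
  change p.2 + q.2 + _ = _
  rw [inner_def, sub_eq_add_neg, ← Finset.sum_neg_distrib]
  congr 1
  refine Finset.sum_congr rfl fun j _ => ?_
  simp only [J_inl, J_inr]; ring

lemma inner_J_swap (a b : E n) : inner ℝ (J a) b = -inner ℝ (J b) a := by
  rw [inner_J_left, real_inner_comm]

lemma contactForm_frameVec (q : H n) (a : E n) : contactForm q (frameVec q a) = 0 := by
  rw [contactForm_eq, frameVec_eq, inner_J_swap q.1]
  simp

lemma contactForm_T (q : H n) : contactForm q (T n) = 1 := by
  simp [contactForm_eq, T]

lemma frameVec_add_contactForm (q v : H n) :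
    frameVec q v.1 + contactForm q v • T n = v := by
  refine Prod.ext (by simp [frameVec_eq, T]) ?_
  simp [frameVec_eq, T, contactForm_eq, inner_J_swap q.1]

/-- The tangent hyperplane with horizontal normal `N` and slope `a`. -/
def tanPlane (q : H n) (N : E n) (a : ℝ) : Submodule ℝ (H n) where
  carrier := {X | inner ℝ N X.1 = a * contactForm q X}
  add_mem' := by
    intro X Y hX hY
    simp only [Set.mem_ofPred_eq, Prod.fst_add, inner_add_right, map_add] at *
    rw [hX, hY]; ring
  zero_mem' := by simp
  smul_mem' := by
    intro c X hX
    simp only [Set.mem_ofPred_eq, Prod.smul_fst, inner_smul_right, map_smul, smul_eq_mul] at *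
    rw [hX]; ring

lemma mem_tanPlane {q : H n} {N : E n} {a : ℝ} {X : H n} :
    X ∈ tanPlane q N a ↔ inner ℝ N X.1 = a * contactForm q X := Iff.rfl

lemma frameVec_mem_tanPlane {q : H n} {N : E n} {a : ℝ} {w : E n} :
    frameVec q w ∈ tanPlane q N a ↔ inner ℝ N w = 0 := by
  rw [mem_tanPlane, contactForm_frameVec, mul_zero, frameVec_eq]

lemma transverse_mem_tanPlane {q : H n} {N : E n} {a : ℝ} (hN : ‖N‖ = 1) :
    a • frameVec q N + T n ∈ tanPlane q N a := by
  rw [mem_tanPlane, map_add, map_smul, contactForm_frameVec, contactForm_T]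
  simp [frameVec_eq, T, inner_smul_right, hN]

/-- A unit vector orthogonal to `N` and `JN`. -/
lemma exists_unit_orthogonal (hn : 2 ≤ n) (N : E n) :
    ∃ v : E n, ‖v‖ = 1 ∧ inner ℝ N v = 0 ∧ inner ℝ (J N) v = 0 := by
  -- The hypothesis `2 ≤ n` enters here: the span of N and JN has dimension at most 2 < 2n.
  have hlt : Module.finrank ℝ (Submodule.span ℝ ({N, J N} : Set (E n))) < Module.finrank ℝ (E n) := by
    refine lt_of_le_of_lt (finrank_span_le_card _) ?_
    rw [finrank_euclideanSpace, Fintype.card_sum, Fintype.card_fin]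
    refine lt_of_le_of_lt ?_ (show 2 < n + n by omega)
    rw [Set.toFinset_insert, Set.toFinset_singleton]
    exact Finset.card_le_two
  have hne : (Submodule.span ℝ ({N, J N} : Set (E n)))ᗮ ≠ ⊥ := by
    intro h
    rw [Submodule.orthogonal_eq_bot_iff] at h
    rw [h, finrank_top] at hlt
    exact lt_irrefl _ hlt
  obtain ⟨v, hv, hv0⟩ := Submodule.exists_mem_ne_zero_of_ne_bot hne
  refine ⟨‖v‖⁻¹ • v, norm_smul_inv_norm hv0, ?_, ?_⟩ <;> rw [inner_smul_right]
  · rw [hv N (Submodule.subset_span (by simp)), mul_zero]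
  · rw [hv (J N) (Submodule.subset_span (by simp)), mul_zero]

end Algebra
end Heis

namespace Heis

open Set Filter Topology

/-! ### Brackets of tangent horizontal fields. -/

section Ambient

variable {n : ℕ}

/-- `a J v - a ⟨Jv, N⟩ N - k v + k ⟨Jv, N⟩ J N`, the derivative of the horizontal normal of an
umbilic hypersurface with `l = 2k` in the direction `v`. -/
def normalDeriv (N : E n) (a k : ℝ) (v : E n) : E n :=
  a • J v - (a * inner ℝ (J v) N) • N - k • v + (k * inner ℝ (J v) N) • J N

/-- The component of `v` orthogonal to the unit vector `N`. -/
def perp (N v : E n) : E n := v - inner ℝ v N • N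

lemma inner_perp {N : E n} (hN : ‖N‖ = 1) (v : E n) : inner ℝ N (perp N v) = 0 := by
  simp [perp, inner_sub_right, inner_smul_right, hN, real_inner_comm]

lemma perp_of_inner_eq_zero {N v : E n} (h : inner ℝ N v = 0) : perp N v = v := by
  simp [perp, real_inner_comm, h]

/-- The derivative of `normalDeriv (N q) (a q) (k q) (perp (N q) v)` along a curve, in terms of the
derivatives `N'`, `a'`, `k'`. -/
def normalDerivDeriv (N : E n) (a k : ℝ) (N' : E n) (a' k' : ℝ) (v : E n) : E n :=
  a' • (J v - inner ℝ (J v) N • N) - k' • (v - inner ℝ (J v) N • J N)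
    + a • (-(inner ℝ v N' • J N) - inner ℝ (J v) N' • N - inner ℝ (J v) N • N')
    + k • (inner ℝ v N' • N + inner ℝ (J v) N' • J N + inner ℝ (J v) N • J N')

lemma hasDerivAt_J {f : ℝ → E n} {f' : E n} {x : ℝ} (hf : HasDerivAt f f' x) :
    HasDerivAt (fun s => J (f s)) (J f') x :=
  (JL (n := n)).hasFDerivAt.comp_hasDerivAt x hf

lemma hasDerivAt_normalDeriv {N : ℝ → E n} {a k : ℝ → ℝ} {N' : E n} {a' k' : ℝ}
    (hN : HasDerivAt N N' 0) (ha : HasDerivAt a a' 0) (hk : HasDerivAt k k' 0) {v : E n}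
    (hv : inner ℝ (N 0) v = 0) :
    HasDerivAt (fun s => normalDeriv (N s) (a s) (k s) (perp (N s) v))
      (normalDerivDeriv (N 0) (a 0) (k 0) N' a' k' v) 0 := by
  have hv' : inner ℝ v (N 0) = 0 := by rw [real_inner_comm, hv]
  have h1 : HasDerivAt (fun s => inner ℝ v (N s)) (inner ℝ v N') 0 := by
    simpa using (hasDerivAt_const (0 : ℝ) v).inner ℝ hN
  have h2 : HasDerivAt (fun s => perp (N s) v) (-(inner ℝ v N' • N 0)) 0 := by
    have := (hasDerivAt_const (0 : ℝ) v).sub (h1.smul hN)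
    refine this.congr_deriv ?_
    simp [hv']
  have h3 := hasDerivAt_J h2
  have h4 := h3.inner ℝ hN
  have h5 := (((ha.smul h3).sub ((ha.mul h4).smul hN)).sub (hk.smul h2)).add
    ((hk.mul h4).smul (hasDerivAt_J hN))
  refine h5.congr_deriv ?_
  have hp : perp (N 0) v = v := perp_of_inner_eq_zero hv
  simp only [hp, normalDerivDeriv, map_neg, map_smul, inner_neg_left, inner_smul_left,
    inner_J_self, Pi.mul_apply]
  simp only [smul_add, smul_sub, smul_neg, smul_smul, add_smul]
  simp only [mul_zero, neg_zero, add_zero]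
  module

/-- The second derivatives of `F` along two vector fields commute up to their bracket. -/
lemma fderiv_fderiv_sub {F : Type*} [NormedAddCommGroup F] [NormedSpace ℝ F] {f : H n → F}
    {X Y : H n → H n} {q : H n} (hf : ContDiffAt ℝ 2 f q) (hX : DifferentiableAt ℝ X q)
    (hY : DifferentiableAt ℝ Y q) :
    fderiv ℝ (fun p => fderiv ℝ f p (X p)) q (Y q) - fderiv ℝ (fun p => fderiv ℝ f p (Y p)) q (X q)
      = fderiv ℝ f q (fderiv ℝ X q (Y q) - fderiv ℝ Y q (X q)) := by
  have hd : DifferentiableAt ℝ (fderiv ℝ f) q :=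
    (hf.fderiv_right (m := 1) (by norm_num)).differentiableAt (by norm_num)
  have hs := hf.isSymmSndFDerivAt (by simp) (X q) (Y q)
  rw [fderiv_clm_apply hd hX, fderiv_clm_apply hd hY, map_sub]
  simp [hs]

/-- The horizontal field `frameVec q (perp (N q) v)`, which is tangent to the hypersurface. -/
def tanField (N : H n → E n) (v : E n) (q : H n) : H n := frameVec q (perp (N q) v)

/-- Where v ⊥ N, the projection of v varies only in the direction of N; the multiple of T comes from
the rotation of the contact planes. So brackets of such fields lie in the span of N and T. -/
lemma hasFDerivAt_tanField {N : H n → E n} {q : H n} {N' : H n →L[ℝ] E n}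
    (hN : HasFDerivAt N N' q) {v : E n} (hv : inner ℝ (N q) v = 0) :
    ∃ L : H n →L[ℝ] H n, HasFDerivAt (tanField N v) L q ∧
      ∀ Y, L Y = frameVec q (-(inner ℝ v (N' Y) • N q)) + inner ℝ (J v) Y.1 • T n := by
  have hv' : inner ℝ v (N q) = 0 := by rw [real_inner_comm, hv]
  have h1 : HasFDerivAt (fun p => perp (N p) v) _ q :=
    (hasFDerivAt_const v q).sub (((hasFDerivAt_const v q).inner ℝ hN).smul hN)
  have h2 := (JL (n := n)).hasFDerivAt.comp q h1
  have h3 := h1.prodMk (h2.inner ℝ (hasFDerivAt_fst (𝕜 := ℝ) (p := q)))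
  refine ⟨_, h3.congr_of_eventuallyEq (Eventually.of_forall fun p => ?_), fun Y => ?_⟩
  · exact frameVec_eq _ _
  · have hp : perp (N q) v = v := perp_of_inner_eq_zero hv
    refine Prod.ext ?_ ?_
    · simp [frameVec_eq, T, hv']
    · simp [frameVec_eq, T, hv', hp]
      ring

/-- `S` is a piece of a hypersurface with horizontal unit normal `N`, slope `a` and
umbilicity `k`, all extended smoothly to the open set `V`. -/
structure IsUmbilicPiece (V S : Set (H n)) (N : H n → E n) (a k : H n → ℝ) : Prop where
  isOpen : IsOpen V
  subset : S ⊆ V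
  contDiffOn_N : ContDiffOn ℝ ∞ N V
  contDiffOn_a : ContDiffOn ℝ ∞ a V
  contDiffOn_k : ContDiffOn ℝ ∞ k V
  norm_N : ∀ q ∈ V, ‖N q‖ = 1
  tangency : ∀ F : H n → ℝ, ContDiffOn ℝ ∞ F V → (∀ q ∈ S, F q = 0) →
    ∀ q ∈ S, ∀ X ∈ tanPlane q (N q) (a q), fderiv ℝ F q X = 0
  frobenius : ∀ q ∈ S, ∀ X ∈ tanPlane q (N q) (a q), ∀ Y ∈ tanPlane q (N q) (a q),
    inner ℝ (fderiv ℝ N q X) Y.1 - inner ℝ (fderiv ℝ N q Y) X.1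
      = fderiv ℝ a q X * contactForm q Y - fderiv ℝ a q Y * contactForm q X
        + 2 * a q * inner ℝ (J X.1) Y.1
  shape : ∀ q ∈ S, ∀ w, inner ℝ (N q) w = 0 →
    fderiv ℝ N q (frameVec q w) = normalDeriv (N q) (a q) (k q) w

namespace IsUmbilicPiece

variable {V S : Set (H n)} {N : H n → E n} {a k : H n → ℝ}

lemma differentiableAt {F : Type*} [NormedAddCommGroup F] [NormedSpace ℝ F] {f : H n → F}
    (hV : IsOpen V) (hf : ContDiffOn ℝ ∞ f V) {q : H n} (hq : q ∈ V) : DifferentiableAt ℝ f q :=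
  (hf.contDiffAt (hV.mem_nhds hq)).differentiableAt (by simp)

lemma contDiffOn_perp (h : IsUmbilicPiece V S N a k) (v : E n) :
    ContDiffOn ℝ ∞ (fun p => perp (N p) v) V :=
  contDiffOn_const.sub ((contDiffOn_const.inner ℝ h.contDiffOn_N).smul h.contDiffOn_N)

lemma contDiffOn_tanField (h : IsUmbilicPiece V S N a k) (v : E n) :
    ContDiffOn ℝ ∞ (tanField N v) V := by
  have h1 := h.contDiffOn_perp v
  have h2 : ContDiffOn ℝ ∞ (fun p => J (perp (N p) v)) V :=
    (JL (n := n)).contDiff.comp_contDiffOn h1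
  refine (h1.prodMk (h2.inner ℝ contDiff_fst.contDiffOn)).congr fun p _ => ?_
  exact frameVec_eq _ _

lemma contDiffOn_fderiv_tanField (h : IsUmbilicPiece V S N a k) {F : Type*} [NormedAddCommGroup F]
    [NormedSpace ℝ F] {f : H n → F} (hf : ContDiffOn ℝ ∞ f V) (v : E n) :
    ContDiffOn ℝ ∞ (fun p => fderiv ℝ f p (tanField N v p)) V :=
  (hf.fderiv_of_isOpen h.isOpen (by simp)).clm_apply (h.contDiffOn_tanField v)

lemma tanField_eq (_h : IsUmbilicPiece V S N a k) {q : H n} {v : E n}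
    (hv : inner ℝ (N q) v = 0) : tanField N v q = frameVec q v := by
  rw [tanField, perp_of_inner_eq_zero hv]

/-- The commutator of the derivatives along two tangent horizontal fields. -/
lemma commutator (h : IsUmbilicPiece V S N a k) {F : Type*} [NormedAddCommGroup F]
    [NormedSpace ℝ F] {f : H n → F} (hf : ContDiffOn ℝ ∞ f V) {q : H n} (hq : q ∈ S) {v w : E n}
    (hv : inner ℝ (N q) v = 0) (hw : inner ℝ (N q) w = 0) :
    fderiv ℝ (fun p => fderiv ℝ f p (tanField N v p)) q (frameVec q w)
      - fderiv ℝ (fun p => fderiv ℝ f p (tanField N w p)) q (frameVec q v)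
      = (2 * inner ℝ (J v) w) • fderiv ℝ f q (a q • frameVec q (N q) + T n) := by
  have hqV := h.subset hq
  have hN := (differentiableAt h.isOpen h.contDiffOn_N hqV).hasFDerivAt
  obtain ⟨Lv, hLv, hLv'⟩ := hasFDerivAt_tanField hN hv
  obtain ⟨Lw, hLw, hLw'⟩ := hasFDerivAt_tanField hN hw
  have key := fderiv_fderiv_sub (n := n) (X := tanField N v) (Y := tanField N w)
    (contDiffAt_infty.1 (hf.contDiffAt (h.isOpen.mem_nhds hqV)) 2)
    hLv.differentiableAt hLw.differentiableAt
  rw [hLv.fderiv, hLw.fderiv, h.tanField_eq hv, h.tanField_eq hw, hLv', hLw'] at key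
  rw [key, ← map_smul]
  congr 1
  -- The bracket has Θ-part 2⟨Jv, w⟩ and horizontal part along N. The Frobenius identity makes the
  -- N-coefficient equal to a times the Θ-part, that is, makes the bracket tangent.
  have hfrob := h.frobenius q hq _ (frameVec_mem_tanPlane.2 hw) _ (frameVec_mem_tanPlane.2 hv)
  rw [contactForm_frameVec, contactForm_frameVec, frameVec_eq, frameVec_eq] at hfrob
  simp only [← frameVec_eq, mul_zero, sub_zero, zero_add] at hfrob
  rw [real_inner_comm v, real_inner_comm w, inner_J_swap w v] at hfrob
  rw [show ∀ A B C D : H n, (A + B) - (C + D) = (A - C) + (B - D) by intros; abel, ← map_sub,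
    ← sub_smul, smul_add, smul_smul, ← map_smul]
  have e1 : (frameVec q v).1 = v := by rw [frameVec_eq]
  have e2 : (frameVec q w).1 = w := by rw [frameVec_eq]
  rw [e1, e2, inner_J_swap w v]
  congr 2
  · rw [neg_sub_neg, ← sub_smul]
    congr 1
    linear_combination -hfrob
  · ring

/-- Horizontal tangent directions generate all tangent directions. For a unit v orthogonal to N and
JN, the derivatives of f along the fields of v and Jv vanish on S, so their tangential derivatives
vanish as well, and the commutator leaves twice the derivative of f along aN + T. -/
lemma fderiv_eq_zero_of_horizontal (hn : 2 ≤ n) (h : IsUmbilicPiece V S N a k) {f : H n → ℝ}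
    (hf : ContDiffOn ℝ ∞ f V)
    (h0 : ∀ q ∈ S, ∀ w, inner ℝ (N q) w = 0 → fderiv ℝ f q (frameVec q w) = 0) {q : H n}
    (hq : q ∈ S) {X : H n} (hX : X ∈ tanPlane q (N q) (a q)) : fderiv ℝ f q X = 0 := by
  obtain ⟨v, hv1, hv2, hv3⟩ := exists_unit_orthogonal hn (N q)
  have hJv : inner ℝ (N q) (J v) = 0 := by
    rw [inner_J_left] at hv3; linarith
  have hz : ∀ u, ∀ p ∈ S, fderiv ℝ f p (tanField N u p) = 0 := fun u p hp =>
    h0 p hp _ (inner_perp (h.norm_N p (h.subset hp)) u)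
  have hc := h.commutator hf hq hv2 hJv
  rw [h.tangency _ (h.contDiffOn_fderiv_tanField hf v) (hz v) q hq _ (frameVec_mem_tanPlane.2 hJv),
    h.tangency _ (h.contDiffOn_fderiv_tanField hf (J v)) (hz (J v)) q hq _
      (frameVec_mem_tanPlane.2 hv2), inner_J_J, real_inner_self_eq_norm_sq, hv1] at hc
  have hT : fderiv ℝ f q (a q • frameVec q (N q) + T n) = 0 := by
    simpa using hc.symm
  have hX' : X = frameVec q (X.1 - (contactForm q X * a q) • N q)
      + contactForm q X • (a q • frameVec q (N q) + T n) := by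
    conv_lhs => rw [← frameVec_add_contactForm q X]
    rw [map_sub, map_smul]
    module
  rw [hX', map_add, map_smul, hT, smul_zero, add_zero]
  refine h0 q hq _ ?_
  rw [mem_tanPlane] at hX
  rw [inner_sub_right, inner_smul_right, hX, real_inner_self_eq_norm_sq, h.norm_N q (h.subset hq)]
  ring

end IsUmbilicPiece
end Ambient
end Heis

namespace Heis

open Set Filter Topology

/-! ### The Codazzi equation and the derivatives of k and a. -/

section Codazzi

variable {n : ℕ}

namespace IsUmbilicPiece

variable {V S : Set (H n)} {N : H n → E n} {a k : H n → ℝ}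

/-- The formula for dN holds only along S, but both sides are smooth on V, so they have the same
derivative in tangent directions. Projecting v by `perp` makes the formula available at all points
of S near q, not just at q. -/
lemma fderiv_fderiv_tanField (h : IsUmbilicPiece V S N a k) {q : H n} (hq : q ∈ S) {v w : E n}
    (hv : inner ℝ (N q) v = 0) (hw : inner ℝ (N q) w = 0) :
    fderiv ℝ (fun p => fderiv ℝ N p (tanField N v p)) q (frameVec q w)
      = normalDerivDeriv (N q) (a q) (k q) (normalDeriv (N q) (a q) (k q) w)
          (fderiv ℝ a q (frameVec q w)) (fderiv ℝ k q (frameVec q w)) v := by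
  have hqV := h.subset hq
  set W := frameVec q w
  have hline : ∀ {F : Type} [NormedAddCommGroup F] [NormedSpace ℝ F] {f : H n → F},
      ContDiffOn ℝ ∞ f V → HasDerivAt (fun s : ℝ => f (q + s • W)) (fderiv ℝ f q W) 0 :=
    fun hf => (differentiableAt h.isOpen hf hqV).hasFDerivAt.hasLineDerivAt W
  have hN := hline h.contDiffOn_N
  have ha := hline h.contDiffOn_a
  have hk := hline h.contDiffOn_k
  have hJ : ∀ {f : H n → E n}, ContDiffOn ℝ ∞ f V → ContDiffOn ℝ ∞ (fun p => J (f p)) V :=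
    fun hf => (JL (n := n)).contDiff.comp_contDiffOn hf
  have hR : ContDiffOn ℝ ∞ (fun p => normalDeriv (N p) (a p) (k p) (perp (N p) v)) V := by
    have hp := h.contDiffOn_perp v
    have hJN := (hJ hp).inner ℝ h.contDiffOn_N
    exact (((h.contDiffOn_a.smul (hJ hp)).sub ((h.contDiffOn_a.mul hJN).smul h.contDiffOn_N)).sub
      (h.contDiffOn_k.smul hp)).add ((h.contDiffOn_k.mul hJN).smul (hJ h.contDiffOn_N))
  have hL := h.contDiffOn_fderiv_tanField h.contDiffOn_N v
  have hshape : fderiv ℝ N q W = normalDeriv (N q) (a q) (k q) w := h.shape q hq w hw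
  have h1 := hasDerivAt_normalDeriv hN ha hk (v := v) (by simpa using hv)
  have h2 := h1.unique (hline hR)
  simp only [zero_smul, add_zero, hshape] at h2
  rw [h2]
  -- `tangency` concerns real functions, so the vector identity is tested against a fixed y.
  refine ext_inner_left ℝ fun y => ?_
  have hsub : ContDiffOn ℝ ∞ (fun p => inner ℝ y (fderiv ℝ N p (tanField N v p)
      - normalDeriv (N p) (a p) (k p) (perp (N p) v))) V := contDiffOn_const.inner ℝ (hL.sub hR)
  have h3 := h.tangency _ hsub (fun p hp => by
    rw [tanField, h.shape p hp _ (inner_perp (h.norm_N p (h.subset hp)) v), sub_self,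
      inner_zero_right]) q hq W (frameVec_mem_tanPlane.2 hw)
  have hd := (differentiableAt h.isOpen hL hqV).sub (differentiableAt h.isOpen hR hqV)
  have h4 := (hasFDerivAt_const y q).inner ℝ hd.hasFDerivAt
  have h5 : fderiv ℝ (fun p => inner ℝ y (fderiv ℝ N p (tanField N v p)
      - normalDeriv (N p) (a p) (k p) (perp (N p) v))) q = _ := h4.fderiv
  rw [h5] at h3
  rw [fderiv_sub (differentiableAt h.isOpen hL hqV) (differentiableAt h.isOpen hR hqV)] at h3
  simpa [inner_sub_right, sub_eq_zero] using h3

/-- The commutator of the derivatives of N is computed in two ways: by differentiating the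
umbilicity formula, and through the bracket of the fields. -/
lemma codazzi (h : IsUmbilicPiece V S N a k) {q : H n} (hq : q ∈ S) {v w : E n}
    (hv : inner ℝ (N q) v = 0) (hw : inner ℝ (N q) w = 0) :
    normalDerivDeriv (N q) (a q) (k q) (normalDeriv (N q) (a q) (k q) w)
        (fderiv ℝ a q (frameVec q w)) (fderiv ℝ k q (frameVec q w)) v
      - normalDerivDeriv (N q) (a q) (k q) (normalDeriv (N q) (a q) (k q) v)
        (fderiv ℝ a q (frameVec q v)) (fderiv ℝ k q (frameVec q v)) w
      = (2 * inner ℝ (J v) w) • fderiv ℝ N q (a q • frameVec q (N q) + T n) := by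
  rw [← h.commutator h.contDiffOn_N hq hv hw, h.fderiv_fderiv_tanField hq hv hw,
    h.fderiv_fderiv_tanField hq hw hv]

/-- The Codazzi equation contains the derivative of N along aN + T, about which umbilicity says
nothing. The Frobenius identity for the pair aN + T, v supplies its tangential components. -/
lemma inner_fderiv_transverse (h : IsUmbilicPiece V S N a k) {q : H n} (hq : q ∈ S) {v : E n}
    (hv : inner ℝ (N q) v = 0) :
    inner ℝ (fderiv ℝ N q (a q • frameVec q (N q) + T n)) v
      = -fderiv ℝ a q (frameVec q v) + 2 * a q ^ 2 * inner ℝ (J (N q)) v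
        + a q * inner ℝ (normalDeriv (N q) (a q) (k q) v) (N q) := by
  have hf := h.frobenius q hq _ (transverse_mem_tanPlane (h.norm_N q (h.subset hq))) _
    (frameVec_mem_tanPlane.2 hv)
  rw [h.shape q hq v hv, contactForm_frameVec, map_add (contactForm q), map_smul (contactForm q),
    contactForm_frameVec, contactForm_T] at hf
  have e1 : (a q • frameVec q (N q) + T n).1 = a q • N q := by simp [frameVec_eq, T]
  have e2 : (frameVec q v).1 = v := by rw [frameVec_eq]
  rw [e1, e2, inner_smul_right, map_smul, inner_smul_left] at hf
  simp only [smul_eq_mul, mul_zero, zero_add, mul_one, zero_sub, conj_trivial] at hf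
  linear_combination hf

/-- The derivatives of `k` and `a` along the directions orthogonal to `N` and `JN`, and the
derivative of `a` along `JN`. -/
lemma fderiv_of_unit (h : IsUmbilicPiece V S N a k) {q : H n} (hq : q ∈ S) {v : E n}
    (hv1 : ‖v‖ = 1) (hv : inner ℝ (N q) v = 0) (hv' : inner ℝ (J (N q)) v = 0) :
    fderiv ℝ k q (frameVec q v) = 0 ∧ fderiv ℝ k q (frameVec q (J (N q))) = 0 ∧
      fderiv ℝ a q (frameVec q (J (N q))) = a q ^ 2 + k q ^ 2 := by
  have hN1 := h.norm_N q (h.subset hq)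
  -- For the pair v, JN the factor ⟨Jv, JN⟩ is zero, so the unknown transverse derivative of N drops
  -- out.
  have hc := h.codazzi hq hv (inner_self_J (N q))
  generalize fderiv ℝ k q (frameVec q v) = kv at *
  generalize fderiv ℝ a q (frameVec q v) = av at *
  generalize fderiv ℝ k q (frameVec q (J (N q))) = ke at *
  generalize fderiv ℝ a q (frameVec q (J (N q))) = ae at *
  generalize fderiv ℝ N q _ = Z at *
  generalize N q = M at *
  generalize a q = b at *
  generalize k q = c at *
  have i1 : inner ℝ v M = 0 := by rw [real_inner_comm, hv]
  have i2 : inner ℝ v (J M) = 0 := by rw [real_inner_comm, hv']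
  have i3 : inner ℝ (J v) M = 0 := by rw [inner_J_left, i2, neg_zero]
  have i4 : inner ℝ M (J v) = 0 := by rw [real_inner_comm, i3]
  have i5 : inner ℝ v v = (1 : ℝ) := by rw [real_inner_self_eq_norm_sq, hv1, one_pow]
  have i6 : inner ℝ M M = (1 : ℝ) := by rw [real_inner_self_eq_norm_sq, hN1, one_pow]
  simp only [normalDerivDeriv, normalDeriv, i3, J_J, inner_J_J, i1, map_add, map_sub, map_neg,
    map_smul, inner_neg_left, i6] at hc
  -- The components along v, Jv and JN give, respectively, the derivative of k along JN, of a along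
  -- JN and of k along v.
  have h1 := congrArg (fun z => inner ℝ z v) hc
  have h2 := congrArg (fun z => inner ℝ z (J v)) hc
  have h3 := congrArg (fun z => inner ℝ z (J M)) hc
  simp only [inner_add_left, inner_sub_left, inner_neg_left, inner_smul_left, inner_smul_right,
    inner_J_J, inner_J_self, inner_self_J, inner_add_right, inner_sub_right, inner_neg_right,
    hv, hv', i1, i2, i3, i4, i5, i6, conj_trivial] at h1 h2 h3
  ring_nf at h1 h2 h3
  refine ⟨by linarith, by linarith, by linarith⟩

/-- Let Z be the derivative of N along aN + T. The v-component of Codazzi for the pair v, Jv reads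
v(a) = 2⟨Z, v⟩, while the Frobenius identity gives ⟨Z, v⟩ = -v(a). Hence 3v(a) = 0. -/
lemma fderiv_a_of_unit (h : IsUmbilicPiece V S N a k) {q : H n} (hq : q ∈ S) {v : E n}
    (hv1 : ‖v‖ = 1) (hv : inner ℝ (N q) v = 0) (hv' : inner ℝ (J (N q)) v = 0) :
    fderiv ℝ a q (frameVec q v) = 0 := by
  have hN1 := h.norm_N q (h.subset hq)
  have j1 : inner ℝ (N q) (J v) = 0 := by rw [inner_J_left] at hv'; linarith
  have j2 : inner ℝ (J (N q)) (J v) = 0 := by rw [inner_J_J, hv]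
  have hk1 := (h.fderiv_of_unit hq hv1 hv hv').1
  have hk2 := (h.fderiv_of_unit hq (v := J v) (by rw [norm_J, hv1]) j1 j2).1
  have hc := h.codazzi hq hv j1
  have ht := h.inner_fderiv_transverse hq hv
  rw [hk1, hk2] at hc
  generalize fderiv ℝ a q (frameVec q v) = av at *
  generalize fderiv ℝ a q (frameVec q (J v)) = aw at *
  generalize fderiv ℝ N q _ = Z at *
  generalize N q = M at *
  generalize a q = b at *
  generalize k q = c at *
  have i1 : inner ℝ v M = 0 := by rw [real_inner_comm, hv]
  have i2 : inner ℝ v (J M) = 0 := by rw [real_inner_comm, hv']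
  have i3 : inner ℝ (J v) M = 0 := by rw [inner_J_left, i2, neg_zero]
  have i4 : inner ℝ M (J v) = 0 := by rw [real_inner_comm, i3]
  have i5 : inner ℝ v v = (1 : ℝ) := by rw [real_inner_self_eq_norm_sq, hv1, one_pow]
  have i6 : inner ℝ M M = (1 : ℝ) := by rw [real_inner_self_eq_norm_sq, hN1, one_pow]
  simp only [normalDerivDeriv, normalDeriv, i3, J_J, inner_J_J, i1, map_add, map_sub, map_neg,
    map_smul, inner_neg_left] at hc ht
  have h1 := congrArg (fun z => inner ℝ z v) hc
  simp only [inner_add_left, inner_sub_left, inner_neg_left, inner_smul_left, inner_smul_right,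
    inner_J_J, inner_J_self, inner_self_J, inner_add_right, inner_sub_right, inner_neg_right,
    hv, hv', i1, i2, i3, i5, i6, conj_trivial] at h1 ht
  rw [ht] at h1
  ring_nf at h1
  linarith

lemma eq_horizontal_add (hn : 2 ≤ n) (h : IsUmbilicPiece V S N a k) {q : H n} (hq : q ∈ S)
    {w : E n} (hw : inner ℝ (N q) w = 0) :
    ∃ v : E n, ‖v‖ = 1 ∧ inner ℝ (N q) v = 0 ∧ inner ℝ (J (N q)) v = 0 ∧
      ∃ r : ℝ, w = r • v + inner ℝ (J (N q)) w • J (N q) := by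
  have hN1 := h.norm_N q (h.subset hq)
  set x := w - inner ℝ (J (N q)) w • J (N q)
  have hx1 : inner ℝ (N q) x = 0 := by
    simp [x, inner_sub_right, inner_smul_right, hw, inner_self_J]
  have hx2 : inner ℝ (J (N q)) x = 0 := by
    simp [x, inner_sub_right, inner_smul_right, norm_J, hN1]
  by_cases hx : x = 0
  · obtain ⟨v, hv1, hv2, hv3⟩ := exists_unit_orthogonal hn (N q)
    exact ⟨v, hv1, hv2, hv3, 0, by rw [zero_smul, zero_add]; exact sub_eq_zero.1 hx⟩
  · refine ⟨‖x‖⁻¹ • x, norm_smul_inv_norm hx, by rw [inner_smul_right, hx1, mul_zero],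
      by rw [inner_smul_right, hx2, mul_zero], ‖x‖, ?_⟩
    rw [smul_smul, mul_inv_cancel₀ (norm_ne_zero_iff.2 hx), one_smul, sub_add_cancel]

lemma fderiv_k_horizontal (hn : 2 ≤ n) (h : IsUmbilicPiece V S N a k) {q : H n} (hq : q ∈ S)
    {w : E n} (hw : inner ℝ (N q) w = 0) :
    fderiv ℝ k q (frameVec q w) = 0 := by
  obtain ⟨v, hv1, hv2, hv3, r, hr⟩ := eq_horizontal_add hn h hq hw
  obtain ⟨h1, h2, -⟩ := h.fderiv_of_unit hq hv1 hv2 hv3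
  rw [hr, map_add, map_smul, map_smul, map_add, map_smul, map_smul, h1, h2]
  simp

lemma fderiv_a_horizontal (hn : 2 ≤ n) (h : IsUmbilicPiece V S N a k) {q : H n} (hq : q ∈ S)
    {w : E n} (hw : inner ℝ (N q) w = 0) :
    fderiv ℝ a q (frameVec q w) = inner ℝ (J (N q)) w * (a q ^ 2 + k q ^ 2) := by
  obtain ⟨v, hv1, hv2, hv3, r, hr⟩ := eq_horizontal_add hn h hq hw
  obtain ⟨-, -, h3⟩ := h.fderiv_of_unit hq hv1 hv2 hv3
  have h4 := h.fderiv_a_of_unit hq hv1 hv2 hv3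
  conv_lhs => rw [hr]
  rw [map_add, map_smul, map_smul, map_add, map_smul, map_smul, h3, h4]
  simp

end IsUmbilicPiece
end Codazzi
end Heis

namespace Heis

open Set Filter Topology

/-! ### Center and height as first integrals. -/

section Conserved

variable {n : ℕ}

/-- The center of the Pansu sphere through `q` with horizontal normal `N`, slope `a` and
umbilicity `lam`. -/
def centerOf (lam : ℝ) (N : E n) (a : ℝ) (z : E n) : E n :=
  z + (a ^ 2 + lam ^ 2)⁻¹ • (a • J N + lam • N)

/-- The height over its center of the point of slope `a` of the Pansu sphere. -/
def heightFun (lam a : ℝ) : ℝ :=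
  1 / (2 * lam ^ 2) * (Real.arctan (a / lam) + a * lam * (a ^ 2 + lam ^ 2)⁻¹)

lemma sq_add_sq_pos {lam : ℝ} (hl : lam ≠ 0) (a : ℝ) : 0 < a ^ 2 + lam ^ 2 := by positivity

/-- In a horizontal tangent direction w, the slope a grows at the rate (a² + λ²)⟨JN, w⟩ and the
height over the center at the rate λ(a² + λ²)⁻¹⟨JN, w⟩. The quotient of the two rates is the
derivative found here. -/
lemma hasDerivAt_heightFun {lam : ℝ} (hl : lam ≠ 0) (a : ℝ) :
    HasDerivAt (heightFun lam) (lam * ((a ^ 2 + lam ^ 2)⁻¹) ^ 2) a := by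
  have hp := (sq_add_sq_pos hl a).ne'
  have h1 := (Real.hasDerivAt_arctan (a / lam)).comp a ((hasDerivAt_id a).div_const lam)
  have h2 := ((hasDerivAt_id a).mul_const lam).mul
    ((((hasDerivAt_id a).pow 2).add_const (lam ^ 2)).inv hp)
  refine ((h1.add h2).const_mul (1 / (2 * lam ^ 2))).congr_deriv ?_
  simp only [id_eq, Nat.cast_ofNat, Pi.pow_apply, Pi.inv_apply]
  have : 1 + (a / lam) ^ 2 ≠ 0 := by positivity
  field_simp
  ring

lemma contDiff_heightFun {lam : ℝ} (hl : lam ≠ 0) : ContDiff ℝ ∞ (heightFun lam) := by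
  have hp : ∀ a : ℝ, a ^ 2 + lam ^ 2 ≠ 0 := fun a => (sq_add_sq_pos hl a).ne'
  have h1 : ContDiff ℝ ∞ (fun a : ℝ => Real.arctan (a / lam)) :=
    Real.contDiff_arctan.comp (contDiff_id.div_const lam)
  have h2 : ContDiff ℝ ∞ (fun a : ℝ => (a ^ 2 + lam ^ 2)⁻¹) :=
    ((contDiff_id.pow 2).add contDiff_const).inv hp
  exact contDiff_const.mul (h1.add ((contDiff_id.mul contDiff_const).mul h2))

namespace IsUmbilicPiece

variable {V S : Set (H n)} {N : H n → E n} {a k : H n → ℝ}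

lemma fderiv_k_eq_zero (hn : 2 ≤ n) (h : IsUmbilicPiece V S N a k) {q : H n} (hq : q ∈ S)
    {X : H n} (hX : X ∈ tanPlane q (N q) (a q)) : fderiv ℝ k q X = 0 :=
  h.fderiv_eq_zero_of_horizontal hn h.contDiffOn_k
    (fun _ hp _ hw => fderiv_k_horizontal hn h hp hw) hq hX

lemma hasDerivAt_line (h : IsUmbilicPiece V S N a k) {F : Type*} [NormedAddCommGroup F]
    [NormedSpace ℝ F] {f : H n → F} (hf : ContDiffOn ℝ ∞ f V) {q : H n} (hq : q ∈ S) (W : H n) :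
    HasDerivAt (fun s : ℝ => f (q + s • W)) (fderiv ℝ f q W) 0 :=
  (differentiableAt h.isOpen hf (h.subset hq)).hasFDerivAt.hasLineDerivAt W

lemma contDiffOn_center (h : IsUmbilicPiece V S N a k) {lam : ℝ} (hl : lam ≠ 0) :
    ContDiffOn ℝ ∞ (fun p => centerOf lam (N p) (a p) p.1) V := by
  have hJ : ContDiffOn ℝ ∞ (fun p => J (N p)) V :=
    (JL (n := n)).contDiff.comp_contDiffOn h.contDiffOn_N
  have hi : ContDiffOn ℝ ∞ (fun p => (a p ^ 2 + lam ^ 2)⁻¹) V :=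
    ((h.contDiffOn_a.pow 2).add contDiffOn_const).inv fun p _ => (sq_add_sq_pos hl _).ne'
  exact contDiff_fst.contDiffOn.add
    (hi.smul ((h.contDiffOn_a.smul hJ).add ((contDiffOn_const (c := lam)).smul h.contDiffOn_N)))

/-- The formulas for dN and da make the derivative of (a JN + λN)/(a² + λ²) along w equal to -w,
which cancels the derivative of z. -/
lemma fderiv_center_horizontal (hn : 2 ≤ n) (h : IsUmbilicPiece V S N a k) {lam : ℝ}
    (hl : lam ≠ 0) (hk : ∀ q ∈ S, k q = lam) {q : H n} (hq : q ∈ S) {w : E n}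
    (hw : inner ℝ (N q) w = 0) :
    fderiv ℝ (fun p => centerOf lam (N p) (a p) p.1) q (frameVec q w) = 0 := by
  have hp := (sq_add_sq_pos hl (a q)).ne'
  have h0 := h.hasDerivAt_line (h.contDiffOn_center hl) hq (frameVec q w)
  have hN := h.hasDerivAt_line h.contDiffOn_N hq (frameVec q w)
  have ha := h.hasDerivAt_line h.contDiffOn_a hq (frameVec q w)
  have hz := h.hasDerivAt_line contDiff_fst.contDiffOn hq (frameVec q w)
  rw [h.shape q hq w hw, hk q hq] at hN
  rw [fderiv_a_horizontal hn h hq hw, hk q hq] at ha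
  rw [fderiv_fst] at hz
  have e2 : (ContinuousLinearMap.fst ℝ (E n) ℝ) (frameVec q w) = w := by rw [frameVec_eq]; rfl
  rw [e2] at hz
  have hi := ((ha.pow 2).add_const (lam ^ 2)).inv (by simpa using hp)
  have h1 := hz.add (hi.smul ((ha.smul (hasDerivAt_J hN)).add (hN.const_smul lam)))
  rw [h0.unique h1]
  have i1 : inner ℝ (J w) (N q) = -inner ℝ (J (N q)) w := inner_J_swap w (N q)
  simp only [zero_smul, add_zero, normalDeriv, i1, map_add, map_sub, map_smul, J_J,
    Pi.pow_apply, Pi.inv_apply, Pi.add_apply, Pi.smul_apply', Pi.smul_apply]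
  generalize inner ℝ (J (N q)) w = s
  generalize N q = M at *
  generalize a q = b at *
  match_scalars <;> field_simp <;> ring

lemma fderiv_center_eq_zero (hn : 2 ≤ n) (h : IsUmbilicPiece V S N a k) {lam : ℝ}
    (hl : lam ≠ 0) (hk : ∀ q ∈ S, k q = lam) {q : H n} (hq : q ∈ S) {X : H n}
    (hX : X ∈ tanPlane q (N q) (a q)) :
    fderiv ℝ (fun p => centerOf lam (N p) (a p) p.1) q X = 0 := by
  refine ext_inner_left ℝ fun y => ?_
  have hc := h.contDiffOn_center hl
  have hd : ∀ p ∈ S, ∀ X, fderiv ℝ (fun p => inner ℝ y (centerOf lam (N p) (a p) p.1)) p X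
      = inner ℝ y (fderiv ℝ (fun p => centerOf lam (N p) (a p) p.1) p X) := by
    intro p hp X
    have := (hasFDerivAt_const y p).inner ℝ
      (differentiableAt h.isOpen hc (h.subset hp)).hasFDerivAt
    rw [this.fderiv]
    simp
  rw [inner_zero_right, ← hd q hq]
  refine h.fderiv_eq_zero_of_horizontal hn (contDiffOn_const.inner ℝ hc) (fun p hp w hw => ?_) hq hX
  rw [hd p hp, fderiv_center_horizontal hn h hl hk hp hw, inner_zero_right]

lemma contDiffOn_height (h : IsUmbilicPiece V S N a k) {lam : ℝ} (hl : lam ≠ 0) (c : E n) :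
    ContDiffOn ℝ ∞ (fun p => p.2 + inner ℝ (J c) p.1 - heightFun lam (a p)) V :=
  (contDiff_snd.contDiffOn.add (contDiffOn_const.inner ℝ contDiff_fst.contDiffOn)).sub
    ((contDiff_heightFun hl).comp_contDiffOn h.contDiffOn_a)

lemma fderiv_height_eq_zero (hn : 2 ≤ n) (h : IsUmbilicPiece V S N a k) {lam : ℝ}
    (hl : lam ≠ 0) (hk : ∀ q ∈ S, k q = lam) {c : E n}
    (hc : ∀ q ∈ S, centerOf lam (N q) (a q) q.1 = c) {q : H n} (hq : q ∈ S) {X : H n}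
    (hX : X ∈ tanPlane q (N q) (a q)) :
    fderiv ℝ (fun p => p.2 + inner ℝ (J c) p.1 - heightFun lam (a p)) q X = 0 := by
  refine h.fderiv_eq_zero_of_horizontal hn (h.contDiffOn_height hl c) (fun q hq w hw => ?_) hq hX
  have hp := (sq_add_sq_pos hl (a q)).ne'
  have h0 := h.hasDerivAt_line (h.contDiffOn_height hl c) hq (frameVec q w)
  have ha := h.hasDerivAt_line h.contDiffOn_a hq (frameVec q w)
  have hz := h.hasDerivAt_line contDiff_fst.contDiffOn hq (frameVec q w)
  have ht := h.hasDerivAt_line contDiff_snd.contDiffOn hq (frameVec q w)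
  rw [fderiv_a_horizontal hn h hq hw, hk q hq] at ha
  rw [fderiv_fst] at hz
  rw [fderiv_snd] at ht
  have e1 : (ContinuousLinearMap.fst ℝ (E n) ℝ) (frameVec q w) = w := by rw [frameVec_eq]; rfl
  have e2 : (ContinuousLinearMap.snd ℝ (E n) ℝ) (frameVec q w) = inner ℝ (J w) q.1 := by
    rw [frameVec_eq]; rfl
  rw [e1] at hz
  rw [e2] at ht
  have hh := (hasDerivAt_heightFun hl (a (q + (0 : ℝ) • frameVec q w))).comp 0 ha
  have h1 := (ht.add ((hasDerivAt_const (0 : ℝ) (J c)).inner ℝ hz)).sub hh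
  rw [h0.unique h1]
  -- Solving the center equation for z makes ⟨Jw, z⟩ explicit; the remaining term ⟨Jw, c⟩ is
  -- cancelled by the derivative of ⟨Jc, z⟩.
  have hz' : q.1 = c - (a q ^ 2 + lam ^ 2)⁻¹ • (a q • J (N q) + lam • N q) := by
    rw [← hc q hq, centerOf]; abel
  have i1 : inner ℝ (J w) (N q) = -inner ℝ (J (N q)) w := inner_J_swap w (N q)
  have i2 : inner ℝ (J w) (J (N q)) = 0 := by rw [inner_J_J, real_inner_comm, hw]
  have i3 : inner ℝ (J w) q.1
      = inner ℝ (J w) c + (a q ^ 2 + lam ^ 2)⁻¹ * lam * inner ℝ (J (N q)) w := by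
    rw [hz', inner_sub_right, inner_smul_right, inner_add_right, inner_smul_right,
      inner_smul_right, i1, i2]
    ring
  simp only [zero_smul, add_zero, inner_zero_left, i3]
  rw [inner_J_swap w c]
  field_simp
  ring

end IsUmbilicPiece
end Conserved
end Heis

namespace Heis

open Set Filter Topology

/-! ### From the hypotheses on the immersion to ambient data. -/

section Linking

variable {n : ℕ} {M : Type*} [TopologicalSpace M] [ChartedSpace (EuclideanSpace ℝ (Fin (2 * n))) M]

/-- Near the open set `ι '' B`, the functions `N` and `a` describe the tangent planes of the
immersion `ι` and satisfy the integrability condition of the hypersurface. -/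
structure IsLocalFrame (ι : M → H n) (B : Set M) (V : Set (H n)) (N : H n → E n) (a : H n → ℝ) :
    Prop where
  isOpen_B : IsOpen B
  isOpen_V : IsOpen V
  mapsTo : MapsTo ι B V
  contDiffOn_N : ContDiffOn ℝ ∞ N V
  contDiffOn_a : ContDiffOn ℝ ∞ a V
  norm_N : ∀ q ∈ V, ‖N q‖ = 1
  tangent_eq : ∀ q ∈ B, tangent ι q = tanPlane (ι q) (N (ι q)) (a (ι q))
  frobenius : ∀ q ∈ V, ∀ X ∈ tanPlane q (N q) (a q), ∀ Y ∈ tanPlane q (N q) (a q),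
    inner ℝ (fderiv ℝ N q X) Y.1 - inner ℝ (fderiv ℝ N q Y) X.1
      = fderiv ℝ a q X * contactForm q Y - fderiv ℝ a q Y * contactForm q X
        + 2 * a q * inner ℝ (J X.1) Y.1

lemma tanPlane_neg (q : H n) (N : E n) (a : ℝ) : tanPlane q (-N) (-a) = tanPlane q N a := by
  ext X
  simp [mem_tanPlane]

lemma mfderiv_comp_apply_eq {ι : M → H n} (himm : IsImmersedHypersurface ι) {F : Type*}
    [NormedAddCommGroup F] [NormedSpace ℝ F] {f : H n → F} {q : M}
    (hf : DifferentiableAt ℝ f (ι q)) (x : TangentSpace (𝓡 (2 * n)) q) :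
    mfderiv (𝓡 (2 * n)) 𝓘(ℝ, F) (fun m => f (ι m)) q x
      = fderiv ℝ f (ι q) (mfderiv (𝓡 (2 * n)) 𝓘(ℝ, H n) ι q x) := by
  have h := mfderiv_comp_apply q (g := f) (f := ι) (I := 𝓡 (2 * n)) (I' := 𝓘(ℝ, H n))
    (I'' := 𝓘(ℝ, F)) hf.mdifferentiableAt ((himm.1 q).mdifferentiableAt (by norm_num)) x
  rw [mfderiv_eq_fderiv] at h
  exact h

lemma nabla_comp {ι : M → H n} (himm : IsImmersedHypersurface ι) {f : H n → E n} {q : M}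
    (hf : DifferentiableAt ℝ f (ι q)) {v : E n} (hv : v ∈ horTangent ι q) :
    nabla ι q v (fun m => f (ι m)) = fderiv ℝ f (ι q) (frameVec (ι q) v) := by
  obtain ⟨x, hx⟩ : ∃ x, mfderiv (𝓡 (2 * n)) 𝓘(ℝ, H n) ι q x = frameVec (ι q) v := hv
  rw [nabla, mfderiv_comp_apply_eq himm hf]
  congr 1
  exact Function.invFun_eq ⟨x, hx⟩

lemma nabla_congr {ι : M → H n} {q : M} {F G : M → E n} (h : F =ᶠ[𝓝 q] G) (v : E n) :
    nabla ι q v F = nabla ι q v G := by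
  unfold nabla
  rw [h.mfderiv_eq]
  rfl

/-- The function that is equal to `k` along an umbilic hypersurface with `l = 2k`. -/
def umbilicity (N : H n → E n) (p : H n) : ℝ :=
  -inner ℝ (fderiv ℝ N p (frameVec p (J (N p)))) (J (N p)) / 2

lemma umbilicity_neg (N : H n → E n) (p : H n) :
    umbilicity (fun q => -N q) p = -umbilicity N p := by
  have e1 : fderiv ℝ (fun q => -N q) p = -fderiv ℝ N p := fderiv_neg
  simp only [umbilicity, e1, map_neg, neg_apply, inner_neg_left,
    inner_neg_right]
  ring

namespace IsLocalFrame

variable {ι : M → H n} {B : Set M} {V : Set (H n)} {N : H n → E n} {a : H n → ℝ}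

/-- The planes determine N and a up to a common sign. Reversing it covers the other choice of e_n,
and later makes k positive. -/
lemma neg (h : IsLocalFrame ι B V N a) : IsLocalFrame ι B V (fun q => -N q) (fun q => -a q) where
  isOpen_B := h.isOpen_B
  isOpen_V := h.isOpen_V
  mapsTo := h.mapsTo
  contDiffOn_N := h.contDiffOn_N.neg
  contDiffOn_a := h.contDiffOn_a.neg
  norm_N q hq := by rw [norm_neg, h.norm_N q hq]
  tangent_eq q hq := by rw [tanPlane_neg, h.tangent_eq q hq]
  frobenius q hq X hX Y hY := by
    rw [tanPlane_neg] at hX hY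
    have := h.frobenius q hq X hX Y hY
    have e1 : fderiv ℝ (fun q => -N q) q = -fderiv ℝ N q := fderiv_neg
    have e2 : fderiv ℝ (fun q => -a q) q = -fderiv ℝ a q := fderiv_neg
    rw [e1, e2]
    simp only [neg_apply, inner_neg_left]
    linarith

lemma mono (h : IsLocalFrame ι B V N a) {B' : Set M} (hB' : IsOpen B') (hsub : B' ⊆ B) :
    IsLocalFrame ι B' V N a :=
  ⟨hB', h.isOpen_V, h.mapsTo.mono_left hsub, h.contDiffOn_N, h.contDiffOn_a, h.norm_N,
    fun q hq => h.tangent_eq q (hsub hq), h.frobenius⟩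

lemma mem_horTangent (h : IsLocalFrame ι B V N a) {q : M} (hq : q ∈ B) {w : E n} :
    w ∈ horTangent ι q ↔ inner ℝ (N (ι q)) w = 0 := by
  rw [horTangent, h.tangent_eq q hq, Submodule.mem_comap, frameVec_mem_tanPlane]

lemma mem_xiPrime (h : IsLocalFrame ι B V N a) {q : M} (hq : q ∈ B) {w : E n} :
    w ∈ xiPrime ι q ↔ inner ℝ (N (ι q)) w = 0 ∧ inner ℝ (J (N (ι q))) w = 0 := by
  rw [xiPrime, Submodule.mem_inf, h.mem_horTangent hq, Submodule.mem_map]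
  refine and_congr_right fun _ => ⟨?_, fun hw => ⟨-J w, ?_, ?_⟩⟩
  · rintro ⟨y, hy, rfl⟩
    rw [inner_J_J]
    exact (h.mem_horTangent hq).1 hy
  · rw [h.mem_horTangent hq, inner_neg_right]
    rw [inner_J_left] at hw
    exact hw
  · rw [map_neg, J_J, neg_neg]

lemma mem_regularSet (h : IsLocalFrame ι B V N a) {q : M} (hq : q ∈ B) : q ∈ regularSet ι := by
  intro heq
  have h1 : frameVec (ι q) (N (ι q)) ∈ tangent ι q := by
    rw [heq, contactPlane, LinearMap.mem_ker, contactForm_frameVec]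
  rw [h.tangent_eq q hq, frameVec_mem_tanPlane, real_inner_self_eq_norm_sq,
    h.norm_N _ (h.mapsTo hq)] at h1
  norm_num at h1

lemma contDiffOn_JN (h : IsLocalFrame ι B V N a) : ContDiffOn ℝ ∞ (fun p => J (N p)) V :=
  (JL (n := n)).contDiff.comp_contDiffOn h.contDiffOn_N

lemma isCharField (h : IsLocalFrame ι B V N a) (himm : IsImmersedHypersurface ι) :
    IsCharField ι B (fun q => -J (N (ι q))) := by
  refine ⟨h.isOpen_B, fun q hq => h.mem_regularSet hq, ?_, fun q hq => ⟨?_, ?_, ?_⟩⟩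
  · have h1 : ContDiffOn ℝ 1 (fun p => -J (N p)) V :=
      (h.contDiffOn_JN.neg).of_le (by exact_mod_cast (le_top : (1 : ℕ∞) ≤ ⊤))
    exact h1.contMDiffOn.comp (himm.1.of_le (by norm_num)).contMDiffOn h.mapsTo
  · rw [h.mem_horTangent hq, inner_neg_right, inner_self_J, neg_zero]
  · rw [Submodule.mem_orthogonal']
    intro u hu
    rw [inner_neg_left, ((h.mem_xiPrime hq).1 hu).2, neg_zero]
  · rw [norm_neg, norm_J, h.norm_N _ (h.mapsTo hq)]

lemma horNormal_eq {M : Type*} (N : H n → E n) (ι : M → H n) :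
    horNormal (fun q => -J (N (ι q))) = fun q => N (ι q) := by
  funext q
  simp [horNormal, J_J]

lemma alpha_eq (h : IsLocalFrame ι B V N a) {q : M} (hq : q ∈ B) {e : M → E n}
    (he : e q = -J (N (ι q))) : alpha ι e q = a (ι q) := by
  have hN : horNormal e q = N (ι q) := by simp [horNormal, he, J_J]
  have h1 : ∀ b : ℝ, b • frameVec (ι q) (horNormal e q) + T n ∈ tangent ι q ↔ b = a (ι q) := by
    intro b
    rw [hN, h.tangent_eq q hq, mem_tanPlane, map_add, map_smul, contactForm_frameVec,
      contactForm_T]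
    simp [frameVec_eq, T, inner_smul_right, h.norm_N _ (h.mapsTo hq)]
  exact (h1 _).1 (Classical.epsilon_spec (p := fun b : ℝ =>
    b • frameVec (ι q) (horNormal e q) + T n ∈ tangent ι q) ⟨a (ι q), (h1 _).2 rfl⟩)

/-- The part of e orthogonal to JN lies in ξ', hence is orthogonal to e and to JN, hence to itself.
So e is a unit multiple of JN. -/
lemma charField_eq_or (h : IsLocalFrame ι B V N a) {U : Set M} {e : M → E n}
    (he : IsCharField ι U e) {q : M} (hq : q ∈ B) (hqU : q ∈ U) :
    e q = -J (N (ι q)) ∨ e q = J (N (ι q)) := by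
  obtain ⟨h1, h2, h3⟩ := he.2.2.2 q hqU
  have hN := h.norm_N _ (h.mapsTo hq)
  rw [h.mem_horTangent hq] at h1
  set s := inner ℝ (J (N (ι q))) (e q) with hs
  have hx : e q - s • J (N (ι q)) ∈ xiPrime ι q := by
    rw [h.mem_xiPrime hq, inner_sub_right, inner_sub_right, inner_smul_right, inner_smul_right,
      h1, inner_self_J, real_inner_self_eq_norm_sq, norm_J, hN]
    simp [hs]
  have hx2 := (Submodule.mem_orthogonal _ _).1 h2 _ hx
  have hx3 := ((h.mem_xiPrime hq).1 hx).2
  have hx4 : inner ℝ (e q - s • J (N (ι q))) (e q - s • J (N (ι q))) = (0 : ℝ) := by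
    rw [inner_sub_right, hx2, inner_smul_right, real_inner_comm, hx3]; simp
  have hx5 : e q = s • J (N (ι q)) := sub_eq_zero.1 (inner_self_eq_zero.1 hx4)
  have hs1 : |s| = 1 := by
    rw [hx5, norm_smul, norm_J, hN, mul_one] at h3
    exact h3
  rcases (abs_eq zero_le_one).1 hs1 with h5 | h5
  · right; rw [hx5, h5, one_smul]
  · left; rw [hx5, h5, neg_one_smul]

/-- Near each point a choice of `e_n` is given by the frame or by its opposite. -/
lemma charField_eventually (h : IsLocalFrame ι B V N a) (himm : IsImmersedHypersurface ι)
    {U : Set M} {e : M → E n} (he : IsCharField ι U e) {q : M} (hq : q ∈ B) (hqU : q ∈ U) :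
    (∀ᶠ m in 𝓝 q, e m = -J (N (ι m))) ∨ (∀ᶠ m in 𝓝 q, e m = J (N (ι m))) := by
  have hc1 : ContinuousAt e q := (he.2.2.1.continuousOn).continuousAt (he.1.mem_nhds hqU)
  have hc2 : ContinuousAt (fun m => J (N (ι m))) q :=
    (ContinuousAt.comp (f := ι) (h.contDiffOn_JN.continuousOn.continuousAt
      (h.isOpen_V.mem_nhds (h.mapsTo hq))) himm.1.continuous.continuousAt)
  have hev : ∀ᶠ m in 𝓝 q, m ∈ B ∧ m ∈ U :=
    (h.isOpen_B.eventually_mem hq).and (he.1.eventually_mem hqU)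
  have hne : ∀ m ∈ B, J (N (ι m)) ≠ -J (N (ι m)) := by
    intro m hm heq
    have h0 : J (N (ι m)) = 0 := by
      have := add_eq_zero_iff_eq_neg.2 heq
      rw [← two_smul ℝ] at this
      exact (smul_eq_zero.1 this).resolve_left two_ne_zero
    have h1 := norm_J (N (ι m))
    rw [h0, norm_zero, h.norm_N _ (h.mapsTo hm)] at h1
    norm_num at h1
  -- Pointwise e is one of two continuous fields that never meet. Near q it stays off the one it
  -- avoids at q, so its sign is locally constant.
  have hsep : ∀ {g : M → E n}, ContinuousAt g q → e q ≠ g q → ∀ᶠ m in 𝓝 q, e m ≠ g m :=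
    fun hg h0 => (hc1.prodMk hg).eventually (isClosed_diagonal.isOpen_compl.eventually_mem h0)
  rcases h.charField_eq_or he hq hqU with h1 | h1
  · left
    have hnear : ∀ᶠ m in 𝓝 q, e m ≠ J (N (ι m)) :=
      hsep hc2 (by rw [h1]; exact (hne q hq).symm)
    filter_upwards [hev, hnear] with m hm hm'
    exact (h.charField_eq_or he hm.1 hm.2).resolve_right hm'
  · right
    have hnear : ∀ᶠ m in 𝓝 q, e m ≠ -J (N (ι m)) :=
      hsep hc2.neg (by rw [h1]; exact hne q hq)
    filter_upwards [hev, hnear] with m hm hm'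
    exact (h.charField_eq_or he hm.1 hm.2).resolve_left hm'

lemma differentiableAt_N (h : IsLocalFrame ι B V N a) {q : M} (hq : q ∈ B) :
    DifferentiableAt ℝ N (ι q) :=
  IsUmbilicPiece.differentiableAt h.isOpen_V h.contDiffOn_N (h.mapsTo hq)

/-- The umbilicity condition in terms of the derivative of the horizontal normal. -/
lemma isUmbilicWith_iff (h : IsLocalFrame ι B V N a) (himm : IsImmersedHypersurface ι)
    {e : M → E n} {q : M} (hq : q ∈ B) (he : ∀ᶠ m in 𝓝 q, e m = -J (N (ι m))) {k : ℝ} :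
    IsUmbilicWith ι e q k ↔ ∀ v, inner ℝ (N (ι q)) v = 0 → inner ℝ (J (N (ι q))) v = 0 →
      fderiv ℝ N (ι q) (frameVec (ι q) v) = a (ι q) • J v - k • v := by
  have hshape : ∀ v ∈ xiPrime ι q, shape ι e q v
      = -fderiv ℝ N (ι q) (frameVec (ι q) v) + a (ι q) • J v := by
    intro v hv
    have hv' := (h.mem_xiPrime hq).1 hv
    have hN : horNormal e =ᶠ[𝓝 q] fun m => N (ι m) := by
      filter_upwards [he] with m hm
      simp [horNormal, hm, J_J]
    rw [shape, nabla_congr hN, nabla_comp himm (h.differentiableAt_N hq)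
      ((h.mem_horTangent hq).2 hv'.1), h.alpha_eq hq he.self_of_nhds, Jprime, he.self_of_nhds,
      inner_neg_left, hv'.2]
    simp
  constructor
  · intro hu v hv1 hv2
    have hv := (h.mem_xiPrime hq).2 ⟨hv1, hv2⟩
    have := hu.2 v hv
    rw [hshape v hv] at this
    rw [← this]; abel
  · intro hu
    have : ∀ v ∈ xiPrime ι q, shape ι e q v = k • v := by
      intro v hv
      have hv' := (h.mem_xiPrime hq).1 hv
      rw [hshape v hv, hu v hv'.1 hv'.2]; abel
    exact ⟨fun v hv => by rw [this v hv]; exact Submodule.smul_mem _ _ hv, this⟩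

lemma ell_eq (h : IsLocalFrame ι B V N a) (himm : IsImmersedHypersurface ι) {q : M} (hq : q ∈ B) :
    ell ι (fun m => -J (N (ι m))) q
      = -inner ℝ (fderiv ℝ N (ι q) (frameVec (ι q) (J (N (ι q))))) (J (N (ι q))) := by
  rw [ell, horNormal_eq, nabla_comp himm (h.differentiableAt_N hq)
    ((h.mem_horTangent hq).2 (by rw [inner_neg_right, inner_self_J, neg_zero]))]
  simp

/-- After a sign change the given local choice becomes the one of the frame. Then l = 2k forces k =
l/2, and l/2 is `umbilicity`. -/
lemma isUmbilicWith_of_isUmbilic (h : IsLocalFrame ι B V N a) (himm : IsImmersedHypersurface ι)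
    (humb : IsUmbilic ι) (hlk : EllEqTwoK ι) {q : M} (hq : q ∈ B) :
    IsUmbilicWith ι (fun m => -J (N (ι m))) q (umbilicity N (ι q)) := by
  obtain ⟨U, e, k, hqU, he, hk⟩ := humb q (h.mem_regularSet hq)
  have key : ∃ k', IsUmbilicWith ι (fun m => -J (N (ι m))) q k' := by
    rcases h.charField_eventually himm he hq hqU with h1 | h1
    · refine ⟨k, ?_⟩
      rw [h.isUmbilicWith_iff himm hq h1] at hk
      rwa [h.isUmbilicWith_iff himm hq (Eventually.of_forall fun _ => rfl)]
    · refine ⟨-k, ?_⟩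
      have h2 : ∀ᶠ m in 𝓝 q, e m = -J (-N (ι m)) := by
        filter_upwards [h1] with m hm
        rw [hm, map_neg, neg_neg]
      rw [h.neg.isUmbilicWith_iff himm hq h2] at hk
      rw [h.isUmbilicWith_iff himm hq (Eventually.of_forall fun _ => rfl)]
      intro v hv1 hv2
      have h3 := hk v (by rw [inner_neg_left, hv1, neg_zero])
        (by rw [map_neg, inner_neg_left, hv2, neg_zero])
      have e1 : fderiv ℝ (fun q => -N q) (ι q) = -fderiv ℝ N (ι q) := fderiv_neg
      rw [e1, neg_apply] at h3
      rw [← neg_inj, h3]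
      module
  obtain ⟨k', hk'⟩ := key
  have hell := hlk q (h.mem_regularSet hq) B _ k' hq (h.isCharField himm) hk'
  rw [h.ell_eq himm hq] at hell
  have : umbilicity N (ι q) = k' := by rw [umbilicity, hell]; ring
  rwa [this]

/-- The eigenvalue k is defined only along Σ; the expression `umbilicity` in dN extends it smoothly
to V. The remaining point is to extend the formula for dN from ξ' to JN. -/
lemma isUmbilicPiece (h : IsLocalFrame ι B V N a) (himm : IsImmersedHypersurface ι)
    (humb : IsUmbilic ι) (hlk : EllEqTwoK ι) :
    IsUmbilicPiece V (ι '' B) N a (umbilicity N) where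
  isOpen := h.isOpen_V
  subset := h.mapsTo.image_subset
  contDiffOn_N := h.contDiffOn_N
  contDiffOn_a := h.contDiffOn_a
  contDiffOn_k := by
    have hJ := h.contDiffOn_JN
    have hJJ : ContDiffOn ℝ ∞ (fun p => J (J (N p))) V :=
      (JL (n := n)).contDiff.comp_contDiffOn hJ
    have h1 : ContDiffOn ℝ ∞ (fun p => frameVec p (J (N p))) V :=
      (hJ.prodMk (hJJ.inner ℝ contDiff_fst.contDiffOn)).congr fun p _ => frameVec_eq _ _
    exact ((((h.contDiffOn_N.fderiv_of_isOpen h.isOpen_V (by simp)).clm_apply h1).inner ℝ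
      hJ).neg).div_const 2
  norm_N := h.norm_N
  tangency := by
    rintro F hF hF0 _ ⟨q, hq, rfl⟩ X hX
    rw [← h.tangent_eq q hq] at hX
    obtain ⟨x, rfl⟩ : ∃ x, mfderiv (𝓡 (2 * n)) 𝓘(ℝ, H n) ι q x = X := hX
    rw [← mfderiv_comp_apply_eq himm
      (IsUmbilicPiece.differentiableAt h.isOpen_V hF (h.mapsTo hq))]
    have h0 : (fun m => F (ι m)) =ᶠ[𝓝 q] fun _ => (0 : ℝ) := by
      filter_upwards [h.isOpen_B.mem_nhds hq] with m hm
      exact hF0 _ ⟨m, hm, rfl⟩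
    rw [h0.mfderiv_eq, mfderiv_const]
    rfl
  frobenius q hq := h.frobenius q (h.mapsTo.image_subset hq)
  shape := by
    rintro _ ⟨q, hq, rfl⟩ w hw
    have hu := (h.isUmbilicWith_iff himm hq (Eventually.of_forall fun _ => rfl)).1
      (h.isUmbilicWith_of_isUmbilic himm humb hlk hq)
    have hV := h.mapsTo hq
    have hN1 := h.norm_N _ hV
    have hfr := h.frobenius _ hV
    have hunit : ∀ X, inner ℝ (fderiv ℝ N (ι q) X) (N (ι q)) = (0 : ℝ) := by
      intro X
      have hd := (h.differentiableAt_N hq).hasFDerivAt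
      have h1 := hd.inner ℝ hd
      have h2 : (fun p => inner ℝ (N p) (N p)) =ᶠ[𝓝 (ι q)] fun _ => (1 : ℝ) := by
        filter_upwards [h.isOpen_V.mem_nhds hV] with p hp
        rw [real_inner_self_eq_norm_sq, h.norm_N p hp, one_pow]
      have h3 := h1.unique ((hasFDerivAt_const (1 : ℝ) (ι q)).congr_of_eventuallyEq h2)
      have h4 := DFunLike.congr_fun h3 X
      simp [real_inner_comm] at h4
      exact (real_inner_comm _ _).trans h4
    have hell : inner ℝ (fderiv ℝ N (ι q) (frameVec (ι q) (J (N (ι q))))) (J (N (ι q)))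
        = -2 * umbilicity N (ι q) := by rw [umbilicity]; ring
    generalize umbilicity N (ι q) = k at *
    generalize fderiv ℝ N (ι q) = L at *
    generalize fderiv ℝ a (ι q) = A at *
    generalize N (ι q) = M at *
    generalize a (ι q) = b at *
    -- dN(JN) has no N-component because |N| = 1, and its JN-component is -2k by l = 2k. Its
    -- component y in ξ' vanishes by the Frobenius identity for JN and y, since dN(y) is known.
    have hJM : L (frameVec (ι q) (J M)) = (-2 * k) • J M := by
      set y := L (frameVec (ι q) (J M)) - (-2 * k) • J M with hy
      have hy1 : inner ℝ M y = 0 := by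
        rw [real_inner_comm, hy, inner_sub_left, hunit, inner_smul_left, inner_J_self]; simp
      have hy2 : inner ℝ (J M) y = 0 := by
        rw [real_inner_comm, hy, inner_sub_left, hell, inner_smul_left,
          real_inner_self_eq_norm_sq, norm_J, hN1]; simp
      have hy3 : inner ℝ (L (frameVec (ι q) (J M))) y = 0 := by
        have hf := hfr _ (frameVec_mem_tanPlane.2 (inner_self_J M)) _
          (frameVec_mem_tanPlane.2 hy1)
        have f1 : (frameVec (ι q) (J M)).1 = J M := by rw [frameVec_eq]
        have f2 : (frameVec (ι q) y).1 = y := by rw [frameVec_eq]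
        rw [contactForm_frameVec, contactForm_frameVec, f1, f2, hu y hy1 hy2, J_J] at hf
        have e1 : inner ℝ (J y) (J M) = 0 := by rw [inner_J_J, real_inner_comm, hy1]
        have e2 : inner ℝ y (J M) = 0 := by rw [real_inner_comm, hy2]
        rw [inner_sub_left, inner_smul_left, inner_smul_left, e1, e2, inner_neg_left, hy1] at hf
        simpa using hf
      have hy4 : inner ℝ y y = (0 : ℝ) := by
        nth_rewrite 1 [hy]
        rw [inner_sub_left, hy3, inner_smul_left, hy2]; simp
      exact sub_eq_zero.1 (inner_self_eq_zero.1 hy4)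
    set s := inner ℝ (J M) w with hs
    have hw' : w = (w - s • J M) + s • J M := by abel
    have i1 : inner ℝ M (w - s • J M) = 0 := by
      rw [inner_sub_right, inner_smul_right, hw, inner_self_J]; simp
    have i2 : inner ℝ (J M) (w - s • J M) = 0 := by
      rw [inner_sub_right, inner_smul_right, real_inner_self_eq_norm_sq, norm_J, hN1, ← hs]; simp
    have i3 : inner ℝ (J w) M = -s := by rw [inner_J_swap, hs]
    rw [normalDeriv, i3]
    conv_lhs => rw [hw']
    rw [map_add, map_add, map_smul, map_smul, hu _ i1 i2, hJM, map_sub, map_smul, J_J]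
    module

end IsLocalFrame
end Linking
end Heis

namespace Heis

open Set Filter Topology

/-! ### Horizontal gradients and the Frobenius identity. -/

section LocalDefiningFunction

variable {n : ℕ}

/-- The horizontal gradient of a function. -/
def horGrad (u : H n → ℝ) (q : H n) : E n :=
  ∑ i, fderiv ℝ u q (frameVec q (EuclideanSpace.basisFun (Fin n ⊕ Fin n) ℝ i)) •
    EuclideanSpace.basisFun (Fin n ⊕ Fin n) ℝ i

lemma inner_horGrad (u : H n → ℝ) (q : H n) (w : E n) :
    inner ℝ (horGrad u q) w = fderiv ℝ u q (frameVec q w) := by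
  conv_rhs => rw [← (EuclideanSpace.basisFun (Fin n ⊕ Fin n) ℝ).sum_repr' w]
  rw [horGrad, sum_inner, map_sum, map_sum]
  refine Finset.sum_congr rfl fun i _ => ?_
  rw [inner_smul_left, map_smul, map_smul, smul_eq_mul, mul_comm]
  rfl

lemma fderiv_eq_horGrad (u : H n → ℝ) (q X : H n) :
    fderiv ℝ u q X = inner ℝ (horGrad u q) X.1 + contactForm q X * fderiv ℝ u q (T n) := by
  conv_lhs => rw [← frameVec_add_contactForm q X]
  rw [map_add, map_smul, inner_horGrad, smul_eq_mul]

lemma contDiff_frameVec (w : E n) : ContDiff ℝ ∞ (fun p : H n => frameVec p w) := by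
  have : ContDiff ℝ ∞ (fun p : H n => ((w, inner ℝ (J w) p.1) : H n)) :=
    contDiff_const.prodMk (contDiff_const.inner ℝ contDiff_fst)
  simpa only [frameVec_eq] using this

lemma contDiffOn_horGrad {u : H n → ℝ} {V : Set (H n)} (hV : IsOpen V)
    (hu : ContDiffOn ℝ ∞ u V) : ContDiffOn ℝ ∞ (horGrad u) V := by
  refine ContDiffOn.sum fun i _ => ?_
  exact ((hu.fderiv_of_isOpen hV (by simp)).clm_apply (contDiff_frameVec _).contDiffOn).smul
    contDiffOn_const

lemma hasFDerivAt_contactForm (q Y : H n) :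
    ∃ L : H n →L[ℝ] ℝ, HasFDerivAt (fun p => contactForm p Y) L q ∧
      ∀ X, L X = inner ℝ (J X.1) Y.1 := by
  have h1 := ((JL (n := n)).hasFDerivAt.comp q (hasFDerivAt_fst (𝕜 := ℝ) (p := q))).inner ℝ
    (hasFDerivAt_const Y.1 q)
  refine ⟨_, (h1.const_add Y.2).congr_of_eventuallyEq
    (Eventually.of_forall fun p => contactForm_eq p Y), fun X => ?_⟩
  simp

/-- The integrability condition of the hyperplane field `ker du`. -/
lemma frobenius_of_fderiv_eq {u : H n → ℝ} {N : H n → E n} {a r : H n → ℝ} {q : H n}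
    (hu : ContDiffAt ℝ 2 u q) (hN : DifferentiableAt ℝ N q) (ha : DifferentiableAt ℝ a q)
    (hr : DifferentiableAt ℝ r q) (hr0 : r q ≠ 0)
    (h : ∀ᶠ p in 𝓝 q, ∀ Y, fderiv ℝ u p Y = r p * (inner ℝ (N p) Y.1 - a p * contactForm p Y))
    {X Y : H n} (hX : X ∈ tanPlane q (N q) (a q)) (hY : Y ∈ tanPlane q (N q) (a q)) :
    inner ℝ (fderiv ℝ N q X) Y.1 - inner ℝ (fderiv ℝ N q Y) X.1
      = fderiv ℝ a q X * contactForm q Y - fderiv ℝ a q Y * contactForm q X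
        + 2 * a q * inner ℝ (J X.1) Y.1 := by
  have hd : DifferentiableAt ℝ (fderiv ℝ u) q :=
    (hu.fderiv_right (m := 1) (by norm_num)).differentiableAt (by norm_num)
  have hs := hu.isSymmSndFDerivAt (by simp) X Y
  -- For Z in the kernel of du the derivative of the factor r drops out. Symmetry of the second
  -- derivative of u then compares (X, Y) with (Y, X).
  have key : ∀ Z W : H n, Z ∈ tanPlane q (N q) (a q) →
      fderiv ℝ (fderiv ℝ u) q W Z = r q * (inner ℝ (fderiv ℝ N q W) Z.1
        - fderiv ℝ a q W * contactForm q Z - a q * inner ℝ (J W.1) Z.1) := by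
    intro Z W hZ
    obtain ⟨L, hL, hL'⟩ := hasFDerivAt_contactForm q Z
    have h1 : HasFDerivAt (fun p => fderiv ℝ u p Z) _ q :=
      hd.hasFDerivAt.clm_apply (hasFDerivAt_const Z q)
    have h2 := hr.hasFDerivAt.mul ((hN.hasFDerivAt.inner ℝ (hasFDerivAt_const Z.1 q)).sub
      (ha.hasFDerivAt.mul hL))
    have h3 := h1.unique (h2.congr_of_eventuallyEq (h.mono fun p hp => hp Z))
    have h4 := DFunLike.congr_fun h3 W
    rw [mem_tanPlane] at hZ
    simp [hL', hZ] at h4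
    rw [h4]
    ring
  rw [key Y X hY, key X Y hX] at hs
  have hs' := mul_left_cancel₀ hr0 hs
  rw [inner_J_swap Y.1 X.1] at hs'
  linear_combination hs'

end LocalDefiningFunction

section LocalFrame

variable {n : ℕ} {M : Type*} [TopologicalSpace M] [ChartedSpace (EuclideanSpace ℝ (Fin (2 * n))) M]

lemma finrank_tangent {ι : M → H n} (himm : IsImmersedHypersurface ι) (p : M) :
    Module.finrank ℝ (tangent ι p) = 2 * n := by
  have h := LinearMap.finrank_range_of_inj
    (f := (mfderiv (𝓡 (2 * n)) 𝓘(ℝ, H n) ι p).toLinearMap) (himm.2 p)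
  refine h.trans ?_
  exact finrank_euclideanSpace_fin

lemma tangent_eq_ker {ι : M → H n} (himm : IsImmersedHypersurface ι) {p : M}
    {L : H n →L[ℝ] ℝ} (hL : L ≠ 0) (h : ∀ X ∈ tangent ι p, L X = 0) :
    tangent ι p = LinearMap.ker L.toLinearMap := by
  refine Submodule.eq_of_le_of_finrank_eq (fun X hX => h X hX) ?_
  have h1 := Module.Dual.finrank_ker_add_one_of_ne_zero (f := L.toLinearMap)
    (fun h0 => hL (ContinuousLinearMap.coe_injective h0))
  have h2 : Module.finrank ℝ (H n) = 2 * n + 1 := by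
    rw [Module.finrank_prod, finrank_euclideanSpace]
    simp
    ring
  rw [finrank_tangent himm]
  omega

/-- N is the normalized horizontal gradient of a local defining function u, and a is -Tu divided by
its length. Regularity guarantees that this length is nonzero: otherwise du would be a nonzero
multiple of Θ, and the tangent plane would be the contact plane. -/
lemma exists_isLocalFrame {ι : M → H n} (himm : IsImmersedHypersurface ι)
    (hsmooth : IsSmoothOnRegularPart ι) {p : M} (hp : p ∈ regularSet ι) :
    ∃ (B : Set M) (V : Set (H n)) (N : H n → E n) (a : H n → ℝ),
      p ∈ B ∧ IsLocalFrame ι B V N a := by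
  obtain ⟨V₀, u, hV₀, hpV₀, hu, hdu, hu0⟩ := hsmooth p hp
  have hker : ∀ q, ι q ∈ V₀ → (∀ᶠ m in 𝓝 q, u (ι m) = 0) →
      tangent ι q = LinearMap.ker (fderiv ℝ u (ι q)).toLinearMap := by
    intro q hqV hq0
    refine tangent_eq_ker himm (hdu _ hqV) fun X hX => ?_
    obtain ⟨x, rfl⟩ : ∃ x, mfderiv (𝓡 (2 * n)) 𝓘(ℝ, H n) ι q x = X := hX
    rw [← mfderiv_comp_apply_eq himm (IsUmbilicPiece.differentiableAt hV₀ hu hqV)]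
    have h0 : (fun m => u (ι m)) =ᶠ[𝓝 q] fun _ => (0 : ℝ) := hq0
    rw [h0.mfderiv_eq, mfderiv_const]
    rfl
  have hcont := contDiffOn_horGrad hV₀ hu
  have hDp : horGrad u (ι p) ≠ 0 := by
    intro h0
    refine hp ?_
    rw [hker p hpV₀ hu0]
    have hT : fderiv ℝ u (ι p) (T n) ≠ 0 := by
      intro hT
      refine hdu _ hpV₀ (ContinuousLinearMap.ext fun X => ?_)
      rw [fderiv_eq_horGrad, h0, hT]
      simp
    ext X
    rw [contactPlane, LinearMap.mem_ker, LinearMap.mem_ker, ContinuousLinearMap.coe_coe,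
      fderiv_eq_horGrad, h0, inner_zero_left, zero_add]
    simp [hT]
  set V : Set (H n) := V₀ ∩ horGrad u ⁻¹' {0}ᶜ with hVdef
  have hVopen : IsOpen V := hcont.continuousOn.isOpen_inter_preimage hV₀ isOpen_compl_singleton
  obtain ⟨B₀, hB₀, hB₀o, hpB₀⟩ := eventually_nhds_iff.1 hu0
  set B : Set M := B₀ ∩ ι ⁻¹' V
  have hBopen : IsOpen B := hB₀o.inter (hVopen.preimage himm.1.continuous)
  have hDV : ContDiffOn ℝ ∞ (horGrad u) V := hcont.mono inter_subset_left
  have hne : ∀ q ∈ V, ‖horGrad u q‖ ≠ 0 := fun q hq => norm_ne_zero_iff.2 hq.2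
  have hnorm : ContDiffOn ℝ ∞ (fun q => ‖horGrad u q‖) V := hDV.norm ℝ fun q hq => hq.2
  have hinv : ContDiffOn ℝ ∞ (fun q => ‖horGrad u q‖⁻¹) V := hnorm.inv hne
  have hN : ContDiffOn ℝ ∞ (fun q => ‖horGrad u q‖⁻¹ • horGrad u q) V := hinv.smul hDV
  have hut : ContDiffOn ℝ ∞ (fun q => fderiv ℝ u q (T n)) V :=
    ((hu.mono inter_subset_left).fderiv_of_isOpen hVopen (by simp)).clm_apply contDiffOn_const
  have ha : ContDiffOn ℝ ∞ (fun q => -(‖horGrad u q‖⁻¹ * fderiv ℝ u q (T n))) V :=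
    (hinv.mul hut).neg
  have hform : ∀ q ∈ V, ∀ Y, fderiv ℝ u q Y = ‖horGrad u q‖ *
      (inner ℝ (‖horGrad u q‖⁻¹ • horGrad u q) Y.1
        - -(‖horGrad u q‖⁻¹ * fderiv ℝ u q (T n)) * contactForm q Y) := by
    intro q hq Y
    rw [inner_smul_left, fderiv_eq_horGrad u q Y]
    have := hne q hq
    simp only [conj_trivial]
    field_simp
    ring
  refine ⟨B, V, fun q => ‖horGrad u q‖⁻¹ • horGrad u q,
    fun q => -(‖horGrad u q‖⁻¹ * fderiv ℝ u q (T n)), ⟨hpB₀, hpV₀, hDp⟩, hBopen, hVopen,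
    fun q hq => hq.2, hN, ha, fun q hq => norm_smul_inv_norm hq.2, fun q hq => ?_, ?_⟩
  · rw [hker q hq.2.1 (by filter_upwards [hB₀o.mem_nhds hq.1] with m hm using hB₀ m hm)]
    ext X
    rw [LinearMap.mem_ker, ContinuousLinearMap.coe_coe, hform _ hq.2, mem_tanPlane, mul_eq_zero,
      or_iff_right (hne _ hq.2), sub_eq_zero]
  · intro q hq X hX Y hY
    exact frobenius_of_fderiv_eq (contDiffAt_infty.1 (hu.contDiffAt (hV₀.mem_nhds hq.1)) 2)
      (IsUmbilicPiece.differentiableAt hVopen hN hq) (IsUmbilicPiece.differentiableAt hVopen ha hq)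
      (IsUmbilicPiece.differentiableAt hVopen hnorm hq) (hne q hq)
      (by filter_upwards [hVopen.mem_nhds hq] with p hp using hform p hp) hX hY

end LocalFrame

/-! ### The immersion in charts. -/

section Charts

variable {n : ℕ} {M : Type*} [TopologicalSpace M] [ChartedSpace (EuclideanSpace ℝ (Fin (2 * n))) M]
  [IsManifold (𝓡 (2 * n)) 2 M]

/-- The immersion in the preferred chart at `p`. -/
def localMap (ι : M → H n) (p : M) (x : EuclideanSpace ℝ (Fin (2 * n))) : H n :=
  ι ((chartAt (EuclideanSpace ℝ (Fin (2 * n))) p).symm x)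

lemma contDiffOn_localMap {ι : M → H n} (himm : IsImmersedHypersurface ι) (p : M) :
    ContDiffOn ℝ 2 (localMap ι p) (chartAt (EuclideanSpace ℝ (Fin (2 * n))) p).target := by
  rw [← contMDiffOn_iff_contDiffOn]
  exact himm.1.comp_contMDiffOn (contMDiffOn_chart_symm (I := 𝓡 (2 * n)) (n := 2))

lemma fderiv_localMap {ι : M → H n} (himm : IsImmersedHypersurface ι) (p : M)
    {x : EuclideanSpace ℝ (Fin (2 * n))}
    (hx : x ∈ (chartAt (EuclideanSpace ℝ (Fin (2 * n))) p).target) :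
    Function.Injective (fderiv ℝ (localMap ι p) x) ∧
      LinearMap.range (fderiv ℝ (localMap ι p) x).toLinearMap
        = tangent ι ((chartAt (EuclideanSpace ℝ (Fin (2 * n))) p).symm x) := by
  set e := chartAt (EuclideanSpace ℝ (Fin (2 * n))) p
  have he := (mdifferentiable_chart (I := 𝓡 (2 * n)) p).symm
  have hb := he.mfderiv_bijective hx
  have hcomp := mfderiv_comp x (g := ι) (f := e.symm) (I := 𝓡 (2 * n)) (I' := 𝓡 (2 * n))
    (I'' := 𝓘(ℝ, H n)) ((himm.1 (e.symm x)).mdifferentiableAt (by norm_num))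
    (he.mdifferentiableAt hx)
  rw [mfderiv_eq_fderiv] at hcomp
  have happ : ∀ y, fderiv ℝ (localMap ι p) x y = mfderiv (𝓡 (2 * n)) 𝓘(ℝ, H n) ι (e.symm x)
      (mfderiv (𝓡 (2 * n)) (𝓡 (2 * n)) e.symm x y) := fun y => DFunLike.congr_fun hcomp y
  constructor
  · intro y y' hyy
    rw [happ, happ] at hyy
    exact hb.1 (himm.2 _ hyy)
  · ext X
    constructor
    · rintro ⟨y, rfl⟩
      exact ⟨_, (happ y).symm⟩
    · rintro ⟨z, rfl⟩
      obtain ⟨y, rfl⟩ := hb.2 z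
      exact ⟨y, happ y⟩

lemma mem_tangent_of_localMap {ι : M → H n} (himm : IsImmersedHypersurface ι) (p : M)
    {x : EuclideanSpace ℝ (Fin (2 * n))}
    (hx : x ∈ (chartAt (EuclideanSpace ℝ (Fin (2 * n))) p).target)
    (y : EuclideanSpace ℝ (Fin (2 * n))) :
    fderiv ℝ (localMap ι p) x y
      ∈ tangent ι ((chartAt (EuclideanSpace ℝ (Fin (2 * n))) p).symm x) := by
  rw [← (fderiv_localMap himm p hx).2]
  exact ⟨y, rfl⟩

/-- A function whose derivative vanishes on the tangent spaces is locally constant. -/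
lemma eventually_eq_of_fderiv_eq_zero {ι : M → H n} (himm : IsImmersedHypersurface ι)
    {F : Type*} [NormedAddCommGroup F] [NormedSpace ℝ F] {f : H n → F} {B : Set M}
    (hB : IsOpen B) (hd : ∀ q ∈ B, DifferentiableAt ℝ f (ι q))
    (h0 : ∀ q ∈ B, ∀ X ∈ tangent ι q, fderiv ℝ f (ι q) X = 0) {p : M} (hp : p ∈ B) :
    ∀ᶠ q in 𝓝 p, f (ι q) = f (ι p) := by
  set e := chartAt (EuclideanSpace ℝ (Fin (2 * n))) p with he
  have hpe : p ∈ e.source := mem_chart_source _ p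
  have hopen : IsOpen (e.target ∩ e.symm ⁻¹' B) := e.isOpen_inter_preimage_symm hB
  obtain ⟨r, hr, hball⟩ := Metric.isOpen_iff.1 hopen (e p)
    ⟨e.map_source hpe, by rwa [mem_preimage, e.left_inv hpe]⟩
  have hder : ∀ x ∈ Metric.ball (e p) r,
      HasFDerivAt (fun y => f (localMap ι p y)) (0 : _ →L[ℝ] F) x := by
    intro x hx
    obtain ⟨hxt, hxB⟩ := hball hx
    have h1 : DifferentiableAt ℝ (localMap ι p) x :=
      ((contDiffOn_localMap himm p).contDiffAt (e.open_target.mem_nhds hxt)).differentiableAt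
        (by norm_num)
    have h2 := (hd _ hxB).hasFDerivAt.comp x h1.hasFDerivAt
    refine h2.congr_fderiv (ContinuousLinearMap.ext fun y => ?_)
    exact h0 _ hxB _ (mem_tangent_of_localMap himm p hxt y)
  have hconst : ∀ x ∈ Metric.ball (e p) r, f (localMap ι p x) = f (localMap ι p (e p)) := by
    intro x hx
    refine (convex_ball (e p) r).is_const_of_fderivWithin_eq_zero (𝕜 := ℝ)
      (fun y hy => (hder y hy).differentiableAt.differentiableWithinAt) (fun y hy => ?_) hx
      (Metric.mem_ball_self hr)
    rw [fderivWithin_of_isOpen Metric.isOpen_ball hy, (hder y hy).fderiv]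
  have hnear : ∀ᶠ q in 𝓝 p, q ∈ e.source ∧ e q ∈ Metric.ball (e p) r :=
    (e.open_source.eventually_mem hpe).and
      ((e.continuousAt hpe).eventually (Metric.ball_mem_nhds _ hr))
  filter_upwards [hnear] with q hq
  have := hconst _ hq.2
  simp only [localMap] at this
  rwa [e.left_inv hq.1, e.left_inv hpe] at this

end Charts
end Heis

namespace Heis

open Set Filter Topology

/-! ### Pieces of Pansu spheres: uniqueness, existence, relative closedness. -/

section PansuNear

variable {n : ℕ} {M : Type*} [TopologicalSpace M] [ChartedSpace (EuclideanSpace ℝ (Fin (2 * n))) M]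

/-- Near `p` the hypersurface is a piece of the Pansu sphere with umbilicity `lam`, center `c` and
height `t`, and `e` is the choice of `e_n` for which `k = lam`. -/
def IsPansuOn (ι : M → H n) (lam : ℝ) (c : E n) (t : ℝ) (U : Set M) (e : M → E n) : Prop :=
  IsCharField ι U e ∧ ∀ q ∈ U, IsUmbilicWith ι e q lam ∧
    centerOf lam (horNormal e q) (alpha ι e q) (ι q).1 = c ∧
    (ι q).2 + inner ℝ (J c) (ι q).1 - heightFun lam (alpha ι e q) = t

/-- The set of points near which the hypersurface is a piece of a given Pansu sphere. -/
def pansuPart (ι : M → H n) (lam : ℝ) (c : E n) (t : ℝ) : Set M :=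
  {p | ∃ U e, p ∈ U ∧ IsPansuOn ι lam c t U e}

lemma isOpen_pansuPart (ι : M → H n) (lam : ℝ) (c : E n) (t : ℝ) :
    IsOpen (pansuPart ι lam c t) := by
  rw [isOpen_iff_mem_nhds]
  rintro p ⟨U, e, hp, hU⟩
  filter_upwards [hU.1.1.mem_nhds hp] with q hq
  exact ⟨U, e, hq, hU⟩

lemma pansuPart_subset (ι : M → H n) (lam : ℝ) (c : E n) (t : ℝ) :
    pansuPart ι lam c t ⊆ regularSet ι := by
  rintro p ⟨U, e, hp, hU⟩
  exact hU.1.2.1 hp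

/-- Two choices of `e_n` near an umbilic point agree or are opposite to each other. -/
lemma IsLocalFrame.isUmbilicWith_unique (hn : 2 ≤ n) {ι : M → H n} {B : Set M} {V : Set (H n)}
    {N : H n → E n} {a : H n → ℝ} (h : IsLocalFrame ι B V N a) (himm : IsImmersedHypersurface ι)
    {U : Set M} {e : M → E n} (he : IsCharField ι U e) {q : M} (hq : q ∈ B) (hqU : q ∈ U)
    {k : ℝ} (hk : IsUmbilicWith ι e q k) {k' : ℝ}
    (hk' : ∀ v, inner ℝ (N (ι q)) v = 0 → inner ℝ (J (N (ι q))) v = 0 →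
      fderiv ℝ N (ι q) (frameVec (ι q) v) = a (ι q) • J v - k' • v) :
    ((∀ᶠ m in 𝓝 q, e m = -J (N (ι m))) ∧ k = k') ∨
      ((∀ᶠ m in 𝓝 q, e m = J (N (ι m))) ∧ k = -k') := by
  -- A nonzero vector of ξ' is needed to read off k; it exists because n ≥ 2.
  obtain ⟨v, hv1, hv2, hv3⟩ := exists_unit_orthogonal hn (N (ι q))
  have hv0 : v ≠ 0 := by rintro rfl; simp at hv1
  have h0 := hk' v hv2 hv3
  rcases h.charField_eventually himm he hq hqU with h1 | h1
  · refine Or.inl ⟨h1, ?_⟩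
    have h2 := (h.isUmbilicWith_iff himm hq h1).1 hk v hv2 hv3
    rw [h0, sub_right_inj] at h2
    exact (smul_left_injective ℝ hv0 h2).symm
  · refine Or.inr ⟨h1, ?_⟩
    have h1' : ∀ᶠ m in 𝓝 q, e m = -J (-N (ι m)) := by
      filter_upwards [h1] with m hm
      rw [hm, map_neg, neg_neg]
    have h2 := (h.neg.isUmbilicWith_iff himm hq h1').1 hk v (by rw [inner_neg_left, hv2, neg_zero])
      (by rw [map_neg, inner_neg_left, hv3, neg_zero])
    have e1 : fderiv ℝ (fun q => -N q) (ι q) = -fderiv ℝ N (ι q) := fderiv_neg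
    rw [e1, neg_apply, h0] at h2
    have h3 : k • v = (-k') • v := by
      rw [neg_smul]
      linear_combination (norm := module) h2
    exact smul_left_injective ℝ hv0 h3

/-- Two choices of `e_n` with positive umbilicity agree. -/
lemma charField_unique (hn : 2 ≤ n) {ι : M → H n} (himm : IsImmersedHypersurface ι)
    (hsmooth : IsSmoothOnRegularPart ι) {U U' : Set M} {e e' : M → E n}
    (he : IsCharField ι U e) (he' : IsCharField ι U' e') {q : M} (hqU : q ∈ U) (hqU' : q ∈ U')
    {k k' : ℝ} (hk : IsUmbilicWith ι e q k) (hk' : IsUmbilicWith ι e' q k') (hpos : 0 < k)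
    (hpos' : 0 < k') : k = k' ∧ (∀ᶠ m in 𝓝 q, e m = e' m) ∧ alpha ι e q = alpha ι e' q := by
  obtain ⟨B, V, N, a, hq, h⟩ := exists_isLocalFrame himm hsmooth (he.2.1 hqU)
  have key : ∀ {N : H n → E n} {a : H n → ℝ}, IsLocalFrame ι B V N a →
      (∀ᶠ m in 𝓝 q, e m = -J (N (ι m))) →
      k = k' ∧ (∀ᶠ m in 𝓝 q, e m = e' m) ∧ alpha ι e q = alpha ι e' q := by
    intro N a h h1
    rcases h.isUmbilicWith_unique hn himm he' hq hqU' hk' ((h.isUmbilicWith_iff himm hq h1).1 hk)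
      with ⟨h2, h3⟩ | ⟨h2, h3⟩
    · refine ⟨h3.symm, ?_, ?_⟩
      · filter_upwards [h1, h2] with m hm1 hm2
        rw [hm1, hm2]
      · rw [h.alpha_eq hq h1.self_of_nhds, h.alpha_eq hq h2.self_of_nhds]
    · linarith
  rcases h.charField_eventually himm he hq hqU with h1 | h1
  · exact key h h1
  · refine key h.neg ?_
    filter_upwards [h1] with m hm
    rw [hm, map_neg, neg_neg]

/-- Positivity of both constants fixes the sign of e_n at q; then λ, c and t are all determined by
N, a and the point. -/
lemma pansuPart_unique (hn : 2 ≤ n) {ι : M → H n} (himm : IsImmersedHypersurface ι)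
    (hsmooth : IsSmoothOnRegularPart ι) {lam lam' : ℝ} (hl : 0 < lam) (hl' : 0 < lam') {c c' : E n}
    {t t' : ℝ} {q : M} (hq : q ∈ pansuPart ι lam c t) (hq' : q ∈ pansuPart ι lam' c' t') :
    lam = lam' ∧ c = c' ∧ t = t' := by
  obtain ⟨U, e, hqU, hU, h⟩ := hq
  obtain ⟨U', e', hqU', hU', h'⟩ := hq'
  obtain ⟨h1, h2, h3⟩ := h q hqU
  obtain ⟨h1', h2', h3'⟩ := h' q hqU'
  obtain ⟨hk, he, ha⟩ := charField_unique hn himm hsmooth hU hU' hqU hqU' h1 h1' hl hl'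
  have hN : horNormal e q = horNormal e' q := by rw [horNormal, horNormal, he.self_of_nhds]
  subst hk
  rw [hN, ha, h2'] at h2
  subst h2
  rw [ha, h3'] at h3
  exact ⟨rfl, rfl, h3.symm⟩

variable [IsManifold (𝓡 (2 * n)) 2 M]

/-- The first integrals become constant in turn, on shrinking neighborhoods: constancy of the center
uses k = λ near the point, and constancy of the height uses the constant center. -/
lemma IsLocalFrame.mem_pansuPart (hn : 2 ≤ n) {ι : M → H n} {B : Set M} {V : Set (H n)}
    {N : H n → E n} {a : H n → ℝ} (h : IsLocalFrame ι B V N a) (himm : IsImmersedHypersurface ι)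
    (humb : IsUmbilic ι) (hlk : EllEqTwoK ι) {p : M} (hp : p ∈ B)
    (hpos : 0 < umbilicity N (ι p)) :
    ∃ c t, p ∈ pansuPart ι (umbilicity N (ι p)) c t := by
  set lam := umbilicity N (ι p)
  have hpc := h.isUmbilicPiece himm humb hlk
  have hkc := eventually_eq_of_fderiv_eq_zero himm h.isOpen_B
    (fun q hq => IsUmbilicPiece.differentiableAt h.isOpen_V hpc.contDiffOn_k (h.mapsTo hq))
    (fun q hq X hX => hpc.fderiv_k_eq_zero hn ⟨q, hq, rfl⟩ (by rwa [← h.tangent_eq q hq])) hp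
  obtain ⟨B₁, hB₁, hB₁o, hpB₁⟩ := eventually_nhds_iff.1 (hkc.and (h.isOpen_B.eventually_mem hp))
  have h1 := h.mono hB₁o (fun q hq => (hB₁ q hq).2)
  have hpc1 := h1.isUmbilicPiece himm humb hlk
  have hk1 : ∀ q ∈ ι '' B₁, umbilicity N q = lam := by
    rintro _ ⟨q, hq, rfl⟩
    exact (hB₁ q hq).1
  have hcc := eventually_eq_of_fderiv_eq_zero himm hB₁o
    (fun q hq => IsUmbilicPiece.differentiableAt h.isOpen_V (hpc1.contDiffOn_center hpos.ne')
      (h1.mapsTo hq))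
    (fun q hq X hX => hpc1.fderiv_center_eq_zero hn hpos.ne' hk1 ⟨q, hq, rfl⟩
      (by rwa [← h1.tangent_eq q hq])) hpB₁
  set c := centerOf lam (N (ι p)) (a (ι p)) (ι p).1
  obtain ⟨B₂, hB₂, hB₂o, hpB₂⟩ := eventually_nhds_iff.1 (hcc.and (hB₁o.eventually_mem hpB₁))
  have h2 := h1.mono hB₂o (fun q hq => (hB₂ q hq).2)
  have hpc2 := h2.isUmbilicPiece himm humb hlk
  have hk2 : ∀ q ∈ ι '' B₂, umbilicity N q = lam := by
    rintro _ ⟨q, hq, rfl⟩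
    exact (hB₁ q (hB₂ q hq).2).1
  have hc2 : ∀ q ∈ ι '' B₂, centerOf lam (N q) (a q) q.1 = c := by
    rintro _ ⟨q, hq, rfl⟩
    exact (hB₂ q hq).1
  have htc := eventually_eq_of_fderiv_eq_zero himm hB₂o
    (fun q hq => IsUmbilicPiece.differentiableAt h.isOpen_V (hpc2.contDiffOn_height hpos.ne' c)
      (h2.mapsTo hq))
    (fun q hq X hX => hpc2.fderiv_height_eq_zero hn hpos.ne' hk2 hc2 ⟨q, hq, rfl⟩
      (by rwa [← h2.tangent_eq q hq])) hpB₂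
  obtain ⟨B₃, hB₃, hB₃o, hpB₃⟩ := eventually_nhds_iff.1 (htc.and (hB₂o.eventually_mem hpB₂))
  have h3 := h2.mono hB₃o (fun q hq => (hB₃ q hq).2)
  refine ⟨c, (ι p).2 + inner ℝ (J c) (ι p).1 - heightFun lam (a (ι p)), B₃, _, hpB₃,
    h3.isCharField himm, fun q hq => ⟨?_, ?_, ?_⟩⟩
  · have := h3.isUmbilicWith_of_isUmbilic himm humb hlk hq
    rwa [hk2 _ ⟨q, (hB₃ q hq).2, rfl⟩] at this
  · rw [horNormal_eq, h3.alpha_eq hq rfl]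
    exact hc2 _ ⟨q, (hB₃ q hq).2, rfl⟩
  · rw [h3.alpha_eq hq rfl]
    exact (hB₃ q hq).1

/-- Near a regular point, either `k = 0` or the hypersurface is a piece of a Pansu sphere. -/
lemma exists_mem_pansuPart (hn : 2 ≤ n) {ι : M → H n} (himm : IsImmersedHypersurface ι)
    (hsmooth : IsSmoothOnRegularPart ι) (humb : IsUmbilic ι) (hlk : EllEqTwoK ι) {p : M}
    (hp : p ∈ regularSet ι) {k : ℝ} {U : Set M} {e : M → E n} (hpU : p ∈ U)
    (he : IsCharField ι U e) (hk : IsUmbilicWith ι e p k) (hk0 : k ≠ 0) :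
    ∃ lam c t, 0 < lam ∧ p ∈ pansuPart ι lam c t := by
  obtain ⟨B, V, N, a, hpB, h⟩ := exists_isLocalFrame himm hsmooth hp
  have hu := h.isUmbilicWith_of_isUmbilic himm humb hlk hpB
  have hne : umbilicity N (ι p) ≠ 0 := by
    rcases h.isUmbilicWith_unique hn himm he hpB hpU hk
      ((h.isUmbilicWith_iff himm hpB (Eventually.of_forall fun _ => rfl)).1 hu) with h1 | h1
    · exact fun h0 => hk0 (by rw [h1.2, h0])
    · exact fun h0 => hk0 (by rw [h1.2, h0, neg_zero])
  -- If k is negative for this frame, the opposite frame is used.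
  rcases lt_or_gt_of_ne hne with h1 | h1
  · have h2 : 0 < umbilicity (fun q => -N q) (ι p) := by rw [umbilicity_neg]; linarith
    obtain ⟨c, t, hct⟩ := h.neg.mem_pansuPart hn himm humb hlk hpB h2
    exact ⟨_, c, t, h2, hct⟩
  · obtain ⟨c, t, hct⟩ := h.mem_pansuPart hn himm humb hlk hpB h1
    exact ⟨_, c, t, h1, hct⟩

/-- The part of the hypersurface that lies on a Pansu sphere is closed in the regular part. -/
lemma mem_pansuPart_of_mem_closure (hn : 2 ≤ n) {ι : M → H n} (himm : IsImmersedHypersurface ι)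
    (hsmooth : IsSmoothOnRegularPart ι) (humb : IsUmbilic ι) (hlk : EllEqTwoK ι) {lam : ℝ}
    (hl : 0 < lam) {c : E n} {t : ℝ} {p : M} (hp : p ∈ regularSet ι)
    (hcl : p ∈ closure (pansuPart ι lam c t)) : p ∈ pansuPart ι lam c t := by
  obtain ⟨B, V, N, a, hpB, h⟩ := exists_isLocalFrame himm hsmooth hp
  have hpc := h.isUmbilicPiece himm humb hlk
  have hkc := eventually_eq_of_fderiv_eq_zero himm h.isOpen_B
    (fun q hq => IsUmbilicPiece.differentiableAt h.isOpen_V hpc.contDiffOn_k (h.mapsTo hq))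
    (fun q hq X hX => hpc.fderiv_k_eq_zero hn ⟨q, hq, rfl⟩ (by rwa [← h.tangent_eq q hq])) hpB
  obtain ⟨q, hq, hqB, hqk⟩ :=
    ((mem_closure_iff_frequently.1 hcl).and_eventually
      ((h.isOpen_B.eventually_mem hpB).and hkc)).exists
  have hu := h.isUmbilicWith_of_isUmbilic himm humb hlk hpB
  -- The local constancy of k carries the value ±λ from the nearby point q to p.
  have hne : umbilicity N (ι p) ≠ 0 := by
    obtain ⟨U, e, hqU, hU, hU'⟩ := hq
    rcases h.isUmbilicWith_unique hn himm hU hqB hqU (hU' q hqU).1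
      ((h.isUmbilicWith_iff himm hqB (Eventually.of_forall fun _ => rfl)).1
        (h.isUmbilicWith_of_isUmbilic himm humb hlk hqB)) with h1 | h1
    · rw [← hqk, ← h1.2]; exact hl.ne'
    · intro h0
      rw [hqk, h0, neg_zero] at h1
      exact hl.ne' h1.2
  obtain ⟨lam', c', t', hl', hp'⟩ := exists_mem_pansuPart hn himm hsmooth humb hlk hp hpB
    (h.isCharField himm) hu hne
  -- The piece through p is open, so it meets the given one, and uniqueness identifies their
  -- parameters.
  obtain ⟨q, hq, hq'⟩ := ((mem_closure_iff_frequently.1 hcl).and_eventually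
    ((isOpen_pansuPart ι lam' c' t').eventually_mem hp')).exists
  obtain ⟨rfl, rfl, rfl⟩ := pansuPart_unique hn himm hsmooth hl hl' hq hq'
  exact hp'

end PansuNear
end Heis

/-! ### Existence of a Pansu piece at a farthest point. -/

namespace Heis

open Set Filter Topology

/-- The second derivative is nonpositive at a local maximum. -/
lemma second_deriv_nonpos_of_isLocalMax {g h : ℝ → ℝ} {x c : ℝ} (hmax : IsLocalMax g x)
    (hg : ∀ᶠ s in 𝓝 x, HasDerivAt g (h s) s) (hh : HasDerivAt h c x) : c ≤ 0 := by
  by_contra! hc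
  have hd : deriv g =ᶠ[𝓝 x] h := hg.mono fun s hs => hs.deriv
  have h1 : deriv (deriv g) x = c := by rw [hd.deriv_eq, hh.deriv]
  -- With a positive second derivative x would also be a local minimum, so g would be constant near
  -- x.
  have hmin : IsLocalMin g x := isLocalMin_of_deriv_deriv_pos (by rw [h1]; exact hc)
    hmax.deriv_eq_zero hg.self_of_nhds.continuousAt
  have hconst : g =ᶠ[𝓝 x] fun _ => g x := by
    filter_upwards [hmax, hmin] with s h2 h3
    exact le_antisymm h2 h3
  have h4 : deriv g =ᶠ[𝓝 x] fun _ => (0 : ℝ) := by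
    filter_upwards [hconst.deriv] with s hs
    rw [hs, deriv_const]
  rw [h4.deriv_eq, deriv_const] at h1
  exact hc.ne h1

lemma hasDerivAt_fst {E F : Type*} [NormedAddCommGroup E] [NormedSpace ℝ E] [NormedAddCommGroup F]
    [NormedSpace ℝ F] {γ : ℝ → E × F} {c : E × F} {s : ℝ} (h : HasDerivAt γ c s) :
    HasDerivAt (fun x => (γ x).1) c.1 s := by
  simpa using h.hasFDerivAt.fst.hasDerivAt

lemma hasDerivAt_snd {E F : Type*} [NormedAddCommGroup E] [NormedSpace ℝ E] [NormedAddCommGroup F]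
    [NormedSpace ℝ F] {γ : ℝ → E × F} {c : E × F} {s : ℝ} (h : HasDerivAt γ c s) :
    HasDerivAt (fun x => (γ x).2) c.2 s := by
  simpa using h.hasFDerivAt.snd.hasDerivAt

section FarthestPoint

variable {n : ℕ} {M : Type*} [TopologicalSpace M] [ChartedSpace (EuclideanSpace ℝ (Fin (2 * n))) M]
  [IsManifold (𝓡 (2 * n)) 2 M]

/-- The tangent space at a point farthest from the vertical axis. -/
lemma inner_eq_zero_of_isMaxOn {ι : M → H n} (himm : IsImmersedHypersurface ι) {p : M}
    (hmax : ∀ q, ‖(ι q).1‖ ≤ ‖(ι p).1‖) {X : H n} (hX : X ∈ tangent ι p) :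
    inner ℝ (ι p).1 X.1 = 0 := by
  set e := chartAt (EuclideanSpace ℝ (Fin (2 * n))) p with he
  have hpe : p ∈ e.source := mem_chart_source _ p
  have hxt : e p ∈ e.target := e.map_source hpe
  have hr := (fderiv_localMap himm p hxt).2
  rw [e.left_inv hpe] at hr
  rw [← hr] at hX
  obtain ⟨y, rfl⟩ := hX
  have hval : localMap ι p (e p) = ι p := by rw [localMap, e.left_inv hpe]
  have hd : HasFDerivAt (localMap ι p) (fderiv ℝ (localMap ι p) (e p)) (e p) :=
    (((contDiffOn_localMap himm p).contDiffAt (e.open_target.mem_nhds hxt)).differentiableAt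
      (by norm_num)).hasFDerivAt
  have h1 := hd.fst.inner ℝ hd.fst
  have h2 : IsLocalMax (fun x => inner ℝ (localMap ι p x).1 (localMap ι p x).1) (e p) := by
    refine Eventually.of_forall fun x => ?_
    simp only [real_inner_self_eq_norm_sq]
    rw [hval]
    exact pow_le_pow_left₀ (norm_nonneg _) (hmax _) 2
  have h3 := DFunLike.congr_fun (h2.hasFDerivAt_eq_zero h1) y
  simp [hval, real_inner_comm] at h3
  rw [real_inner_comm]
  first | exact h3 | (rw [real_inner_comm]; exact h3)

/-- An immersion into the t-axis would embed ℝ^{2n} linearly in ℝ. -/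
lemma exists_ne_zero {ι : M → H n} (hn : 2 ≤ n) (himm : IsImmersedHypersurface ι) (p : M) :
    ∃ q, (ι q).1 ≠ 0 := by
  by_contra! h0
  set e := chartAt (EuclideanSpace ℝ (Fin (2 * n))) p with he
  have hpe : p ∈ e.source := mem_chart_source _ p
  have hxt : e p ∈ e.target := e.map_source hpe
  have hd : HasFDerivAt (localMap ι p) (fderiv ℝ (localMap ι p) (e p)) (e p) :=
    (((contDiffOn_localMap himm p).contDiffAt (e.open_target.mem_nhds hxt)).differentiableAt
      (by norm_num)).hasFDerivAt
  have h1 := hd.fst.unique ((hasFDerivAt_const (0 : E n) (e p)).congr_of_eventuallyEq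
    (Eventually.of_forall fun x => h0 _))
  have hinj : Function.Injective ((LinearMap.snd ℝ (E n) ℝ).comp
      (fderiv ℝ (localMap ι p) (e p)).toLinearMap) := by
    intro y y' hyy
    refine (fderiv_localMap himm p hxt).1 (Prod.ext ?_ hyy)
    exact (DFunLike.congr_fun h1 y).trans (DFunLike.congr_fun h1 y').symm
  have := LinearMap.finrank_le_finrank_of_injective hinj
  rw [finrank_euclideanSpace_fin, Module.finrank_self] at this
  omega

/-- At a point farthest from the vertical axis the hypersurface is regular and `k ≠ 0`. -/
lemma exists_mem_pansuPart_of_compact [CompactSpace M] [Nonempty M] {ι : M → H n} (hn : 2 ≤ n)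
    (himm : IsImmersedHypersurface ι) (hsmooth : IsSmoothOnRegularPart ι) (humb : IsUmbilic ι)
    (hlk : EllEqTwoK ι) : ∃ lam c t p, 0 < lam ∧ p ∈ pansuPart ι lam c t := by
  obtain ⟨p, -, hp⟩ := isCompact_univ.exists_isMaxOn (s := (univ : Set M)) univ_nonempty
    (f := fun q => ‖(ι q).1‖) (himm.1.continuous.fst.norm.continuousOn)
  have hmax : ∀ q, ‖(ι q).1‖ ≤ ‖(ι p).1‖ := fun q => hp (mem_univ q)
  have hz0 : (ι p).1 ≠ 0 := by
    obtain ⟨q, hq⟩ := exists_ne_zero hn himm p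
    intro h0
    have := hmax q
    rw [h0, norm_zero] at this
    exact hq (norm_le_zero_iff.1 this)
  have htan : ∀ X ∈ tangent ι p, inner ℝ (ι p).1 X.1 = 0 := fun X hX =>
    inner_eq_zero_of_isMaxOn himm hmax hX
  -- At the farthest point the tangent plane is {X : ⟨z, X⟩ = 0}, which contains T. It follows that
  -- p is regular, that a = 0, and that N is parallel to z.
  have hTmem : T n ∈ tangent ι p := by
    have hL : (innerSL ℝ (ι p).1).comp (ContinuousLinearMap.fst ℝ (E n) ℝ) ≠ 0 := by
      intro h0
      have := DFunLike.congr_fun h0 ((ι p).1, (0 : ℝ))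
      simp at this
      exact hz0 this
    rw [tangent_eq_ker himm hL fun X hX => htan X hX]
    simp [T]
  have hreg : p ∈ regularSet ι := by
    intro heq
    rw [heq, contactPlane, LinearMap.mem_ker, contactForm_T] at hTmem
    exact one_ne_zero hTmem
  obtain ⟨B, V, N, a, hpB, h⟩ := exists_isLocalFrame himm hsmooth hreg
  have hN1 := h.norm_N _ (h.mapsTo hpB)
  have ha0 : a (ι p) = 0 := by
    rw [h.tangent_eq p hpB, mem_tanPlane, contactForm_T] at hTmem
    simpa [T] using hTmem.symm
  set z := (ι p).1 with hz
  have hzN : z = inner ℝ (N (ι p)) z • N (ι p) := by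
    set y := z - inner ℝ (N (ι p)) z • N (ι p) with hy
    have h1 : inner ℝ (N (ι p)) y = 0 := by
      rw [hy, inner_sub_right, inner_smul_right, real_inner_self_eq_norm_sq, hN1]; ring
    have h2 : inner ℝ z y = 0 := by
      have := htan (frameVec (ι p) y) (by rwa [h.tangent_eq p hpB, frameVec_mem_tanPlane])
      rwa [frameVec_eq] at this
    have h3 : inner ℝ y y = (0 : ℝ) := by
      nth_rewrite 1 [hy]
      rw [inner_sub_left, h2, inner_smul_left, h1]; simp
    exact sub_eq_zero.1 (inner_self_eq_zero.1 h3)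
  have hu := h.isUmbilicWith_of_isUmbilic himm humb hlk hpB
  -- If k = 0, a curve in Σ with initial velocity JN has horizontal acceleration orthogonal to N,
  -- hence to z. Then |z|² has second derivative 2|JN|² = 2 at a maximum.
  have hne : umbilicity N (ι p) ≠ 0 := by
    intro hk0
    set e := chartAt (EuclideanSpace ℝ (Fin (2 * n))) p with he
    have hpe : p ∈ e.source := mem_chart_source _ p
    have hxt : e p ∈ e.target := e.map_source hpe
    have hval : localMap ι p (e p) = ι p := by rw [localMap, e.left_inv hpe]
    obtain ⟨y, hy⟩ : ∃ y, fderiv ℝ (localMap ι p) (e p) y = frameVec (ι p) (J (N (ι p))) := by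
      have h1 : frameVec (ι p) (J (N (ι p))) ∈ tangent ι p := by
        rw [h.tangent_eq p hpB, frameVec_mem_tanPlane, inner_self_J]
      have hr := (fderiv_localMap himm p hxt).2
      rw [e.left_inv hpe] at hr
      rw [← hr] at h1
      exact h1
    have hline : HasDerivAt (fun s : ℝ => e p + s • y) y 0 := by
      simpa using ((hasDerivAt_id (0 : ℝ)).smul_const y).const_add (e p)
    have hcl : ContinuousAt (fun s : ℝ => e p + s • y) 0 := hline.continuousAt
    have hx0 : e p + (0 : ℝ) • y = e p := by simp
    have hopen : IsOpen (e.target ∩ e.symm ⁻¹' B) := e.isOpen_inter_preimage_symm h.isOpen_B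
    have hmem : ∀ᶠ s : ℝ in 𝓝 0, e p + s • y ∈ e.target ∩ e.symm ⁻¹' B := by
      refine hcl.eventually (hopen.mem_nhds ?_)
      change e p + (0 : ℝ) • y ∈ _
      rw [hx0]
      exact ⟨hxt, by rwa [mem_preimage, e.left_inv hpe]⟩
    set γ : ℝ → H n := fun s => localMap ι p (e p + s • y)
    set γ' : ℝ → H n := fun s => fderiv ℝ (localMap ι p) (e p + s • y) y
    have hγ : ∀ᶠ s in 𝓝 (0 : ℝ), HasDerivAt γ (γ' s) s := by
      filter_upwards [hmem] with s hs
      have h1 : HasDerivAt (fun s : ℝ => e p + s • y) y s := by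
        simpa using ((hasDerivAt_id s).smul_const y).const_add (e p)
      exact (((contDiffOn_localMap himm p).contDiffAt
        (e.open_target.mem_nhds hs.1)).differentiableAt (by norm_num)).hasFDerivAt.comp_hasDerivAt
          s h1
    have hdd : DifferentiableAt ℝ (fderiv ℝ (localMap ι p)) (e p + (0 : ℝ) • y) := by
      rw [hx0]
      exact (((contDiffOn_localMap himm p).contDiffAt (e.open_target.mem_nhds hxt)).fderiv_right
        (m := 1) (by norm_num)).differentiableAt (by norm_num)
    have hγ'd : DifferentiableAt ℝ γ' 0 :=
      (DifferentiableAt.comp (0 : ℝ) hdd hline.differentiableAt).clm_apply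
        (differentiableAt_const y)
    have hγ2 := hγ'd.hasDerivAt
    set c := deriv γ' 0
    have hγ0 : γ 0 = ι p := by simp only [γ, hx0, hval]
    have hγ'0 : γ' 0 = frameVec (ι p) (J (N (ι p))) := by simp only [γ', hx0, hy]
    have hfst : (frameVec (ι p) (J (N (ι p)))).1 = J (N (ι p)) := by rw [frameVec_eq]
    have hγ1 := hγ.self_of_nhds
    have hNγ : HasDerivAt (fun s => N (γ s)) (fderiv ℝ N (ι p) (γ' 0)) 0 := by
      have := (h.differentiableAt_N hpB).hasFDerivAt
      rw [← hγ0] at this ⊢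
      exact this.comp_hasDerivAt 0 hγ1
    have haγ : HasDerivAt (fun s => a (γ s)) (fderiv ℝ a (ι p) (γ' 0)) 0 := by
      have := (IsUmbilicPiece.differentiableAt h.isOpen_V h.contDiffOn_a
        (h.mapsTo hpB)).hasFDerivAt
      rw [← hγ0] at this ⊢
      exact this.comp_hasDerivAt 0 hγ1
    have hΘ := (hasDerivAt_snd hγ2).add ((hasDerivAt_J (hasDerivAt_fst hγ1)).inner ℝ (hasDerivAt_fst hγ2))
    -- Tangency of the velocity along the curve, to be differentiated at 0: since a = 0, Θ(γ') = 0
    -- and ⟨dN(JN), JN⟩ = -2k = 0 there, only ⟨N, c.1⟩ survives.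
    have hrel : (fun s => inner ℝ (N (γ s)) (γ' s).1) =ᶠ[𝓝 0]
        fun s => a (γ s) * ((γ' s).2 + inner ℝ (J (γ s).1) (γ' s).1) := by
      filter_upwards [hmem] with s hs
      have h1 := mem_tangent_of_localMap himm p hs.1 y
      rw [h.tangent_eq _ hs.2, mem_tanPlane, contactForm_eq] at h1
      exact h1
    have h1 := ((hNγ.inner ℝ (hasDerivAt_fst hγ2)).unique
      ((haγ.mul hΘ).congr_of_eventuallyEq hrel))
    have hΘ0 : (γ' 0).2 + inner ℝ (J (γ 0).1) (γ' 0).1 = 0 := by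
      rw [← contactForm_eq, hγ0, hγ'0, contactForm_frameVec]
    rw [hγ0, hγ'0, hfst] at hΘ0
    have hk0' : inner ℝ (fderiv ℝ N (ι p) (frameVec (ι p) (J (N (ι p))))) (J (N (ι p)))
        = (0 : ℝ) := by
      rw [umbilicity] at hk0; linarith
    have h2 : inner ℝ (N (ι p)) c.1 = 0 := by
      simp only [Pi.add_apply, hγ0, ha0, hγ'0, hfst, hk0', hΘ0] at h1
      simpa using h1
    have hg : ∀ᶠ s in 𝓝 (0 : ℝ), HasDerivAt (fun s => inner ℝ (γ s).1 (γ s).1)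
        (2 * inner ℝ (γ s).1 (γ' s).1) s := by
      filter_upwards [hγ] with s hs
      refine ((hasDerivAt_fst hs).inner ℝ (hasDerivAt_fst hs)).congr_deriv ?_
      rw [real_inner_comm (γ s).1, two_mul]
    have hh := ((hasDerivAt_fst hγ1).inner ℝ (hasDerivAt_fst hγ2)).const_mul 2
    have hmaxγ : IsLocalMax (fun s => inner ℝ (γ s).1 (γ s).1) (0 : ℝ) := by
      refine Eventually.of_forall fun s => ?_
      simp only [real_inner_self_eq_norm_sq]
      rw [hγ0]
      exact pow_le_pow_left₀ (norm_nonneg _) (hmax _) 2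
    have h3 := second_deriv_nonpos_of_isLocalMax hmaxγ hg hh
    rw [hγ0, ← hz, hzN, inner_smul_left, h2, hγ'0, hfst, real_inner_self_eq_norm_sq, norm_J,
      hN1] at h3
    norm_num at h3
  obtain ⟨lam, c, t, hl, hct⟩ := exists_mem_pansuPart hn himm hsmooth humb hlk hreg hpB
    (h.isCharField himm) hu hne
  exact ⟨lam, c, t, p, hl, hct⟩

end FarthestPoint
end Heis

/-! ### Singular points and continuation across them. -/

namespace Heis

open Set Filter Topology

/-- The inverse function theorem for spaces of the same finite dimension. -/
lemma exists_openPartialHomeomorph {X Y : Type*} [NormedAddCommGroup X] [NormedSpace ℝ X]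
    [FiniteDimensional ℝ X] [NormedAddCommGroup Y] [NormedSpace ℝ Y] [FiniteDimensional ℝ Y]
    (hXY : Module.finrank ℝ X = Module.finrank ℝ Y) {f : X → Y} {f' : X →L[ℝ] Y} {x : X}
    (hf : ContDiffAt ℝ 1 f x) (hf' : HasFDerivAt f f' x) (hinj : ∀ y, f' y = 0 → y = 0) :
    ∃ φ : OpenPartialHomeomorph X Y, x ∈ φ.source ∧ ∀ y, φ y = f y := by
  have : CompleteSpace X := FiniteDimensional.complete ℝ X
  have hinj' : Function.Injective f'.toLinearMap :=
    (injective_iff_map_eq_zero f'.toLinearMap).2 hinj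
  set L := (LinearEquiv.ofInjectiveOfFinrankEq f'.toLinearMap hinj' hXY).toContinuousLinearEquiv
  have hL : (L : X →L[ℝ] Y) = f' := by
    ext y
    exact DFunLike.congr_fun (LinearEquiv.coe_ofInjectiveOfFinrankEq f'.toLinearMap hinj' hXY) y
  rw [← hL] at hf'
  exact ⟨hf.toOpenPartialHomeomorph f hf' (by norm_num),
    hf.mem_toOpenPartialHomeomorph_source hf' (by norm_num), fun y => rfl⟩

section Closure

variable {n : ℕ} {M : Type*} [TopologicalSpace M] [ChartedSpace (EuclideanSpace ℝ (Fin (2 * n))) M]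

/-- The horizontal distance to the center at a point of a Pansu sphere. -/
lemma norm_of_centerOf_eq {lam : ℝ} (hl : 0 < lam) {N c z : E n} {a : ℝ} (hN : ‖N‖ = 1)
    (h : centerOf lam N a z = c) :
    z - c = -((a ^ 2 + lam ^ 2)⁻¹ • (a • J N + lam • N)) ∧
      ‖z - c‖ ^ 2 = (a ^ 2 + lam ^ 2)⁻¹ := by
  have h1 : z - c = -((a ^ 2 + lam ^ 2)⁻¹ • (a • J N + lam • N)) := by
    rw [← h, centerOf]; abel
  refine ⟨h1, ?_⟩
  have hp := sq_add_sq_pos hl.ne' a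
  have h2 : ‖a • J N + lam • N‖ ^ 2 = a ^ 2 + lam ^ 2 := by
    rw [← real_inner_self_eq_norm_sq]
    simp only [inner_add_left, inner_add_right, inner_smul_left, inner_smul_right, inner_J_self,
      inner_self_J, real_inner_self_eq_norm_sq, norm_J, hN, conj_trivial]
    ring
  rw [h1, norm_neg, norm_smul, mul_pow, h2, norm_inv, Real.norm_of_nonneg hp.le]
  field_simp

/-- Of a frame and its opposite, the one matching e supplies N and a at the point. -/
lemma pansuPart_data {ι : M → H n} (himm : IsImmersedHypersurface ι)
    (hsmooth : IsSmoothOnRegularPart ι) {lam : ℝ} {c : E n} {t : ℝ} {q : M}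
    (hq : q ∈ pansuPart ι lam c t) : ∃ N a, ‖N‖ = 1 ∧ tangent ι q = tanPlane (ι q) N a ∧
      centerOf lam N a (ι q).1 = c ∧
      (ι q).2 + inner ℝ (J c) (ι q).1 - heightFun lam a = t := by
  obtain ⟨U, e, hqU, hU, h⟩ := hq
  obtain ⟨-, h2, h3⟩ := h q hqU
  obtain ⟨B, V, N, a, hqB, hf⟩ := exists_isLocalFrame himm hsmooth (hU.2.1 hqU)
  have key : ∀ {N : H n → E n} {a : H n → ℝ}, IsLocalFrame ι B V N a → e q = -J (N (ι q)) →
      ∃ N a, ‖N‖ = 1 ∧ tangent ι q = tanPlane (ι q) N a ∧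
      centerOf lam N a (ι q).1 = c ∧
      (ι q).2 + inner ℝ (J c) (ι q).1 - heightFun lam a = t := by
    intro N a hf he
    have hN : horNormal e q = N (ι q) := by simp [horNormal, he, J_J]
    rw [hN, hf.alpha_eq hqB he] at h2
    rw [hf.alpha_eq hqB he] at h3
    exact ⟨_, _, hf.norm_N _ (hf.mapsTo hqB), hf.tangent_eq q hqB, h2, h3⟩
  rcases hf.charField_eq_or hU hqB hqU with h4 | h4
  · exact key hf h4
  · exact key hf.neg (by rw [h4, map_neg, neg_neg])

lemma pansuPart_ne_center {ι : M → H n} (himm : IsImmersedHypersurface ι)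
    (hsmooth : IsSmoothOnRegularPart ι) {lam : ℝ} (hl : 0 < lam) {c : E n} {t : ℝ} {q : M}
    (hq : q ∈ pansuPart ι lam c t) : (ι q).1 ≠ c := by
  obtain ⟨N, a, hN, -, hc, -⟩ := pansuPart_data himm hsmooth hq
  have h1 := (norm_of_centerOf_eq hl hN hc).2
  intro h0
  rw [h0, sub_self, norm_zero] at h1
  have := inv_pos.2 (sq_add_sq_pos hl.ne' a)
  rw [← h1] at this
  norm_num at this

/-- Small punctured neighborhoods of a point of a manifold of dimension at least two are
connected. -/
lemma exists_isPreconnected_diff_singleton (hn : 2 ≤ n) {p : M} {W : Set M} (hW : W ∈ 𝓝 p) :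
    ∃ W' ⊆ W, IsOpen W' ∧ p ∈ W' ∧ IsPreconnected (W' \ {p}) := by
  set e := chartAt (EuclideanSpace ℝ (Fin (2 * n))) p with he
  have hpe : p ∈ e.source := mem_chart_source _ p
  have hopen : IsOpen (e.target ∩ e.symm ⁻¹' interior W) :=
    e.isOpen_inter_preimage_symm isOpen_interior
  obtain ⟨r, hr, hball⟩ := Metric.isOpen_iff.1 hopen (e p)
    ⟨e.map_source hpe, by rw [mem_preimage, e.left_inv hpe]; exact mem_interior_iff_mem_nhds.2 hW⟩
  set ψ := OpenPartialHomeomorph.univBall (E := EuclideanSpace ℝ (Fin (2 * n))) (e p) r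
  have hψs : ψ.source = univ := OpenPartialHomeomorph.univBall_source _ _
  have hψt : ψ.target = Metric.ball (e p) r := OpenPartialHomeomorph.univBall_target _ hr
  have hψ0 : ψ 0 = e p := OpenPartialHomeomorph.univBall_apply_zero _ _
  have hbt : Metric.ball (e p) r ⊆ e.target := fun x hx => (hball hx).1
  refine ⟨e.symm '' Metric.ball (e p) r, ?_, ?_, ?_, ?_⟩
  · rintro _ ⟨x, hx, rfl⟩
    exact interior_subset (hball hx).2
  · exact e.symm.isOpen_image_of_subset_source Metric.isOpen_ball hbt
  · exact ⟨e p, Metric.mem_ball_self hr, e.left_inv hpe⟩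
  · have hset : e.symm '' Metric.ball (e p) r \ {p} = (fun x => e.symm (ψ x)) '' {0}ᶜ := by
      ext q
      constructor
      · rintro ⟨⟨x, hx, rfl⟩, hne⟩
        have hx' : x ∈ ψ.target := by rwa [hψt]
        refine ⟨ψ.symm x, fun h0 => hne ?_, by simp only [ψ.right_inv hx']⟩
        rw [mem_singleton_iff] at h0 ⊢
        rw [← ψ.right_inv hx', h0, hψ0, e.left_inv hpe]
      · rintro ⟨x, hx, rfl⟩
        have hx' : x ∈ ψ.source := by rw [hψs]; trivial
        have hmem : ψ x ∈ Metric.ball (e p) r := by rw [← hψt]; exact ψ.map_source hx'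
        refine ⟨⟨ψ x, hmem, rfl⟩, fun h0 => hx ?_⟩
        rw [mem_singleton_iff] at h0 ⊢
        have h1 : ψ x = e p := by
          have h0' : e.symm (ψ x) = p := h0
          rw [← e.right_inv (hbt hmem), h0']
        refine ψ.injOn hx' (by rw [hψs]; trivial) ?_
        rw [h1, hψ0]
    rw [hset]
    have hrank : 1 < Module.rank ℝ (EuclideanSpace ℝ (Fin (2 * n))) :=
      Module.one_lt_rank_of_one_lt_finrank (by rw [finrank_euclideanSpace_fin]; omega)
    refine (isConnected_compl_singleton_of_one_lt_rank hrank 0).isPreconnected.image _ ?_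
    have hψc : ContinuousOn ψ univ := by rw [← hψs]; exact ψ.continuousOn
    refine e.symm.continuousOn.comp (hψc.mono (subset_univ _)) fun x _ => hbt ?_
    rw [← hψt]
    exact ψ.map_source (by rw [hψs]; trivial)

variable [IsManifold (𝓡 (2 * n)) 2 M]

/-- The contact form as a continuous linear form. -/
def contactCLM (q : H n) : H n →L[ℝ] ℝ :=
  ContinuousLinearMap.snd ℝ (E n) ℝ + (innerSL ℝ (JL q.1)).comp (ContinuousLinearMap.fst ℝ (E n) ℝ)

lemma contactCLM_apply (q v : H n) : contactCLM q v = contactForm q v := by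
  rw [contactForm_eq]
  simp [contactCLM]

lemma continuous_contactCLM : Continuous (contactCLM (n := n)) := by
  unfold contactCLM
  fun_prop

/-- Near a singular point, a tangent vector of `Σ` that is not horizontal is long. -/
lemma exists_bound_of_singular {ι : M → H n} (himm : IsImmersedHypersurface ι) {p : M}
    (hp : p ∉ regularSet ι) (C : ℝ) :
    ∀ᶠ q in 𝓝 p, ∀ X ∈ tangent ι q, ‖X‖ ≤ C → contactForm (ι q) X ≠ 1 := by
  set e := chartAt (EuclideanSpace ℝ (Fin (2 * n))) p with he
  have hpe : p ∈ e.source := mem_chart_source _ p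
  have hxt : e p ∈ e.target := e.map_source hpe
  have hval : localMap ι p (e p) = ι p := by rw [localMap, e.left_inv hpe]
  set L := fderiv ℝ (localMap ι p) with hL
  have hcL : ContinuousAt L (e p) :=
    (((contDiffOn_localMap himm p).contDiffAt (e.open_target.mem_nhds hxt)).fderiv_right
        (m := 0) (by norm_num)).continuousAt
  have hcm : ContinuousAt (localMap ι p) (e p) :=
    ((contDiffOn_localMap himm p).contDiffAt (e.open_target.mem_nhds hxt)).continuousAt
  -- The differential at p is bounded below by 1/K, nearby ones by 1/(2K). As Θ∘dι vanishes at p, it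
  -- has norm below 1/(2K(|C| + 1)) near p, so |Θ(X)| ≤ |C|/(|C| + 1) < 1 when ‖X‖ ≤ C.
  obtain ⟨K, hK, hKL⟩ := LinearMap.exists_antilipschitzWith (L (e p)).toLinearMap
    (LinearMap.ker_eq_bot.2 (fderiv_localMap himm p hxt).1)
  have hK0 : (0 : ℝ) < K := hK
  have hbound : ∀ y, ‖y‖ ≤ K * ‖L (e p) y‖ := fun y => by
    have := hKL.le_mul_dist y 0
    simpa using this
  have h1 : ∀ᶠ x in 𝓝 (e p), ‖L x - L (e p)‖ < 1 / (2 * K) := by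
    have := hcL.eventually (Metric.ball_mem_nhds (L (e p)) (show 0 < 1 / (2 * (K : ℝ)) by positivity))
    filter_upwards [this] with x hx
    rwa [← dist_eq_norm]
  have hΘ : ContinuousAt (fun x => (contactCLM (localMap ι p x)).comp (L x)) (e p) :=
    (continuous_contactCLM.continuousAt.comp hcm).clm_comp hcL
  have hΘ0 : (contactCLM (localMap ι p (e p))).comp (L (e p)) = 0 := by
    ext y
    have h2 := mem_tangent_of_localMap himm p hxt y
    rw [e.left_inv hpe, not_not.1 hp, contactPlane, LinearMap.mem_ker] at h2
    rw [ContinuousLinearMap.comp_apply, contactCLM_apply, hval, h2]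
    rfl
  have h2 : ∀ᶠ x in 𝓝 (e p), ‖(contactCLM (localMap ι p x)).comp (L x)‖
      < 1 / (2 * K * (|C| + 1)) := by
    have h3 : Tendsto (fun x => ‖(contactCLM (localMap ι p x)).comp (L x)‖) (𝓝 (e p)) (𝓝 0) := by
      have := hΘ.norm.tendsto
      rwa [hΘ0, norm_zero] at this
    exact h3.eventually_lt_const (by positivity)
  filter_upwards [(e.continuousAt hpe).eventually (h1.and h2), e.open_source.eventually_mem hpe]
    with q hq hqe X hX hXC hX1
  obtain ⟨h3, h4⟩ := hq
  have hr := (fderiv_localMap himm p (e.map_source hqe)).2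
  rw [e.left_inv hqe] at hr
  rw [← hr] at hX
  obtain ⟨y, rfl⟩ := hX
  change ‖L (e q) y‖ ≤ C at hXC
  change contactForm (ι q) (L (e q) y) = 1 at hX1
  have h5 : ‖y‖ ≤ 2 * K * |C| := by
    have e1 : ‖L (e p) y‖ ≤ ‖L (e q) y‖ + ‖(L (e q) - L (e p)) y‖ := by
      rw [sub_apply]
      have := norm_sub_le (L (e q) y) (L (e q) y - L (e p) y)
      rwa [sub_sub_cancel] at this
    have e2 : ‖(L (e q) - L (e p)) y‖ ≤ 1 / (2 * K) * ‖y‖ :=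
      ((L (e q) - L (e p)).le_opNorm y).trans
        (mul_le_mul_of_nonneg_right h3.le (norm_nonneg _))
    have e3 := hbound y
    have e4 : K * ‖L (e p) y‖ ≤ K * (|C| + 1 / (2 * K) * ‖y‖) := by
      have := le_abs_self C
      gcongr
      linarith
    have e5 : K * (|C| + 1 / (2 * K) * ‖y‖) = K * |C| + ‖y‖ / 2 := by
      field_simp
    linarith
  have h6 : (1 : ℝ) ≤ ‖(contactCLM (localMap ι p (e q))).comp (L (e q))‖ * ‖y‖ := by
    have := ((contactCLM (localMap ι p (e q))).comp (L (e q))).le_opNorm y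
    have hvq : localMap ι p (e q) = ι q := congrArg ι (e.left_inv hqe)
    rw [ContinuousLinearMap.comp_apply, contactCLM_apply, hvq, hX1, norm_one] at this
    rwa [hvq]
  have h7 : ‖(contactCLM (localMap ι p (e q))).comp (L (e q))‖ * ‖y‖
      ≤ 1 / (2 * K * (|C| + 1)) * (2 * K * |C|) :=
    mul_le_mul h4.le h5 (norm_nonneg _) (by positivity)
  have h8 : 1 / (2 * K * (|C| + 1)) * (2 * K * |C|) = |C| / (|C| + 1) := by
    field_simp
  have h9 : |C| / (|C| + 1) < 1 := by
    rw [div_lt_one (by positivity)]; linarith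
  linarith

/-- Limit points of a piece of a Pansu sphere that are singular lie over the center. -/
lemma eq_center_of_mem_closure {ι : M → H n} (himm : IsImmersedHypersurface ι)
    (hsmooth : IsSmoothOnRegularPart ι) {lam : ℝ} (hl : 0 < lam) {c : E n} {t : ℝ} {p : M}
    (hp : p ∉ regularSet ι) (hcl : p ∈ closure (pansuPart ι lam c t)) : (ι p).1 = c := by
  by_contra hne
  set d := ‖(ι p).1 - c‖ with hd
  have hd0 : 0 < d := norm_pos_iff.2 (sub_ne_zero.2 hne)
  set R := ‖(ι p).1‖ + 1
  have hcont : Continuous fun q => (ι q).1 := himm.1.continuous.fst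
  have h1 : ∀ᶠ q in 𝓝 p, d / 2 < ‖(ι q).1 - c‖ :=
    (hcont.sub continuous_const).norm.continuousAt.eventually
      (lt_mem_nhds (show d / 2 < ‖(ι p).1 - c‖ by rw [← hd]; linarith))
  have h2 : ∀ᶠ q in 𝓝 p, ‖(ι q).1‖ < R :=
    hcont.norm.continuousAt.eventually (gt_mem_nhds (show ‖(ι p).1‖ < ‖(ι p).1‖ + 1 by linarith))
  -- The constant bounds aN + T: its horizontal part is at most 2/d and its vertical part at most
  -- 2R/d + 1.
  have h3 := exists_bound_of_singular himm hp (2 / d + (2 / d * R + 1))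
  obtain ⟨q, hq, h4, h5, h6⟩ := ((mem_closure_iff_frequently.1 hcl).and_eventually
    (h1.and (h2.and h3))).exists
  obtain ⟨N, a, hN, htan, hc, -⟩ := pansuPart_data himm hsmooth hq
  have hnorm := (norm_of_centerOf_eq hl hN hc).2
  -- From a² + λ² = |z - c|⁻² and |z - c| > d/2.
  have ha : |a| ≤ 2 / d := by
    have hp := sq_add_sq_pos hl.ne' a
    have e1 : (d / 2) ^ 2 * (a ^ 2 + lam ^ 2) < 1 := by
      have : (d / 2) ^ 2 < (a ^ 2 + lam ^ 2)⁻¹ := by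
        rw [← hnorm]
        exact pow_lt_pow_left₀ h4 (by positivity) two_ne_zero
      calc (d / 2) ^ 2 * (a ^ 2 + lam ^ 2) < (a ^ 2 + lam ^ 2)⁻¹ * (a ^ 2 + lam ^ 2) := by
            gcongr
        _ = 1 := inv_mul_cancel₀ hp.ne'
    have e2 : (d / 2 * a) ^ 2 ≤ 1 := by nlinarith [sq_nonneg (d / 2 * lam)]
    have e3 := (sq_le_one_iff_abs_le_one _).1 e2
    rw [abs_mul, abs_of_pos (by positivity : 0 < d / 2)] at e3
    rw [le_div_iff₀ hd0]
    linarith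
  refine h6 (a • frameVec (ι q) N + T n) (by rw [htan]; exact transverse_mem_tanPlane hN) ?_ ?_
  · have e1 : a • frameVec (ι q) N + T n = (a • N, a * inner ℝ (J N) (ι q).1 + 1) := by
      simp [frameVec_eq, T]
    rw [e1, Prod.norm_def]
    have e2 : ‖a • N‖ ≤ 2 / d := by rw [norm_smul, hN, mul_one]; exact ha
    have hR : 0 ≤ R := by positivity
    have e3 : ‖a * inner ℝ (J N) (ι q).1 + 1‖ ≤ 2 / d * R + 1 := by
      refine (norm_add_le _ _).trans ?_
      rw [norm_one, norm_mul]
      have e4 : ‖inner ℝ (J N) (ι q).1‖ ≤ R := by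
        refine (norm_inner_le_norm _ _).trans ?_
        rw [norm_J, hN, one_mul]
        exact h5.le
      have e5 : ‖a‖ * ‖inner ℝ (J N) (ι q).1‖ ≤ 2 / d * R :=
        mul_le_mul ha e4 (norm_nonneg _) (by positivity)
      linarith
    have e6 : 0 ≤ 2 / d := by positivity
    have e7 : 0 ≤ 2 / d * R := by positivity
    exact max_le (by simp only; linarith) (by simp only; linarith)
  · rw [map_add, map_smul, contactForm_frameVec, contactForm_T, smul_zero, zero_add]

/-- Near a singular point the hypersurface is a graph over the horizontal plane. -/
lemma exists_horizontal_chart {ι : M → H n} (himm : IsImmersedHypersurface ι) {p : M}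
    (hp : p ∉ regularSet ι) (c : E n) :
    ∃ φ : OpenPartialHomeomorph (EuclideanSpace ℝ (Fin (2 * n))) (E n),
      chartAt (EuclideanSpace ℝ (Fin (2 * n))) p p ∈ φ.source ∧
        ∀ x, φ x = (localMap ι p x).1 - c := by
  set e := chartAt (EuclideanSpace ℝ (Fin (2 * n))) p with he
  have hpe : p ∈ e.source := mem_chart_source _ p
  have hxt : e p ∈ e.target := e.map_source hpe
  have hcd := (contDiffOn_localMap himm p).contDiffAt (e.open_target.mem_nhds hxt)
  have hd := (hcd.differentiableAt (by norm_num)).hasFDerivAt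
  refine exists_openPartialHomeomorph ?_
    ((contDiffAt_fst.comp _ (hcd.of_le (by norm_num))).sub contDiffAt_const)
    (hd.fst.sub_const c) fun y hy => ?_
  · rw [finrank_euclideanSpace_fin, finrank_euclideanSpace]
    simp
    ring
  · have h1 := mem_tangent_of_localMap himm p hxt y
    rw [e.left_inv hpe, not_not.1 hp, contactPlane, LinearMap.mem_ker, contactForm_eq] at h1
    have h2 : (fderiv ℝ (localMap ι p) (e p) y).1 = 0 := hy
    rw [h2, inner_zero_right, add_zero] at h1
    refine (fderiv_localMap himm p hxt).1 ?_
    rw [map_zero]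
    exact Prod.ext h2 h1

/-- The contact plane contains no vertical vector, so near a singular point the horizontal
projection is injective. -/
lemma eventually_ne_of_singular {ι : M → H n} (himm : IsImmersedHypersurface ι) {p : M}
    (hp : p ∉ regularSet ι) : ∀ᶠ q in 𝓝 p, (ι q).1 = (ι p).1 → q = p := by
  obtain ⟨φ, hφ, hφ'⟩ := exists_horizontal_chart himm hp 0
  set e := chartAt (EuclideanSpace ℝ (Fin (2 * n))) p with he
  have hpe : p ∈ e.source := mem_chart_source _ p
  filter_upwards [(e.continuousAt hpe).eventually (φ.open_source.mem_nhds hφ),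
    e.open_source.mem_nhds hpe] with q hq hqe hqp
  refine e.injOn hqe hpe (φ.injOn hq hφ ?_)
  rw [hφ', hφ', localMap, localMap, e.left_inv hqe, e.left_inv hpe, hqp]

/-- A closed connected umbilic hypersurface is a piece of a Pansu sphere near all its regular
points, and its singular points lie over the center. -/
lemma mem_pansuPart_or [PreconnectedSpace M] (hn : 2 ≤ n) {ι : M → H n}
    (himm : IsImmersedHypersurface ι) (hsmooth : IsSmoothOnRegularPart ι) (humb : IsUmbilic ι)
    (hlk : EllEqTwoK ι) {lam : ℝ} (hl : 0 < lam) {c : E n} {t : ℝ}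
    (hne : (pansuPart ι lam c t).Nonempty) :
    closure (pansuPart ι lam c t) = univ ∧
      ∀ p, p ∈ pansuPart ι lam c t ∨ (p ∉ regularSet ι ∧ (ι p).1 = c) := by
  have hdich : ∀ p ∈ closure (pansuPart ι lam c t),
      p ∈ pansuPart ι lam c t ∨ (p ∉ regularSet ι ∧ (ι p).1 = c) := by
    intro p hp
    by_cases hreg : p ∈ regularSet ι
    · exact Or.inl (mem_pansuPart_of_mem_closure hn himm hsmooth humb hlk hl hreg hp)
    · exact Or.inr ⟨hreg, eq_center_of_mem_closure himm hsmooth hl hreg hp⟩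
  have hopenA := isOpen_pansuPart ι lam c t
  have hopen : IsOpen (closure (pansuPart ι lam c t)) := by
    rw [isOpen_iff_mem_nhds]
    intro p hp
    rcases hdich p hp with h1 | ⟨hreg, hc⟩
    · exact mem_of_superset (hopenA.mem_nhds h1) subset_closure
    · obtain ⟨W, hW, hWo, hpW, hWc⟩ :=
        exists_isPreconnected_diff_singleton hn (eventually_ne_of_singular himm hreg)
      -- No point of the punctured neighborhood lies over c, so the piece is relatively closed there
      -- as well as open, and it is nonempty because p is a limit point.
      have hsub : W \ {p} ⊆ pansuPart ι lam c t := by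
        refine hWc.subset_of_closure_inter_subset hopenA ?_ ?_
        · obtain ⟨q, hq, hqW⟩ := ((mem_closure_iff_frequently.1 hp).and_eventually
            (hWo.mem_nhds hpW)).exists
          refine ⟨q, ⟨hqW, fun h0 => ?_⟩, hq⟩
          rw [mem_singleton_iff] at h0
          rw [h0] at hq
          exact hreg (pansuPart_subset _ _ _ _ hq)
        · rintro q ⟨hq, hqW, hqp⟩
          rcases hdich q hq with h1 | ⟨-, h2⟩
          · exact h1
          · exact absurd (hW hqW (by rw [h2, hc])) hqp
      filter_upwards [hWo.mem_nhds hpW] with q hq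
      by_cases hqp : q = p
      · rw [hqp]; exact hp
      · exact subset_closure (hsub ⟨hq, hqp⟩)
  have huniv : closure (pansuPart ι lam c t) = univ :=
    IsClopen.eq_univ ⟨isClosed_closure, hopen⟩ hne.closure
  exact ⟨huniv, fun p => hdich p (by rw [huniv]; trivial)⟩

end Closure
end Heis

namespace Heis

open Set Filter Topology

/-! ### The Pansu sphere in terms of latitude. -/

section Profile

/-- The height on the Pansu sphere as a function of the latitude. -/
def latHeight (lam b : ℝ) : ℝ := 1 / (2 * lam ^ 2) * (b + Real.sin b * Real.cos b)

lemma continuous_latHeight (lam : ℝ) : Continuous (latHeight lam) := by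
  unfold latHeight
  fun_prop

lemma latHeight_neg (lam b : ℝ) : latHeight lam (-b) = -latHeight lam b := by
  simp only [latHeight, Real.sin_neg, Real.cos_neg]
  ring

lemma strictMonoOn_latHeight {lam : ℝ} (hl : 0 < lam) :
    StrictMonoOn (latHeight lam) (Icc (-(Real.pi / 2)) (Real.pi / 2)) := by
  refine strictMonoOn_of_deriv_pos (convex_Icc _ _) (continuous_latHeight lam).continuousOn
    fun b hb => ?_
  rw [interior_Icc] at hb
  have h1 : HasDerivAt (latHeight lam) (1 / (2 * lam ^ 2) *
      (1 + (Real.cos b * Real.cos b + Real.sin b * -Real.sin b))) b :=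
    ((hasDerivAt_id b).add ((Real.hasDerivAt_sin b).mul (Real.hasDerivAt_cos b))).const_mul _
  rw [h1.deriv]
  have h2 := Real.cos_pos_of_mem_Ioo hb
  have h3 := Real.sin_sq_add_cos_sq b
  have h4 : 1 + (Real.cos b * Real.cos b + Real.sin b * -Real.sin b) = 2 * Real.cos b ^ 2 := by
    linarith
  rw [h4]
  positivity

lemma latHeight_zero (lam : ℝ) : latHeight lam 0 = 0 := by simp [latHeight]

/-- The substitution b = arctan(a/λ) turns slope into latitude, since sin b cos b = aλ/(a² + λ²). -/
lemma heightFun_eq_latHeight {lam : ℝ} (hl : 0 < lam) (a : ℝ) :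
    heightFun lam a = latHeight lam (Real.arctan (a / lam)) := by
  rw [heightFun, latHeight, Real.sin_arctan, Real.cos_arctan]
  congr 2
  have h1 : 0 < 1 + (a / lam) ^ 2 := by positivity
  have h2 := Real.mul_self_sqrt h1.le
  have hp := sq_add_sq_pos hl.ne' a
  have h3 : a / lam / √(1 + (a / lam) ^ 2) * (1 / √(1 + (a / lam) ^ 2))
      = a / lam / (√(1 + (a / lam) ^ 2) * √(1 + (a / lam) ^ 2)) := by
    field_simp
  rw [h3, h2]
  field_simp
  ring

/-- The Pansu sphere, parametrized by the latitude. -/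
def latSphere (n : ℕ) (lam : ℝ) : Set (H n) :=
  {q | ∃ b ∈ Icc (-(Real.pi / 2)) (Real.pi / 2), lam * ‖q.1‖ = Real.cos b ∧ q.2 = latHeight lam b}

variable {n : ℕ}

/-- The height is strictly increasing in the latitude, hence determines the radius. This excludes
dilations at regular points. -/
lemma norm_eq_of_mem_latSphere {lam : ℝ} (hl : 0 < lam) {q q' : H n} (hq : q ∈ latSphere n lam)
    (hq' : q' ∈ latSphere n lam) (h : q.2 = q'.2) : ‖q.1‖ = ‖q'.1‖ := by
  obtain ⟨b, hb, h1, h2⟩ := hq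
  obtain ⟨b', hb', h1', h2'⟩ := hq'
  have : b = b' := (strictMonoOn_latHeight hl).injOn hb hb' (by rw [← h2, ← h2', h])
  subst this
  exact mul_left_cancel₀ hl.ne' (h1.trans h1'.symm)

lemma lat_nonneg {lam : ℝ} (hl : 0 < lam) {b : ℝ} (hb : b ∈ Icc (-(Real.pi / 2)) (Real.pi / 2))
    (h : 0 ≤ latHeight lam b) : 0 ≤ b := by
  by_contra! hneg
  have h0 : (0 : ℝ) ∈ Icc (-(Real.pi / 2)) (Real.pi / 2) := by
    constructor <;> linarith [Real.pi_pos]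
  have := strictMonoOn_latHeight hl hb h0 hneg
  rw [latHeight_zero] at this
  linarith

lemma lat_nonpos {lam : ℝ} (hl : 0 < lam) {b : ℝ} (hb : b ∈ Icc (-(Real.pi / 2)) (Real.pi / 2))
    (h : latHeight lam b ≤ 0) : b ≤ 0 := by
  have hb' : -b ∈ Icc (-(Real.pi / 2)) (Real.pi / 2) := ⟨by linarith [hb.2], by linarith [hb.1]⟩
  have := lat_nonneg hl hb' (by rw [latHeight_neg]; linarith)
  linarith

/-- The radius gives the latitude up to sign, and the height has the sign of the latitude. This
serves near the poles, where the radius is the natural coordinate. -/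
lemma height_eq_of_mem_latSphere {lam : ℝ} (hl : 0 < lam) {q q' : H n} (hq : q ∈ latSphere n lam)
    (hq' : q' ∈ latSphere n lam) (h : ‖q.1‖ = ‖q'.1‖) (hs : 0 < q.2 * q'.2) : q.2 = q'.2 := by
  obtain ⟨b, hb, h1, h2⟩ := hq
  obtain ⟨b', hb', h1', h2'⟩ := hq'
  have hc : Real.cos b = Real.cos b' := by rw [← h1, ← h1', h]
  have hp := Real.pi_pos
  rw [h2, h2'] at hs ⊢
  congr 1
  rcases pos_and_pos_or_neg_and_neg_of_mul_pos hs with ⟨h3, h4⟩ | ⟨h3, h4⟩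
  · exact Real.injOn_cos ⟨lat_nonneg hl hb h3.le, by linarith [hb.2]⟩
      ⟨lat_nonneg hl hb' h4.le, by linarith [hb'.2]⟩ hc
  · have := Real.injOn_cos (x₁ := -b) (x₂ := -b')
      ⟨by linarith [lat_nonpos hl hb h3.le], by linarith [hb.1]⟩
      ⟨by linarith [lat_nonpos hl hb' h4.le], by linarith [hb'.1]⟩ (by simp [hc])
    linarith

lemma height_ne_zero_of_mem_latSphere {lam : ℝ} (hl : 0 < lam) {q : H n}
    (hq : q ∈ latSphere n lam) (h : q.1 = 0) : q.2 ≠ 0 := by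
  obtain ⟨b, hb, h1, h2⟩ := hq
  rw [h, norm_zero, mul_zero] at h1
  intro h0
  rw [h2] at h0
  have h3 := lat_nonneg hl hb h0.ge
  have h4 := lat_nonpos hl hb h0.le
  have : b = 0 := le_antisymm h4 h3
  rw [this, Real.cos_zero] at h1
  norm_num at h1

/-- The latitude parametrization describes the two graphs of the Pansu sphere. -/
lemma latSphere_eq_pansuSphere {lam : ℝ} (hl : 0 < lam) : latSphere n lam = pansuSphere n lam := by
  have hp := Real.pi_pos
  have hfun : ∀ (z : E n) (b : ℝ), 0 ≤ b → b ≤ Real.pi / 2 → lam * ‖z‖ = Real.cos b →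
      pansuFun lam z = latHeight lam b := by
    intro z b h0 h1 h2
    have h3 : lam ^ 2 * ‖z‖ ^ 2 = Real.cos b ^ 2 := by rw [← h2]; ring
    have h4 : √(1 - Real.cos b ^ 2) = Real.sin b := by
      rw [← Real.sin_sq, Real.sqrt_sq (Real.sin_nonneg_of_nonneg_of_le_pi h0 (by linarith))]
    rw [pansuFun, latHeight, h3, h4, h2, Real.arccos_cos h0 (by linarith)]
    ring
  ext q
  constructor
  · rintro ⟨b, hb, h1, h2⟩
    refine ⟨?_, ?_⟩
    · rw [le_div_iff₀ hl, mul_comm, h1]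
      exact Real.cos_le_one b
    · rcases le_total 0 b with h | h
      · left
        rw [hfun q.1 b h hb.2 h1, h2]
      · right
        rw [hfun q.1 (-b) (by linarith) (by linarith [hb.1]) (by rw [Real.cos_neg, h1]), h2,
          latHeight_neg, neg_neg]
  · rintro ⟨h1, h2⟩
    rw [le_div_iff₀ hl, mul_comm] at h1
    have h0 : 0 ≤ lam * ‖q.1‖ := by positivity
    have hc : Real.cos (Real.arccos (lam * ‖q.1‖)) = lam * ‖q.1‖ :=
      Real.cos_arccos (by linarith) h1
    have ha0 := Real.arccos_nonneg (lam * ‖q.1‖)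
    have ha1 : Real.arccos (lam * ‖q.1‖) ≤ Real.pi / 2 := Real.arccos_le_pi_div_two.2 h0
    have hf := hfun q.1 _ ha0 ha1 hc.symm
    rcases h2 with h2 | h2
    · exact ⟨_, ⟨by linarith, ha1⟩, hc.symm, by rw [h2, hf]⟩
    · exact ⟨-Real.arccos (lam * ‖q.1‖), ⟨by linarith, by linarith⟩, by rw [Real.cos_neg, hc],
        by rw [h2, hf, latHeight_neg]⟩

/-- A map of the plane onto the Pansu sphere, which collapses the sphere of radius `π`. -/
def wrap (lam : ℝ) (x : E n) : H n :=
  ((Real.sinc ‖x‖ / lam) • x, latHeight lam (Real.arcsin (Real.cos ‖x‖)))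

lemma continuous_wrap (lam : ℝ) : Continuous (wrap (n := n) lam) := by
  have := Real.continuous_sinc
  have := continuous_latHeight lam
  have := Real.continuous_arcsin
  unfold wrap
  fun_prop

lemma sinc_mul_self (s : ℝ) : Real.sinc s * s = Real.sin s := by
  by_cases h : s = 0
  · simp [h]
  · rw [Real.sinc_of_ne_zero h, div_mul_cancel₀ _ h]

lemma wrap_mem {lam : ℝ} (hl : 0 < lam) (x : E n) : wrap lam x ∈ latSphere n lam := by
  refine ⟨_, ⟨Real.neg_pi_div_two_le_arcsin _, Real.arcsin_le_pi_div_two _⟩, ?_, rfl⟩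
  rw [Real.cos_arcsin, ← Real.abs_sin_eq_sqrt_one_sub_cos_sq, ← sinc_mul_self, wrap, norm_smul,
    abs_mul, norm_div, Real.norm_of_nonneg hl.le, Real.norm_eq_abs, abs_norm]
  field_simp

/-- On [0, π] this is just the latitude π/2 - s. Writing it as arcsin(cos s) keeps `wrap` in the
sphere on the whole space, so that it can be lifted from a simply connected domain. -/
lemma arcsin_cos_of_mem {s : ℝ} (h0 : 0 ≤ s) (h1 : s ≤ Real.pi) :
    Real.arcsin (Real.cos s) = Real.pi / 2 - s := by
  rw [Real.arcsin_eq_pi_div_two_sub_arccos, Real.arccos_cos h0 h1]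

lemma wrap_surjOn [Nontrivial (E n)] {lam : ℝ} (hl : 0 < lam) {q : H n}
    (hq : q ∈ latSphere n lam) : ∃ x ∈ Metric.closedBall (0 : E n) Real.pi, wrap lam x = q := by
  obtain ⟨b, hb, h1, h2⟩ := hq
  set s := Real.pi / 2 - b with hs
  have hs0 : 0 ≤ s := by linarith [hb.2]
  have hs1 : s ≤ Real.pi := by linarith [hb.1]
  have hcos : Real.cos b = Real.sin s := by rw [hs, Real.sin_pi_div_two_sub]
  have hht : latHeight lam (Real.arcsin (Real.cos s)) = q.2 := by
    rw [arcsin_cos_of_mem hs0 hs1, h2, hs, sub_sub_cancel]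
  -- At a pole any vector of norm s is a preimage; elsewhere the direction is that of q.1.
  by_cases h0 : Real.sin s = 0
  · obtain ⟨x, hx⟩ := exists_norm_eq (E n) hs0
    refine ⟨x, by rw [mem_closedBall_zero_iff, hx]; exact hs1, ?_⟩
    refine Prod.ext ?_ (by rw [wrap, hx]; exact hht)
    have hq0 : q.1 = 0 := by
      rw [hcos, h0] at h1
      exact norm_eq_zero.1 ((mul_eq_zero.1 h1).resolve_left hl.ne')
    rw [hq0, ← norm_eq_zero]
    change ‖(Real.sinc ‖x‖ / lam) • x‖ = 0
    rw [norm_smul, norm_div, hx]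
    have h3 := sinc_mul_self s
    rw [h0] at h3
    rcases mul_eq_zero.1 h3 with h4 | h4 <;> simp [h4]
  · have hpos : 0 < Real.sin s :=
      (Real.sin_nonneg_of_nonneg_of_le_pi hs0 hs1).lt_of_ne (Ne.symm h0)
    have hs2 : s ≠ 0 := by rintro h; rw [h, Real.sin_zero] at h0; exact h0 rfl
    have hn : ‖(lam * s / Real.sin s) • q.1‖ = s := by
      rw [norm_smul, Real.norm_of_nonneg (by positivity)]
      calc lam * s / Real.sin s * ‖q.1‖ = s / Real.sin s * (lam * ‖q.1‖) := by ring
        _ = s := by rw [h1, hcos]; field_simp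
    refine ⟨(lam * s / Real.sin s) • q.1, by rw [mem_closedBall_zero_iff, hn]; exact hs1, ?_⟩
    refine Prod.ext ?_ (by rw [wrap, hn]; exact hht)
    rw [wrap, hn, smul_smul, Real.sinc_of_ne_zero hs2]
    have : Real.sin s / s / lam * (lam * s / Real.sin s) = 1 := by field_simp
    rw [this, one_smul]

/-- `wrap` identifies only points of the bounding sphere. -/
lemma eq_or_norm_eq_of_wrap_eq {lam : ℝ} (hl : 0 < lam) {x y : E n}
    (hx : x ∈ Metric.closedBall (0 : E n) Real.pi) (hy : y ∈ Metric.closedBall (0 : E n) Real.pi)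
    (h : wrap lam x = wrap lam y) : x = y ∨ (‖x‖ = Real.pi ∧ ‖y‖ = Real.pi) := by
  rw [mem_closedBall_zero_iff] at hx hy
  have h2 : latHeight lam (Real.arcsin (Real.cos ‖x‖)) = latHeight lam (Real.arcsin (Real.cos ‖y‖)) :=
    congrArg Prod.snd h
  have h3 := (strictMonoOn_latHeight hl).injOn
    ⟨Real.neg_pi_div_two_le_arcsin _, Real.arcsin_le_pi_div_two _⟩
    ⟨Real.neg_pi_div_two_le_arcsin _, Real.arcsin_le_pi_div_two _⟩ h2
  rw [arcsin_cos_of_mem (norm_nonneg _) hx, arcsin_cos_of_mem (norm_nonneg _) hy] at h3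
  have h4 : ‖x‖ = ‖y‖ := by linarith
  by_cases hpi : ‖x‖ = Real.pi
  · exact Or.inr ⟨hpi, by rw [← h4, hpi]⟩
  left
  by_cases h0 : ‖x‖ = 0
  · rw [norm_eq_zero.1 h0, norm_eq_zero.1 (h4.symm.trans h0)]
  have h5 : (Real.sinc ‖x‖ / lam) • x = (Real.sinc ‖y‖ / lam) • y := congrArg Prod.fst h
  have hsin : 0 < Real.sin ‖x‖ := Real.sin_pos_of_pos_of_lt_pi
    ((norm_nonneg x).lt_of_ne (Ne.symm h0)) (hx.lt_of_ne hpi)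
  rw [← h4] at h5
  refine smul_right_injective (E n) (r := Real.sinc ‖x‖ / lam) ?_ h5
  rw [Real.sinc_of_ne_zero h0]
  positivity

lemma isClosed_latSphere [Nontrivial (E n)] {lam : ℝ} (hl : 0 < lam) :
    IsClosed (latSphere n lam) := by
  have : latSphere n lam = wrap lam '' Metric.closedBall (0 : E n) Real.pi := by
    ext q
    constructor
    · exact fun hq => wrap_surjOn hl hq
    · rintro ⟨x, -, rfl⟩
      exact wrap_mem hl x
  rw [this]
  exact ((isCompact_closedBall _ _).image (continuous_wrap lam)).isClosed

end Profile

/-! ### The Pansu sphere has only trivial connected coverings. -/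

section Covering

variable {n : ℕ} {M : Type*} [TopologicalSpace M]

/-- A Pansu sphere has no nontrivial connected compact coverings. -/
lemma bijective_of_isLocalHomeomorph [T2Space M] [CompactSpace M] [ConnectedSpace M]
    (hn : 1 < Module.rank ℝ (E n)) {lam : ℝ} (hl : 0 < lam) {f : M → latSphere n lam}
    (hf : IsLocalHomeomorph f) : Function.Bijective f := by
  have : Nontrivial (E n) := rank_pos_iff_nontrivial.1 (zero_lt_one.trans hn)
  have cov : IsCoveringMap f := isLocalHomeomorph_iff_isCoveringMap.1 hf
  obtain ⟨p₀⟩ := (inferInstance : Nonempty M)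
  set Q : C(E n, latSphere n lam) :=
    ⟨fun x => ⟨wrap lam x, wrap_mem hl x⟩, (continuous_wrap lam).subtype_mk _⟩ with hQ
  have hsurj : ∀ y : latSphere n lam, ∃ x ∈ Metric.closedBall (0 : E n) Real.pi, Q x = y := by
    intro y
    obtain ⟨x, hx, h⟩ := wrap_surjOn hl y.2
    exact ⟨x, hx, Subtype.ext h⟩
  obtain ⟨x₀, hx₀, hQx₀⟩ := hsurj (f p₀)
  -- `wrap` lifts to M because its domain is a vector space.
  obtain ⟨F, ⟨hF0, hF⟩, -⟩ := cov.existsUnique_continuousMap_lifts Q x₀ p₀ hQx₀.symm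
  have hFQ : ∀ x, f (F x) = Q x := fun x => congrFun hF x
  -- The sphere of radius π is connected and `wrap` collapses it to a point, so the lift is constant
  -- on it and descends to a section of f.
  have hsphere : ∀ x y : E n, ‖x‖ = Real.pi → ‖y‖ = Real.pi → F x = F y := by
    intro x y hx hy
    have hQc : ∀ z : E n, ‖z‖ = Real.pi → wrap lam z = (0, latHeight lam (-(Real.pi / 2))) := by
      intro z hz
      rw [wrap, hz, Real.sinc_of_ne_zero Real.pi_ne_zero]
      simp
    refine cov.eqOn_of_comp_eqOn (isPreconnected_sphere hn (0 : E n) Real.pi)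
      F.continuous.continuousOn (continuousOn_const (c := F y)) (fun z hz => ?_)
      (a := y) (by simpa using hy) rfl (by simpa using hx)
    rw [mem_sphere_zero_iff_norm] at hz
    simp only [Function.comp_apply, hFQ]
    exact Subtype.ext ((hQc z hz).trans (hQc y hy).symm)
  choose r hr hQr using hsurj
  set S : latSphere n lam → M := fun y => F (r y)
  have hSQ : ∀ x ∈ Metric.closedBall (0 : E n) Real.pi, S (Q x) = F x := by
    intro x hx
    rcases eq_or_norm_eq_of_wrap_eq hl (hr (Q x)) hx (congrArg Subtype.val (hQr (Q x))) with h | h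
    · exact congrArg F h
    · exact hsphere _ _ h.1 h.2
  -- By compactness the closed ball maps onto the Pansu sphere by a closed map, so preimages of
  -- closed sets under the section are closed.
  have hS : Continuous S := by
    rw [continuous_iff_isClosed]
    intro C hC
    have : S ⁻¹' C = Q '' (Metric.closedBall (0 : E n) Real.pi ∩ F ⁻¹' C) := by
      ext y
      constructor
      · intro hy
        exact ⟨r y, ⟨hr y, hy⟩, hQr y⟩
      · rintro ⟨x, ⟨hx, hxC⟩, rfl⟩
        rw [mem_preimage, hSQ x hx]
        exact hxC
    rw [this]
    exact (((isCompact_closedBall _ _).inter_right (hC.preimage F.continuous)).image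
      Q.continuous).isClosed
  have hfS : ∀ y, f (S y) = y := fun y => by rw [hFQ, hQr]
  -- Both sides lift f and agree at p₀; connectedness of M makes them equal.
  have hSf : S ∘ f = id := by
    refine cov.eq_of_comp_eq (hS.comp hf.continuous) continuous_id ?_ p₀ ?_
    · funext m
      exact hfS (f m)
    · change S (f p₀) = p₀
      rw [← hQx₀, hSQ x₀ hx₀, hF0]
  exact ⟨fun m m' h => by rw [← id_eq m, ← hSf, ← id_eq m', ← hSf, Function.comp_apply, h]; rfl,
    fun y => ⟨S y, hfS y⟩⟩

lemma isLocalHomeomorph_of_injOn {X Y : Type*} [TopologicalSpace X] [TopologicalSpace Y]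
    {f : X → Y} (hf : Continuous f) (hinj : ∀ p, ∃ U ∈ 𝓝 p, InjOn f U)
    (hopen : ∀ p, 𝓝 (f p) ≤ map f (𝓝 p)) : IsLocalHomeomorph f := by
  have ho : IsOpenMap f := IsOpenMap.of_nhds_le hopen
  rw [isLocalHomeomorph_iff_isOpenEmbedding_restrict]
  intro p
  obtain ⟨U, hU, hUi⟩ := hinj p
  refine ⟨interior U, isOpen_interior.mem_nhds (mem_interior_iff_mem_nhds.2 hU), ?_⟩
  exact IsOpenEmbedding.of_continuous_injective_isOpenMap (hf.comp continuous_subtype_val)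
    ((hUi.mono interior_subset).injective) (ho.domRestrict isOpen_interior)

end Covering
end Heis

namespace Heis

open Set Filter Topology

/-! ### The recentered immersion covers the Pansu sphere. -/

section Global

variable {n : ℕ} {M : Type*} [TopologicalSpace M] [ChartedSpace (EuclideanSpace ℝ (Fin (2 * n))) M]

/-- The left translation that moves the point over `c` at height `t` to the origin. -/
def recenter (c : E n) (t : ℝ) (q : H n) : H n := (q.1 - c, q.2 + inner ℝ (J c) q.1 - t)

lemma mul_eq_recenter (c : E n) (t : ℝ) (q : H n) : mul (-c, -t) q = recenter c t q := by
  rw [mul_eq, recenter]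
  refine Prod.ext ?_ ?_
  · simp only []; abel
  · simp only [map_neg, inner_neg_left]; ring

lemma continuous_recenter (c : E n) (t : ℝ) : Continuous (recenter c t) := by
  unfold recenter
  fun_prop

/-- The latitude is arctan(a/λ), whose cosine λ(a² + λ²)^{-1/2} equals λ|z - c|. -/
lemma recenter_mem_latSphere {ι : M → H n} (himm : IsImmersedHypersurface ι)
    (hsmooth : IsSmoothOnRegularPart ι) {lam : ℝ} (hl : 0 < lam) {c : E n} {t : ℝ} {q : M}
    (hq : q ∈ pansuPart ι lam c t) : recenter c t (ι q) ∈ latSphere n lam := by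
  obtain ⟨N, a, hN, -, hc, ht⟩ := pansuPart_data himm hsmooth hq
  have h1 := (norm_of_centerOf_eq hl hN hc).2
  refine ⟨Real.arctan (a / lam), ⟨(Real.neg_pi_div_two_lt_arctan _).le,
    (Real.arctan_lt_pi_div_two _).le⟩, ?_, ?_⟩
  · have hp := sq_add_sq_pos hl.ne' a
    have h2 : 0 < Real.cos (Real.arctan (a / lam)) := Real.cos_arctan_pos _
    refine (sq_eq_sq₀ (by positivity) h2.le).1 ?_
    rw [Real.cos_sq_arctan, mul_pow, recenter, h1]
    field_simp
    ring
  · rw [← heightFun_eq_latHeight hl, recenter, ← ht]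
    ring

/-- The local choices of `e_n` with `k = lam` define a global one. -/
lemma exists_global_charField (hn : 2 ≤ n) {ι : M → H n} (himm : IsImmersedHypersurface ι)
    (hsmooth : IsSmoothOnRegularPart ι) {lam : ℝ} (hl : 0 < lam) {c : E n} {t : ℝ}
    (hreg : regularSet ι ⊆ pansuPart ι lam c t) :
    ∃ e : M → E n, IsCharField ι (regularSet ι) e ∧
      ∀ p ∈ regularSet ι, IsUmbilicWith ι e p lam := by
  classical
  choose! U e hpU hU using fun p (hp : p ∈ pansuPart ι lam c t) => hp
  -- Near p this diagonal choice equals e p, because both have the same positive k. Hence it is C¹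
  -- although the pieces were chosen independently.
  set g : M → E n := fun p => e p p
  have heq : regularSet ι = pansuPart ι lam c t :=
    hreg.antisymm (pansuPart_subset ι lam c t)
  have hg : ∀ p ∈ pansuPart ι lam c t, g =ᶠ[𝓝 p] e p := by
    intro p hp
    filter_upwards [(hU p hp).1.1.mem_nhds (hpU p hp)] with q hq
    have hq' : q ∈ pansuPart ι lam c t := ⟨_, _, hq, hU p hp⟩
    exact (charField_unique hn himm hsmooth (hU q hq').1 (hU p hp).1 (hpU q hq') hq
      ((hU q hq').2 q (hpU q hq')).1 ((hU p hp).2 q hq).1 hl hl).2.1.self_of_nhds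
  refine ⟨g, ⟨?_, Subset.rfl, ?_, ?_⟩, ?_⟩
  · rw [heq]; exact isOpen_pansuPart ι lam c t
  · intro p hp
    rw [heq] at hp
    have h1 := (hU p hp).1.2.2.1.contMDiffAt ((hU p hp).1.1.mem_nhds (hpU p hp))
    exact (h1.congr_of_eventuallyEq (hg p hp)).contMDiffWithinAt
  · intro p hp
    rw [heq] at hp
    exact (hU p hp).1.2.2.2 p (hpU p hp)
  · intro p hp
    rw [heq] at hp
    have h1 := ((hU p hp).2 p (hpU p hp)).1
    have h2 : ∀ v, shape ι g p v = shape ι (e p) p v := by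
      intro v
      have h3 : horNormal g =ᶠ[𝓝 p] horNormal (e p) := by
        filter_upwards [hg p hp] with q hq
        rw [horNormal, horNormal, hq]
      rw [shape, shape, nabla, nabla, h3.mfderiv_eq, alpha, alpha, h3.self_of_nhds]
      rfl
    exact ⟨fun v hv => by rw [h2]; exact h1.1 v hv, fun v hv => by rw [h2]; exact h1.2 v hv⟩

variable [IsManifold (𝓡 (2 * n)) 2 M]

/-- Near a regular point, dilating the hypersurface horizontally from the center gives coordinates
of the ambient space. -/
lemma exists_dilation_chart {ι : M → H n} (himm : IsImmersedHypersurface ι)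
    (hsmooth : IsSmoothOnRegularPart ι) {lam : ℝ} (hl : 0 < lam) {c : E n} {t : ℝ} {p : M}
    (hp : p ∈ pansuPart ι lam c t) :
    ∃ φ : OpenPartialHomeomorph (ℝ × EuclideanSpace ℝ (Fin (2 * n))) (H n),
      (1, chartAt (EuclideanSpace ℝ (Fin (2 * n))) p p) ∈ φ.source ∧
        ∀ y, φ y = (y.1 • (recenter c t (localMap ι p y.2)).1,
          (recenter c t (localMap ι p y.2)).2) := by
  set e := chartAt (EuclideanSpace ℝ (Fin (2 * n))) p with he
  have hpe : p ∈ e.source := mem_chart_source _ p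
  have hxt : e p ∈ e.target := e.map_source hpe
  have hval : localMap ι p (e p) = ι p := congrArg ι (e.left_inv hpe)
  have hcd := ((contDiffOn_localMap himm p).contDiffAt (e.open_target.mem_nhds hxt)).of_le
    (show (1 : WithTop ℕ∞) ≤ 2 by norm_num)
  have hd := (hcd.differentiableAt (by norm_num)).hasFDerivAt
  set L := fderiv ℝ (localMap ι p) (e p) with hL
  have hcd' : ContDiffAt ℝ 1 (fun y : ℝ × EuclideanSpace ℝ (Fin (2 * n)) => localMap ι p y.2)
      (1, e p) := ContDiffAt.comp (1, e p) (f := Prod.snd) hcd contDiffAt_snd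
  have hd' : HasFDerivAt (fun y : ℝ × EuclideanSpace ℝ (Fin (2 * n)) => localMap ι p y.2)
      (L.comp (ContinuousLinearMap.snd ℝ ℝ _)) (1, e p) :=
    HasFDerivAt.comp (1, e p) (f := Prod.snd) hd hasFDerivAt_snd
  have hf := (hasFDerivAt_fst (𝕜 := ℝ) (p := ((1 : ℝ), e p))).smul (hd'.fst.sub_const c)
  have hg := (hd'.snd.add (((innerSL ℝ (J c)).hasFDerivAt).comp _ hd'.fst)).sub_const t
  have hfg := hf.prodMk hg
  refine exists_openPartialHomeomorph ?_ ?_ hfg ?_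
  · rw [Module.finrank_prod, Module.finrank_prod, finrank_euclideanSpace_fin,
      finrank_euclideanSpace]
    simp
    ring
  · refine (contDiffAt_fst.smul (hcd'.fst.sub contDiffAt_const)).prodMk
      ((hcd'.snd.add ?_).sub contDiffAt_const)
    exact contDiffAt_const.inner ℝ hcd'.fst
  -- A kernel vector gives a tangent vector with horizontal part -s(z - c) and Θ = 0, hence
  -- orthogonal to N. But ⟨N, z - c⟩ = -λ/(a² + λ²) ≠ 0, so s = 0.
  · rintro ⟨s, y⟩ hsy
    have h1 : (1 : ℝ) • (L y).1 + s • ((ι p).1 - c) = 0 := by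
      rw [← hval]; exact congrArg Prod.fst hsy
    have h2 : (L y).2 + inner ℝ (J c) (L y).1 = 0 := congrArg Prod.snd hsy
    rw [one_smul] at h1
    have h1' : (L y).1 = -(s • ((ι p).1 - c)) := eq_neg_of_add_eq_zero_left h1
    obtain ⟨N, a, hN, htan, hc, -⟩ := pansuPart_data himm hsmooth hp
    have h3 := mem_tangent_of_localMap himm p hxt y
    rw [e.left_inv hpe, htan, mem_tanPlane, contactForm_eq, ← hL] at h3
    have hz := (norm_of_centerOf_eq hl hN hc).1
    have h4 : inner ℝ (J (ι p).1) (L y).1 = inner ℝ (J c) (L y).1 := by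
      have : inner ℝ (J ((ι p).1 - c)) (L y).1 = 0 := by
        rw [h1', inner_neg_right, inner_smul_right, inner_J_self, mul_zero, neg_zero]
      rw [map_sub, inner_sub_left] at this
      linarith
    rw [h4, h2, mul_zero, h1', hz, inner_neg_right, inner_smul_right, inner_neg_right,
      inner_smul_right, inner_add_right, inner_smul_right, inner_smul_right, inner_self_J,
      real_inner_self_eq_norm_sq, hN] at h3
    have hpos := sq_add_sq_pos hl.ne' a
    have h5 : s = 0 := by
      have h6 : s * ((a ^ 2 + lam ^ 2)⁻¹ * lam) = 0 := by linarith
      exact (mul_eq_zero.1 h6).resolve_right (by positivity)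
    have h7 : (L y).1 = 0 := by rw [h1', h5, zero_smul, neg_zero]
    rw [h7, inner_zero_right, add_zero] at h2
    have h8 : y = 0 := by
      refine (fderiv_localMap himm p hxt).1 ?_
      rw [map_zero]
      exact Prod.ext h7 h2
    exact Prod.ext h5 h8

/-- A closed umbilic hypersurface that contains a piece of a Pansu sphere covers it. -/
lemma isLocalHomeomorph_recenter {ι : M → H n} (himm : IsImmersedHypersurface ι)
    (hsmooth : IsSmoothOnRegularPart ι) {lam : ℝ} (hl : 0 < lam) {c : E n} {t : ℝ}
    (hmem : ∀ p, recenter c t (ι p) ∈ latSphere n lam)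
    (hor : ∀ p, p ∈ pansuPart ι lam c t ∨ (p ∉ regularSet ι ∧ (ι p).1 = c)) :
    IsLocalHomeomorph fun p => (⟨recenter c t (ι p), hmem p⟩ : latSphere n lam) := by
  have hcont : Continuous fun p => recenter c t (ι p) :=
    (continuous_recenter c t).comp himm.1.continuous
  refine isLocalHomeomorph_of_injOn (hcont.subtype_mk _) (fun p => ?_) (fun p => ?_)
  · set e := chartAt (EuclideanSpace ℝ (Fin (2 * n))) p with he
    have hpe : p ∈ e.source := mem_chart_source _ p
    rcases hor p with hp | ⟨hp, hc⟩
    · obtain ⟨φ, hφ, hφ'⟩ := exists_dilation_chart himm hsmooth hl hp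
      have hce : ContinuousAt (fun q => ((1 : ℝ), e q)) p :=
        continuousAt_const.prodMk (e.continuousAt hpe)
      refine ⟨_, Filter.inter_mem (hce (φ.open_source.mem_nhds hφ)) (e.open_source.mem_nhds hpe),
        ?_⟩
      rintro q ⟨hq, hqe⟩ q' ⟨hq', hqe'⟩ h
      have h1 : recenter c t (ι q) = recenter c t (ι q') := congrArg Subtype.val h
      have hv : localMap ι p (e q) = ι q := congrArg ι (e.left_inv hqe)
      have hv' : localMap ι p (e q') = ι q' := congrArg ι (e.left_inv hqe')
      have h2 := φ.injOn hq hq' (by simp only [hφ', hv, hv', h1])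
      exact e.injOn hqe hqe' (congrArg Prod.snd h2)
    · obtain ⟨φ, hφ, hφ'⟩ := exists_horizontal_chart himm hp c
      refine ⟨_, Filter.inter_mem ((e.continuousAt hpe) (φ.open_source.mem_nhds hφ))
        (e.open_source.mem_nhds hpe), ?_⟩
      rintro q ⟨hq, hqe⟩ q' ⟨hq', hqe'⟩ h
      have h1 : recenter c t (ι q) = recenter c t (ι q') := congrArg Subtype.val h
      have hv : localMap ι p (e q) = ι q := congrArg ι (e.left_inv hqe)
      have hv' : localMap ι p (e q') = ι q' := congrArg ι (e.left_inv hqe')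
      refine e.injOn hqe hqe' (φ.injOn hq hq' ?_)
      rw [hφ', hφ', hv, hv']
      exact congrArg Prod.fst h1
  · intro W hW
    rw [mem_map] at hW
    obtain ⟨U, hUW, hUo, hpU⟩ := mem_nhds_iff.1 hW
    set e := chartAt (EuclideanSpace ℝ (Fin (2 * n))) p with he
    have hpe : p ∈ e.source := mem_chart_source _ p
    have hxt : e p ∈ e.target := e.map_source hpe
    have hval : localMap ι p (e p) = ι p := congrArg ι (e.left_inv hpe)
    rcases hor p with hp | ⟨hp, hc⟩
    -- A nearby point y of the sphere is a horizontal dilate by s > 0 of a point of Σ at the same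
    -- height. Equal heights force equal radii, so s = 1 and y is in the image.
    · obtain ⟨φ, hφ, hφ'⟩ := exists_dilation_chart himm hsmooth hl hp
      set U' := U ∩ pansuPart ι lam c t
      have hU'o : IsOpen U' := hUo.inter (isOpen_pansuPart ι lam c t)
      set D : Set (ℝ × EuclideanSpace ℝ (Fin (2 * n))) :=
        φ.source ∩ Ioi 0 ×ˢ (e.target ∩ e.symm ⁻¹' U') with hD
      have hDo : IsOpen D := φ.open_source.inter
        (isOpen_Ioi.prod (e.isOpen_inter_preimage_symm hU'o))
      have hpD : (1, e p) ∈ D := by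
        refine ⟨hφ, ⟨(zero_lt_one : (0 : ℝ) < 1), hxt, ?_⟩⟩
        rw [mem_preimage, e.left_inv hpe]
        exact ⟨hpU, hp⟩
      have himg : φ '' D ∈ 𝓝 (recenter c t (ι p)) := by
        refine (φ.isOpen_image_of_subset_source hDo inter_subset_left).mem_nhds
          ⟨_, hpD, ?_⟩
        rw [hφ', hval, one_smul]
      refine mem_of_superset (continuous_subtype_val.continuousAt.preimage_mem_nhds himg) ?_
      rintro ⟨y, hy⟩ ⟨⟨s, x⟩, ⟨-, hs, hx, hxU⟩, hsx⟩
      have hxy : φ (s, x) = y := hsx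
      rw [hφ'] at hxy
      have h1 := norm_eq_of_mem_latSphere hl hy (hmem (e.symm x))
        (by rw [← hxy]; rfl)
      have h2 : s • (recenter c t (ι (e.symm x))).1 = y.1 := congrArg Prod.fst hxy
      have h3 : (recenter c t (ι (e.symm x))).1 ≠ 0 :=
        sub_ne_zero.2 (pansuPart_ne_center himm hsmooth hl hxU.2)
      have h4 : s = 1 := by
        rw [← h2, norm_smul, Real.norm_of_nonneg (le_of_lt hs)] at h1
        exact (mul_eq_right₀ (norm_ne_zero_iff.2 h3)).1 h1
      have h5 : (⟨recenter c t (ι (e.symm x)), hmem _⟩ : latSphere n lam) ∈ W := hUW hxU.1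
      have h6 : recenter c t (ι (e.symm x)) = y := by
        rw [← hxy, h4, one_smul]; rfl
      simpa only [h6] using h5
    -- Over the center a nearby y shares its horizontal part with a point of Σ. The pole has nonzero
    -- height, so nearby both heights have its sign and therefore coincide.
    · obtain ⟨φ, hφ, hφ'⟩ := exists_horizontal_chart himm hp c
      set h₀ := (recenter c t (ι p)).2 with hh₀
      have hh0 : h₀ ≠ 0 := height_ne_zero_of_mem_latSphere hl (hmem p) (sub_eq_zero.2 hc)
      have hh0' : 0 < h₀ * h₀ := mul_self_pos.2 hh0
      set U' := U ∩ {q | 0 < h₀ * (recenter c t (ι q)).2}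
      have hU'o : IsOpen U' :=
        hUo.inter (isOpen_lt continuous_const (continuous_const.mul hcont.snd))
      set D : Set (EuclideanSpace ℝ (Fin (2 * n))) :=
        φ.source ∩ (e.target ∩ e.symm ⁻¹' U') with hD
      have hDo : IsOpen D := φ.open_source.inter (e.isOpen_inter_preimage_symm hU'o)
      have hpD : e p ∈ D := by
        refine ⟨hφ, hxt, ?_⟩
        rw [mem_preimage, e.left_inv hpe]
        exact ⟨hpU, hh0'⟩
      have himg : (fun y : H n => y.1) ⁻¹' (φ '' D) ∩ {y | 0 < h₀ * y.2}
          ∈ 𝓝 (recenter c t (ι p)) := by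
        refine IsOpen.mem_nhds (((φ.isOpen_image_of_subset_source hDo
          inter_subset_left).preimage continuous_fst).inter
            (isOpen_lt continuous_const (continuous_const.mul continuous_snd)))
          ⟨⟨_, hpD, ?_⟩, hh0'⟩
        rw [hφ', hval]
        rfl
      refine mem_of_superset (continuous_subtype_val.continuousAt.preimage_mem_nhds himg) ?_
      rintro ⟨y, hy⟩ ⟨⟨x, ⟨-, hx, hxU⟩, hxy⟩, hys⟩
      have hxy' : φ x = y.1 := hxy
      have hys' : 0 < h₀ * y.2 := hys
      rw [hφ'] at hxy'
      have h1 : (recenter c t (ι (e.symm x))).1 = y.1 := hxy'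
      have h3 : 0 < h₀ * (recenter c t (ι (e.symm x))).2 := hxU.2
      have h2 := height_eq_of_mem_latSphere hl (hmem (e.symm x)) hy (by rw [h1]) (by
        have := mul_pos h3 hys'
        have h4 : h₀ * (recenter c t (ι (e.symm x))).2 * (h₀ * y.2)
          = (h₀ * h₀) * ((recenter c t (ι (e.symm x))).2 * y.2) := by ring
        rw [h4] at this
        exact pos_of_mul_pos_right this hh0'.le)
      have h5 : (⟨recenter c t (ι (e.symm x)), hmem _⟩ : latSphere n lam) ∈ W := hUW hxU.1
      have h6 : recenter c t (ι (e.symm x)) = y := Prod.ext h1 h2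
      simpa only [h6] using h5

end Global
end Heis

end

/-- A closed, connected umbilic hypersurface `ι : M → H_n`, `n ≥ 2`, with `l = 2k` is congruent
with a Pansu sphere `S_λ` with `λ = k`. The function `k` is defined up to the choice of the sign of
`e_n`, and the equation `k = λ` holds for one global choice `e` of `e_n` on the regular part. -/
theorem theorem1p3 (n : ℕ) (hn : 2 ≤ n) (M : Type*) [TopologicalSpace M] [T2Space M]
    [CompactSpace M] [ConnectedSpace M]
    [ChartedSpace (EuclideanSpace ℝ (Fin (2 * n))) M]
    [IsManifold (𝓡 (2 * n)) 2 M]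
    (ι : M → Heis.H n)
    (himm : Heis.IsImmersedHypersurface ι)
    (hsmooth : Heis.IsSmoothOnRegularPart ι)
    (humb : Heis.IsUmbilic ι)
    (hlk : Heis.EllEqTwoK ι) :
    Function.Injective ι ∧
      ∃ lam : ℝ, 0 < lam ∧
        (∃ g : Heis.H n, Heis.mul g '' Set.range ι = Heis.pansuSphere n lam) ∧
        ∃ e : M → Heis.E n, Heis.IsCharField ι (Heis.regularSet ι) e ∧
          ∀ p ∈ Heis.regularSet ι, Heis.IsUmbilicWith ι e p lam := by
  obtain ⟨lam, c, t, p₀, hl, hp₀⟩ :=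
    Heis.exists_mem_pansuPart_of_compact hn himm hsmooth humb hlk
  obtain ⟨hcl, hor⟩ := Heis.mem_pansuPart_or hn himm hsmooth humb hlk hl ⟨p₀, hp₀⟩
  have hrank : 1 < Module.rank ℝ (Heis.E n) :=
    Module.one_lt_rank_of_one_lt_finrank (by rw [finrank_euclideanSpace]; simp; omega)
  have : Nontrivial (Heis.E n) := rank_pos_iff_nontrivial.1 (zero_lt_one.trans hrank)
  have hmem : ∀ p, Heis.recenter c t (ι p) ∈ Heis.latSphere n lam := by
    -- The sphere is closed and the Pansu part is dense, so singular points lie on the sphere too.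
    have h1 : closure (Heis.pansuPart ι lam c t)
        ⊆ (fun p => Heis.recenter c t (ι p)) ⁻¹' Heis.latSphere n lam :=
      closure_minimal (fun p hp => Heis.recenter_mem_latSphere himm hsmooth hl hp)
        ((Heis.isClosed_latSphere hl).preimage
          ((Heis.continuous_recenter c t).comp himm.1.continuous))
    intro p
    exact h1 (by rw [hcl]; trivial)
  obtain ⟨hinj, hsurj⟩ := Heis.bijective_of_isLocalHomeomorph hrank hl
    (Heis.isLocalHomeomorph_recenter himm hsmooth hl hmem hor)
  refine ⟨fun p q h => hinj (Subtype.ext (congrArg (Heis.recenter c t) h)), lam, hl,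
    ⟨(-c, -t), ?_⟩, Heis.exists_global_charField hn himm hsmooth hl fun p hp =>
      (hor p).resolve_right fun h => h.1 hp⟩
  rw [← Heis.latSphere_eq_pansuSphere hl, ← Set.range_comp]
  ext q
  constructor
  · rintro ⟨p, rfl⟩
    rw [Function.comp_apply, Heis.mul_eq_recenter]
    exact hmem p
  · intro hq
    obtain ⟨p, hp⟩ := hsurj ⟨q, hq⟩
    exact ⟨p, by rw [Function.comp_apply, Heis.mul_eq_recenter]; exact congrArg Subtype.val hp⟩
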